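/- Let $\mathcal B$ be a bicategory and let $F\colon \mathcal B^{\mathrm{coop}}\to\mathbf{Bicat}$ be a trihomomorphism into the tricategory of bicategories, homomorphisms (pseudofunctors), pseudo-natural transformations and modifications. Its data are: bicategories $Fx$; pseudofunctors $\mathcal B(x,y)^{\mathrm{op}}\to\mathbf{Bicat}(Fy,Fx)$, $f\mapsto Ff$, $(\alpha\colon f\Rightarrow g)\mapsto(F\alpha\colon Fg\Rightarrow Ff)$, with constraints $\phi$; adjoint equivalences $\chi_{gf}\colon Ff\circ Fg\to F(gf)$, pseudo-natural in $f,g$, and $\iota_x\colon 1_{Fx}\to F(1_x)$; and invertible modifications $\omega,\gamma,\delta$ for associativity and the two units, natural in their indices and satisfying the two coherence axioms (over the pentagon and over the triangle). Define $\mathrm{el}\,F$ as follows. A 0-cell is a pair $(x,\tilde x)$ with $x\in\mathcal B$, $\tilde x\in Fx$. A 1-cell $(x,\tilde x)\to(y,\tilde y)$ is a pair $(f,\tilde f)$ with $f\colon x\to y$ and $\tilde f\colon\tilde x\to Ff(\tilde y)$. A 2-cell $(f,\tilde f)\Rightarrow(g,\tilde g)$ is a pair $(\alpha,\tilde\alpha)$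 with $\alpha\colon f\Rightarrow g$ and $\tilde\alpha\colon \tilde f\Rightarrow F\alpha_{\tilde y}\circ\tilde g$. The composite $(g,\tilde g)(f,\tilde f)$, for $(g,\tilde g)\colon(y,\tilde y)\to(z,\tilde z)$, is $(gf,\ \chi_{gf,\tilde z}\circ Ff(\tilde g)\circ\tilde f)$ and the identity on $(x,\tilde x)$ is $(1_x,\iota_{x,\tilde x})$. Identity 2-cells, vertical and horizontal composition of 2-cells and the associativity and unit constraints have as first components those of $\mathcal B$ and as second components the evident pastings built from $\phi$, $F\alpha$, $\chi$, $\iota$, $\omega$, $\gamma$, $\delta$. Then $\mathrm{el}\,F$ is a bicategory, and the first projection $P_F\colon \mathrm{el}\,F\to\mathcal B$ is a homomorphism that strictly preserves composition and identities and is a fibration of bicategories, that is: 1. for every $e\in\mathrm{el}\,F$ and every 1-cell $f\colon b\to P_Fe$ there is a cartesian 1-cell $h\colon a\to e$ with $P_Fh=f$; 2. each functor $\mathrm{el}\,F(u,v)\to\mathcal B(P_Fu,P_Fv)$ is a (Grothendieck) fibration of categories; 3. the horizontal composite of two cartesian 2-cells (2-cells cartesian for the functors in 2) is cartesian. Here,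 for a homomorphism $P\colon\mathcal E\to\mathcal B$ with composition constraints $\phi_{hf}\colon Pf\circ Ph\cong P(fh)$, a *lift* of $(h\colon Pz\to Px,\ \alpha\colon Pf\circ h\cong Pg)$ along $f\colon x\to y$, where $g\colon z\to y$, is a triple $(\hat h\colon z\to x,\ \hat\alpha\colon f\hat h\cong g,\ \hat\beta\colon P\hat h\cong h)$ with $\alpha\cdot(Pf\,\hat\beta)=P\hat\alpha\cdot\phi_{\hat hf}$. The 1-cell $f$ is *cartesian* if every such $(h,\alpha)$ has a lift and if, for all $\sigma\colon g\Rightarrow g'$, all $(h,\alpha)$, $(h',\alpha')$ over $g,g'$ with lifts $(\hat h,\hat\alpha,\hat\beta)$, $(\hat h',\hat\alpha',\hat\beta')$, and all $\delta\colon h\Rightarrow h'$ with $\alpha'\cdot(Pf\,\delta)=P\sigma\cdot\alpha$, there is a unique $\hat\delta\colon\hat h\Rightarrow\hat h'$ with $\hat\alpha'\cdot(f\hat\delta)=\sigma\cdot\hat\alpha$ and $\delta\cdot\hat\beta=\hat\beta'\cdot P\hat\delta$. Moreover, lifts along cartesian 1-cells of $\mathrm{el}\,F$ can always be chosen with $P_F\hat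 h=h$ and $\hat\beta=1$. The cartesian lifts may be chosen as follows: for $f\colon x\to y$ in $\mathcal B$ and $(y,\tilde y)\in\mathrm{el}\,F$, the 1-cell $(f,1_{Ff(\tilde y)})\colon(x,Ff(\tilde y))\to(y,\tilde y)$ is cartesian; for $(g,\tilde g)\colon(x,\tilde x)\to(y,\tilde y)$ in $\mathrm{el}\,F$ and $\alpha\colon f\Rightarrow g$ in $\mathcal B$, the 2-cell $(\alpha,1)\colon(f,F\alpha_{\tilde y}\circ\tilde g)\Rightarrow(g,\tilde g)$ is cartesian. -/

import Mathlib

open CategoryTheory Bicategory Opposite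
open scoped CategoryTheory.Pseudofunctor.StrongTrans

set_option linter.checkUnivs false

universe w₁ w₂ w₃ w₄ v₁ v₂ v₃ v₄ u₁ u₂ u₃ u₄

/-! ### Horizontal composition of transformations

Composites of homomorphisms are written in diagrammatic order (`G.comp H` is `G` followed by `H`).
Vertical composition of transformations and modifications is Mathlib's bicategory structure on
`X ⥤ᵖ Y`. -/

namespace Tricat

variable {X : Type u₁} [Bicategory.{w₁, v₁} X] {Y : Type u₂} [Bicategory.{w₂, v₂} Y]
  {Z : Type u₃} [Bicategory.{w₃, v₃} Z] {W : Type u₄} [Bicategory.{w₄, v₄} W]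

/-- The transformation with components `η_{K x}`. -/
def whiskerPre (K : X ⥤ᵖ Y) {G H : Y ⥤ᵖ Z} (η : G ⟶ H) : K.comp G ⟶ K.comp H where
  app x := η.app (K.obj x)
  naturality f := η.naturality (K.map f)
  naturality_naturality θ := η.naturality_naturality (K.map₂ θ)
  naturality_id x := by
    change (η.naturality (K.map (𝟙 x))).hom ≫
        η.app (K.obj x) ◁ (H.map₂ (K.mapId x).hom ≫ (H.mapId (K.obj x)).hom) =
      (G.map₂ (K.mapId x).hom ≫ (G.mapId (K.obj x)).hom) ▷ η.app (K.obj x) ≫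
        (λ_ (η.app (K.obj x))).hom ≫ (ρ_ (η.app (K.obj x))).inv
    rw [Bicategory.whiskerLeft_comp, ← η.naturality_naturality_assoc, η.naturality_id,
      comp_whiskerRight, Category.assoc]
  naturality_comp {x y z} f g := by
    change (η.naturality (K.map (f ≫ g))).hom ≫ η.app (K.obj x) ◁
        (H.map₂ (K.mapComp f g).hom ≫ (H.mapComp (K.map f) (K.map g)).hom) =
      (G.map₂ (K.mapComp f g).hom ≫ (G.mapComp (K.map f) (K.map g)).hom) ▷ η.app (K.obj z) ≫
        (α_ _ _ _).hom ≫ G.map (K.map f) ◁ (η.naturality (K.map g)).hom ≫ (α_ _ _ _).inv ≫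
          (η.naturality (K.map f)).hom ▷ H.map (K.map g) ≫ (α_ _ _ _).hom
    rw [Bicategory.whiskerLeft_comp, ← η.naturality_naturality_assoc, η.naturality_comp,
      comp_whiskerRight, Category.assoc]

/-- The transformation with components `K (η_x)`. -/
def whiskerPost {G H : X ⥤ᵖ Y} (η : G ⟶ H) (K : Y ⥤ᵖ Z) : G.comp K ⟶ H.comp K where
  app x := K.map (η.app x)
  naturality {x y} f := (K.mapComp (G.map f) (η.app y)).symm ≪≫ K.map₂Iso (η.naturality f) ≪≫
    K.mapComp (η.app x) (H.map f)
  naturality_naturality {x y f g} θ := by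
    change K.map₂ (G.map₂ θ) ▷ K.map (η.app y) ≫ (K.mapComp (G.map g) (η.app y)).inv ≫
        K.map₂ (η.naturality g).hom ≫ (K.mapComp (η.app x) (H.map g)).hom =
      ((K.mapComp (G.map f) (η.app y)).inv ≫
        K.map₂ (η.naturality f).hom ≫ (K.mapComp (η.app x) (H.map f)).hom) ≫
          K.map (η.app x) ◁ K.map₂ (H.map₂ θ)
    have h := congrArg K.map₂ (η.naturality_naturality θ)
    simp only [PrelaxFunctor.map₂_comp, Pseudofunctor.map₂_whisker_right,
      Pseudofunctor.map₂_whisker_left, Category.assoc] at h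
    simp only [Category.assoc]
    rw [← cancel_epi (K.mapComp (G.map f) (η.app y)).hom,
      ← cancel_mono (K.mapComp (η.app x) (H.map g)).inv]
    simpa using h
  naturality_id x := by
    change ((K.mapComp (G.map (𝟙 x)) (η.app x)).inv ≫ K.map₂ (η.naturality (𝟙 x)).hom ≫
        (K.mapComp (η.app x) (H.map (𝟙 x))).hom) ≫
          K.map (η.app x) ◁ (K.map₂ (H.mapId x).hom ≫ (K.mapId (H.obj x)).hom) =
      (K.map₂ (G.mapId x).hom ≫ (K.mapId (G.obj x)).hom) ▷ K.map (η.app x) ≫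
        (λ_ (K.map (η.app x))).hom ≫ (ρ_ (K.map (η.app x))).inv
    have h := congrArg K.map₂ (η.naturality_id x)
    simp only [PrelaxFunctor.map₂_comp, Pseudofunctor.map₂_whisker_right,
      Pseudofunctor.map₂_whisker_left, Category.assoc] at h
    replace h := (K.mapComp (G.map (𝟙 x)) (η.app x)).inv ≫= h =≫
      (K.mapComp (η.app x) (𝟙 (H.obj x))).hom ≫ K.map (η.app x) ◁ (K.mapId (H.obj x)).hom
    have e : K.map₂ (ρ_ (η.app x)).inv ≫ (K.mapComp (η.app x) (𝟙 (H.obj x))).hom ≫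
        K.map (η.app x) ◁ (K.mapId (H.obj x)).hom = (ρ_ (K.map (η.app x))).inv := by
      rw [K.mapComp_id_right_hom, Category.assoc, ← K.map₂_comp_assoc, Iso.inv_hom_id,
        K.map₂_id, Category.id_comp, Category.assoc, ← Bicategory.whiskerLeft_comp,
        Iso.inv_hom_id, Bicategory.whiskerLeft_id, Category.comp_id]
    simp only [Category.assoc, Iso.inv_hom_id_assoc, Pseudofunctor.map₂_left_unitor, e] at h
    simpa using h
  naturality_comp {x y z} f g := by
    change ((K.mapComp (G.map (f ≫ g)) (η.app z)).inv ≫ K.map₂ (η.naturality (f ≫ g)).hom ≫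
        (K.mapComp (η.app x) (H.map (f ≫ g))).hom) ≫ K.map (η.app x) ◁
          (K.map₂ (H.mapComp f g).hom ≫ (K.mapComp (H.map f) (H.map g)).hom) =
      (K.map₂ (G.mapComp f g).hom ≫ (K.mapComp (G.map f) (G.map g)).hom) ▷ K.map (η.app z) ≫
        (α_ _ _ _).hom ≫ K.map (G.map f) ◁ ((K.mapComp (G.map g) (η.app z)).inv ≫
          K.map₂ (η.naturality g).hom ≫ (K.mapComp (η.app y) (H.map g)).hom) ≫ (α_ _ _ _).inv ≫
            ((K.mapComp (G.map f) (η.app y)).inv ≫ K.map₂ (η.naturality f).hom ≫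
              (K.mapComp (η.app x) (H.map f)).hom) ▷ K.map (H.map g) ≫ (α_ _ _ _).hom
    have h := congrArg K.map₂ (η.naturality_comp f g)
    simp only [PrelaxFunctor.map₂_comp, Pseudofunctor.map₂_whisker_right,
      Pseudofunctor.map₂_whisker_left, Category.assoc] at h
    replace h := (K.mapComp (G.map (f ≫ g)) (η.app z)).inv ≫= h =≫
      (K.mapComp (η.app x) (H.map f ≫ H.map g)).hom ≫
        K.map (η.app x) ◁ (K.mapComp (H.map f) (H.map g)).hom
    have e : (K.mapComp (G.map f) (η.app y ≫ H.map g)).inv ≫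
        K.map₂ (α_ (G.map f) (η.app y) (H.map g)).inv ≫
          (K.mapComp (G.map f ≫ η.app y) (H.map g)).hom =
        K.map (G.map f) ◁ (K.mapComp (η.app y) (H.map g)).hom ≫ (α_ _ _ _).inv ≫
          (K.mapComp (G.map f) (η.app y)).inv ▷ K.map (H.map g) := by
      rw [Iso.inv_comp_eq, K.mapComp_assoc_right_hom_assoc]
      simp
    simpa [reassoc_of% e] using h

/-- Horizontal composition of transformations, with components `α_{G x}` followed by `H' (β_x)`. -/
def hcompTrans {G G' : X ⥤ᵖ Y} {H H' : Y ⥤ᵖ Z} (β : G ⟶ G') (α : H ⟶ H') :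
    G.comp H ⟶ G'.comp H' :=
  whiskerPre G α ≫ whiskerPost β H'

/-- The associativity transformation for composition of homomorphisms. -/
def assocTrans (G : X ⥤ᵖ Y) (H : Y ⥤ᵖ Z) (K : Z ⥤ᵖ W) :
    (G.comp H).comp K ⟶ G.comp (H.comp K) where
  app x := 𝟙 (K.obj (H.obj (G.obj x)))
  naturality f := ρ_ (K.map (H.map (G.map f))) ≪≫ (λ_ (K.map (H.map (G.map f)))).symm
  naturality_naturality {x y f g} θ := by
    change K.map₂ (H.map₂ (G.map₂ θ)) ▷ 𝟙 (K.obj (H.obj (G.obj y))) ≫ (ρ_ (K.map (H.map (G.map g)))).hom ≫ (λ_ (K.map (H.map (G.map g)))).inv =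
      ((ρ_ (K.map (H.map (G.map f)))).hom ≫ (λ_ (K.map (H.map (G.map f)))).inv) ≫ 𝟙 (K.obj (H.obj (G.obj x))) ◁ K.map₂ (H.map₂ (G.map₂ θ))
    simp
  naturality_id x := by
    change ((ρ_ (K.map (H.map (G.map (𝟙 x))))).hom ≫ (λ_ (K.map (H.map (G.map (𝟙 x))))).inv) ≫ 𝟙 (K.obj (H.obj (G.obj x))) ◁
        (K.map₂ (H.map₂ (G.mapId x).hom) ≫ K.map₂ (H.mapId (G.obj x)).hom ≫ (K.mapId (H.obj (G.obj x))).hom) =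
      (K.map₂ (H.map₂ (G.mapId x).hom ≫ (H.mapId (G.obj x)).hom) ≫ (K.mapId (H.obj (G.obj x))).hom) ▷ 𝟙 (K.obj (H.obj (G.obj x))) ≫ (λ_ (𝟙 (K.obj (H.obj (G.obj x))))).hom ≫ (ρ_ (𝟙 (K.obj (H.obj (G.obj x))))).inv
    simp [unitors_equal]
  naturality_comp {x y z} f g := by
    change ((ρ_ (K.map (H.map (G.map (f ≫ g))))).hom ≫ (λ_ (K.map (H.map (G.map (f ≫ g))))).inv) ≫ 𝟙 (K.obj (H.obj (G.obj x))) ◁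
        (K.map₂ (H.map₂ (G.mapComp f g).hom) ≫ K.map₂ (H.mapComp (G.map f) (G.map g)).hom ≫
          (K.mapComp (H.map (G.map f)) (H.map (G.map g))).hom) =
      (K.map₂ (H.map₂ (G.mapComp f g).hom ≫ (H.mapComp (G.map f) (G.map g)).hom) ≫
          (K.mapComp (H.map (G.map f)) (H.map (G.map g))).hom) ▷ 𝟙 (K.obj (H.obj (G.obj z))) ≫ (α_ _ _ _).hom ≫
        K.map (H.map (G.map f)) ◁ ((ρ_ (K.map (H.map (G.map g)))).hom ≫ (λ_ (K.map (H.map (G.map g)))).inv) ≫ (α_ _ _ _).inv ≫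
          ((ρ_ (K.map (H.map (G.map f)))).hom ≫ (λ_ (K.map (H.map (G.map f)))).inv) ▷ K.map (H.map (G.map g)) ≫ (α_ _ _ _).hom
    simp

/-- The unit transformation `1 ≫ G ⟶ G`. -/
def unitTransLeft (G : X ⥤ᵖ Y) : (Pseudofunctor.id X).comp G ⟶ G where
  app x := 𝟙 (G.obj x)
  naturality f := ρ_ (G.map f) ≪≫ (λ_ (G.map f)).symm
  naturality_naturality {x y f g} θ := by
    change G.map₂ θ ▷ 𝟙 (G.obj y) ≫ (ρ_ (G.map g)).hom ≫ (λ_ (G.map g)).inv =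
      ((ρ_ (G.map f)).hom ≫ (λ_ (G.map f)).inv) ≫ 𝟙 (G.obj x) ◁ G.map₂ θ
    simp
  naturality_id x := by
    change ((ρ_ (G.map (𝟙 x))).hom ≫ (λ_ (G.map (𝟙 x))).inv) ≫ 𝟙 (G.obj x) ◁
        ((G.mapId x).hom) =
      (G.map₂ (𝟙 (𝟙 x)) ≫ (G.mapId x).hom) ▷ 𝟙 (G.obj x) ≫ (λ_ (𝟙 (G.obj x))).hom ≫ (ρ_ (𝟙 (G.obj x))).inv
    simp [unitors_equal]
  naturality_comp {x y z} f g := by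
    change ((ρ_ (G.map (f ≫ g))).hom ≫ (λ_ (G.map (f ≫ g))).inv) ≫ 𝟙 (G.obj x) ◁
        ((G.mapComp f g).hom) =
      (G.map₂ (𝟙 (f ≫ g)) ≫ (G.mapComp f g).hom) ▷ 𝟙 (G.obj z) ≫ (α_ _ _ _).hom ≫
        G.map f ◁ ((ρ_ (G.map g)).hom ≫ (λ_ (G.map g)).inv) ≫ (α_ _ _ _).inv ≫
          ((ρ_ (G.map f)).hom ≫ (λ_ (G.map f)).inv) ▷ G.map g ≫ (α_ _ _ _).hom
    simp

/-- The unit transformation `G ⟶ G ≫ 1`. -/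
def unitTransRight (G : X ⥤ᵖ Y) : G ⟶ G.comp (Pseudofunctor.id Y) where
  app x := 𝟙 (G.obj x)
  naturality f := ρ_ (G.map f) ≪≫ (λ_ (G.map f)).symm
  naturality_naturality {x y f g} θ := by
    change G.map₂ θ ▷ 𝟙 (G.obj y) ≫ (ρ_ (G.map g)).hom ≫ (λ_ (G.map g)).inv =
      ((ρ_ (G.map f)).hom ≫ (λ_ (G.map f)).inv) ≫ 𝟙 (G.obj x) ◁ G.map₂ θ
    simp
  naturality_id x := by
    change ((ρ_ (G.map (𝟙 x))).hom ≫ (λ_ (G.map (𝟙 x))).inv) ≫ 𝟙 (G.obj x) ◁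
        ((G.mapId x).hom ≫ 𝟙 (𝟙 (G.obj x))) =
      ((G.mapId x).hom) ▷ 𝟙 (G.obj x) ≫ (λ_ (𝟙 (G.obj x))).hom ≫ (ρ_ (𝟙 (G.obj x))).inv
    simp [unitors_equal]
  naturality_comp {x y z} f g := by
    change ((ρ_ (G.map (f ≫ g))).hom ≫ (λ_ (G.map (f ≫ g))).inv) ≫ 𝟙 (G.obj x) ◁
        ((G.mapComp f g).hom ≫ 𝟙 (G.map f ≫ G.map g)) =
      ((G.mapComp f g).hom) ▷ 𝟙 (G.obj z) ≫ (α_ _ _ _).hom ≫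
        G.map f ◁ ((ρ_ (G.map g)).hom ≫ (λ_ (G.map g)).inv) ≫ (α_ _ _ _).inv ≫
          ((ρ_ (G.map f)).hom ≫ (λ_ (G.map f)).inv) ▷ G.map g ≫ (α_ _ _ _).hom
    simp

/-- The component at `x` of an invertible modification. -/
@[simps]
def isoApp {G H : X ⥤ᵖ Y} {η θ : G ⟶ H} (i : η ≅ θ) (x : X) : η.app x ≅ θ.app x where
  hom := i.hom.as.app x
  inv := i.inv.as.app x
  hom_inv_id := congrArg (fun m => m.as.app x) i.hom_inv_id
  inv_hom_id := congrArg (fun m => m.as.app x) i.inv_hom_id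

/-- Horizontal composition of 2-cells in a bicategory. -/
def hcomp₂ {a b c : X} {f f' : a ⟶ b} {g g' : b ⟶ c} (α : f ⟶ f') (β : g ⟶ g') :
    f ≫ g ⟶ f' ≫ g' :=
  α ▷ g ≫ f' ◁ β

end Tricat

/-! ### Trihomomorphisms `Bᶜᵒᵒᵖ ⟶ Bicat` -/

open Tricat

/-- The action of a trihomomorphism `Bᶜᵒᵒᵖ ⟶ Bicat` on objects and on hom-bicategories: each
object `b` is sent to a bicategory, and `B(a, b)ᵒᵖ`, seen as a locally discrete bicategory, is
mapped by a homomorphism to the bicategory of homomorphisms `F b ⟶ F a`, transformations and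
modifications. -/
structure TrihomCells (B : Type u₁) [Bicategory.{w₁, v₁} B] where
  obj : B → Type u₂
  [bicat : ∀ b, Bicategory.{w₂, v₂} (obj b)]
  hom (a b : B) : LocallyDiscrete (a ⟶ b)ᵒᵖ ⥤ᵖ (obj b ⥤ᵖ obj a)

namespace TrihomCells

attribute [instance] TrihomCells.bicat

variable {B : Type u₁} [Bicategory.{w₁, v₁} B] (F : TrihomCells.{w₁, w₂, v₁, v₂, u₁, u₂} B)
  {a b c d : B}

/-- `F f : F b ⟶ F a` for `f : a ⟶ b`. -/
def map (f : a ⟶ b) : F.obj b ⥤ᵖ F.obj a := (F.hom a b).obj ⟨op f⟩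

/-- `F α : F g ⟶ F f` for `α : f ⟶ g`. -/
def map₂ {f g : a ⟶ b} (α : f ⟶ g) : F.map g ⟶ F.map f := (F.hom a b).map α.op.toLoc

/-- The component `(F α)_x`. -/
def app {f g : a ⟶ b} (α : f ⟶ g) (x : F.obj b) : (F.map g).obj x ⟶ (F.map f).obj x :=
  (F.map₂ α).app x

/-- The naturality 2-cell of `F α` at a 1-cell `k`. -/
def appNat {f g : a ⟶ b} (α : f ⟶ g) {x y : F.obj b} (k : x ⟶ y) :
    (F.map g).map k ≫ F.app α y ≅ F.app α x ≫ (F.map f).map k :=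
  (F.map₂ α).naturality k

/-- The coherence isomorphism `F β ≫ F α ≅ F γ` for `γ = α ≫ β`. -/
def compIso {f g h : a ⟶ b} (α : f ⟶ g) (β : g ⟶ h) (γ : f ⟶ h) (e : α ≫ β = γ) :
    F.map₂ β ≫ F.map₂ α ≅ F.map₂ γ :=
  ((F.hom a b).mapComp' β.op.toLoc α.op.toLoc γ.op.toLoc (by subst e; rfl)).symm

/-- The coherence isomorphism `F α ≅ 1` for `α = 1`. -/
def idIso {f : a ⟶ b} (α : f ⟶ f) (e : α = 𝟙 f) : F.map₂ α ≅ 𝟙 (F.map f) :=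
  (F.hom a b).mapId' α.op.toLoc (by subst e; rfl)

/-- Components of `compIso`. -/
def appComp {f g h : a ⟶ b} (α : f ⟶ g) (β : g ⟶ h) (γ : f ⟶ h) (e : α ≫ β = γ)
    (x : F.obj b) : F.app β x ≫ F.app α x ≅ F.app γ x :=
  isoApp (F.compIso α β γ e) x

/-- Components of `idIso`. -/
def appId {f : a ⟶ b} (α : f ⟶ f) (e : α = 𝟙 f) (x : F.obj b) :
    F.app α x ≅ 𝟙 ((F.map f).obj x) :=
  isoApp (F.idIso α e) x

end TrihomCells

/-- The data of a trihomomorphism `Bᶜᵒᵒᵖ ⟶ Bicat`. -/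
structure TrihomData (B : Type u₁) [Bicategory.{w₁, v₁} B] extends
    TrihomCells.{w₁, w₂, v₁, v₂, u₁, u₂} B where
  /-- Composition of 1-cells is preserved up to adjoint equivalences. The pseudo-naturality of the
  chosen inverses in `f` and `g` is determined by that of `chi`. -/
  chi {a b c : B} (f : a ⟶ b) (g : b ⟶ c) :
    Bicategory.Equivalence ((toTrihomCells.map g).comp (toTrihomCells.map f))
      (toTrihomCells.map (f ≫ g))
  /-- The pseudo-naturality cells of `chi`. -/
  chiNat {a b c : B} {f f' : a ⟶ b} {g g' : b ⟶ c} (α : f ⟶ f') (β : g ⟶ g') :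
    hcompTrans (toTrihomCells.map₂ β) (toTrihomCells.map₂ α) ≫ (chi f g).hom ≅
      (chi f' g').hom ≫ toTrihomCells.map₂ (hcomp₂ α β)
  /-- Identity 1-cells are preserved up to adjoint equivalences. Since the source is the unit
  bicategory, the naturality cell at the identity 2-cell is forced to be the canonical one. -/
  iota (a : B) : Bicategory.Equivalence (Pseudofunctor.id (obj a)) (toTrihomCells.map (𝟙 a))
  /-- The invertible modifications for associativity. -/
  omega {a b c d : B} (f : a ⟶ b) (g : b ⟶ c) (h : c ⟶ d) :
    whiskerPost (chi g h).hom (toTrihomCells.map f) ≫ (chi f (g ≫ h)).hom ≫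
        toTrihomCells.map₂ (α_ f g h).hom ≅
      assocTrans (toTrihomCells.map h) (toTrihomCells.map g) (toTrihomCells.map f) ≫
        whiskerPre (toTrihomCells.map h) (chi f g).hom ≫ (chi (f ≫ g) h).hom
  /-- The invertible modifications for the unit at the codomain. -/
  gamma {a b : B} (f : a ⟶ b) :
    whiskerPost (iota b).hom (toTrihomCells.map f) ≫ (chi f (𝟙 b)).hom ≫
        toTrihomCells.map₂ (ρ_ f).inv ≅
      unitTransLeft (toTrihomCells.map f)
  /-- The invertible modifications for the unit at the domain. -/
  delta {a b : B} (f : a ⟶ b) :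
    toTrihomCells.map₂ (λ_ f).hom ≅
      unitTransRight (toTrihomCells.map f) ≫
        whiskerPre (toTrihomCells.map f) (iota a).hom ≫ (chi (𝟙 a) f).hom

namespace TrihomData

variable {B : Type u₁} [Bicategory.{w₁, v₁} B] (F : TrihomData.{w₁, w₂, v₁, v₂, u₁, u₂} B)
  {a b c d : B}

/-- `χ_x : F f (F g x) ⟶ F (f ≫ g) x`. -/
def chiApp (f : a ⟶ b) (g : b ⟶ c) (x : F.obj c) :
    (F.map f).obj ((F.map g).obj x) ⟶ (F.map (f ≫ g)).obj x :=
  (F.chi f g).hom.app x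

/-- The naturality 2-cell of `χ` at a 1-cell of `F c`. -/
def chiCell (f : a ⟶ b) (g : b ⟶ c) {x y : F.obj c} (k : x ⟶ y) :
    (F.map f).map ((F.map g).map k) ≫ F.chiApp f g y ≅
      F.chiApp f g x ≫ (F.map (f ≫ g)).map k :=
  (F.chi f g).hom.naturality k

/-- The component at `x` of the naturality cell of `χ` at 2-cells of `B`. -/
def chiNatApp {f f' : a ⟶ b} {g g' : b ⟶ c} (α : f ⟶ f') (β : g ⟶ g') (x : F.obj c) :
    (F.app α ((F.map g').obj x) ≫ (F.map f).map (F.app β x)) ≫ F.chiApp f g x ≅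
      F.chiApp f' g' x ≫ F.app (hcomp₂ α β) x :=
  isoApp (F.chiNat α β) x

/-- `ι_x : x ⟶ F 1 x`. -/
def iotaApp (a : B) (x : F.obj a) : x ⟶ (F.map (𝟙 a)).obj x :=
  (F.iota a).hom.app x

/-- The naturality 2-cell of `ι` at a 1-cell of `F a`. -/
def iotaCell (a : B) {x y : F.obj a} (k : x ⟶ y) :
    k ≫ F.iotaApp a y ≅ F.iotaApp a x ≫ (F.map (𝟙 a)).map k :=
  (F.iota a).hom.naturality k

/-- Components of `ω`. -/
def omegaApp (f : a ⟶ b) (g : b ⟶ c) (h : c ⟶ d) (x : F.obj d) :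
    (F.map f).map (F.chiApp g h x) ≫ F.chiApp f (g ≫ h) x ≫ F.app (α_ f g h).hom x ≅
      F.chiApp f g ((F.map h).obj x) ≫ F.chiApp (f ≫ g) h x :=
  isoApp (F.omega f g h) x ≪≫ λ_ (F.chiApp f g ((F.map h).obj x) ≫ F.chiApp (f ≫ g) h x)

/-- Components of `γ`. -/
def gammaApp (f : a ⟶ b) (x : F.obj b) :
    (F.map f).map (F.iotaApp b x) ≫ F.chiApp f (𝟙 b) x ≫ F.app (ρ_ f).inv x ≅
      𝟙 ((F.map f).obj x) :=
  isoApp (F.gamma f) x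

/-- Components of `δ`. -/
def deltaApp (f : a ⟶ b) (x : F.obj b) :
    F.app (λ_ f).hom x ≅ F.iotaApp a ((F.map f).obj x) ≫ F.chiApp (𝟙 a) f x :=
  isoApp (F.delta f) x ≪≫ λ_ (F.iotaApp a ((F.map f).obj x) ≫ F.chiApp (𝟙 a) f x)

end TrihomData

/-- The axioms of a trihomomorphism `Bᶜᵒᵒᵖ ⟶ Bicat`. Equations between modifications are stated on
components; `⊗≫` is composition with the evident associativity and unit constraints inserted. -/
structure TrihomData.IsTrihom {B : Type u₁} [Bicategory.{w₁, v₁} B]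
    (F : TrihomData.{w₁, w₂, v₁, v₂, u₁, u₂} B) : Prop where
  /-- `χ` is pseudo-natural: identities. -/
  chi_id {a b c : B} (f : a ⟶ b) (g : b ⟶ c) (x : F.obj c) :
    (F.chiNatApp (𝟙 f) (𝟙 g) x).hom ≫
        F.chiApp f g x ◁ (F.appId (hcomp₂ (𝟙 f) (𝟙 g)) (by simp [hcomp₂]) x).hom =
      (F.appId (𝟙 f) rfl ((F.map g).obj x)).hom ▷ (F.map f).map (F.app (𝟙 g) x) ▷
          F.chiApp f g x ⊗≫
        ((F.map f).map₂ (F.appId (𝟙 g) rfl x).hom ≫ ((F.map f).mapId ((F.map g).obj x)).hom) ▷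
          F.chiApp f g x ⊗≫
        𝟙 (F.chiApp f g x ≫ 𝟙 ((F.map (f ≫ g)).obj x))
  /-- `χ` is pseudo-natural: composition. -/
  chi_comp {a b c : B} {f f' f'' : a ⟶ b} {g g' g'' : b ⟶ c} (α : f ⟶ f') (α' : f' ⟶ f'')
    (β : g ⟶ g') (β' : g' ⟶ g'') (x : F.obj c) :
    (F.app α' ((F.map g'').obj x) ≫ (F.map f').map (F.app β' x)) ◁ (F.chiNatApp α β x).hom ⊗≫
        (F.chiNatApp α' β' x).hom ▷ F.app (hcomp₂ α β) x ⊗≫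
        F.chiApp f'' g'' x ◁ (F.appComp (hcomp₂ α β) (hcomp₂ α' β') (hcomp₂ (α ≫ α') (β ≫ β'))
          (by simp [hcomp₂, whisker_exchange_assoc]) x).hom =
      𝟙 ((F.app α' ((F.map g'').obj x) ≫ (F.map f').map (F.app β' x)) ≫
          (F.app α ((F.map g').obj x) ≫ (F.map f).map (F.app β x)) ≫ F.chiApp f g x) ⊗≫
        F.app α' ((F.map g'').obj x) ◁ (F.appNat α (F.app β' x)).hom ▷
          ((F.map f).map (F.app β x) ≫ F.chiApp f g x) ⊗≫
        (F.appComp α α' (α ≫ α') rfl ((F.map g'').obj x)).hom ▷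
          ((F.map f).map (F.app β' x) ≫ (F.map f).map (F.app β x) ≫ F.chiApp f g x) ⊗≫
        F.app (α ≫ α') ((F.map g'').obj x) ◁
          (((F.map f).mapComp (F.app β' x) (F.app β x)).inv ≫
            (F.map f).map₂ (F.appComp β β' (β ≫ β') rfl x).hom) ▷ F.chiApp f g x ⊗≫
        (F.chiNatApp (α ≫ α') (β ≫ β') x).hom
  /-- `ω` is natural in its three indices. -/
  omega_nat {a b c d : B} {f f' : a ⟶ b} {g g' : b ⟶ c} {h h' : c ⟶ d} (α : f ⟶ f')
    (β : g ⟶ g') (γ : h ⟶ h') (x : F.obj d) :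
    𝟙 (F.app α ((F.map g').obj ((F.map h').obj x)) ≫
          (F.map f).map (F.app β ((F.map h').obj x) ≫ (F.map g).map (F.app γ x)) ≫
          (F.map f).map (F.chiApp g h x) ≫ F.chiApp f (g ≫ h) x ≫ F.app (α_ f g h).hom x) ⊗≫
        F.app α ((F.map g').obj ((F.map h').obj x)) ◁
          (((F.map f).mapComp (F.app β ((F.map h').obj x) ≫ (F.map g).map (F.app γ x))
              (F.chiApp g h x)).inv ≫
            (F.map f).map₂ (F.chiNatApp β γ x).hom ≫
            ((F.map f).mapComp (F.chiApp g' h' x) (F.app (hcomp₂ β γ) x)).hom) ▷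
              (F.chiApp f (g ≫ h) x ≫ F.app (α_ f g h).hom x) ⊗≫
        (F.appNat α (F.chiApp g' h' x)).inv ▷
          ((F.map f).map (F.app (hcomp₂ β γ) x) ≫
            F.chiApp f (g ≫ h) x ≫ F.app (α_ f g h).hom x) ⊗≫
        (F.map f').map (F.chiApp g' h' x) ◁
          (F.chiNatApp α (hcomp₂ β γ) x).hom ▷ F.app (α_ f g h).hom x ⊗≫
        ((F.map f').map (F.chiApp g' h' x) ≫ F.chiApp f' (g' ≫ h') x) ◁
          ((F.appComp (α_ f g h).hom (hcomp₂ α (hcomp₂ β γ))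
              (hcomp₂ (hcomp₂ α β) γ ≫ (α_ f' g' h').hom) (by simp [hcomp₂]) x).hom ≫
            (F.appComp (hcomp₂ (hcomp₂ α β) γ) (α_ f' g' h').hom _ rfl x).inv) ⊗≫
        (F.omegaApp f' g' h' x).hom ▷ F.app (hcomp₂ (hcomp₂ α β) γ) x =
      𝟙 (F.app α ((F.map g').obj ((F.map h').obj x)) ≫
          (F.map f).map (F.app β ((F.map h').obj x) ≫ (F.map g).map (F.app γ x)) ≫
          (F.map f).map (F.chiApp g h x) ≫ F.chiApp f (g ≫ h) x ≫ F.app (α_ f g h).hom x) ⊗≫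
        (F.app α ((F.map g').obj ((F.map h').obj x)) ≫
          (F.map f).map (F.app β ((F.map h').obj x) ≫ (F.map g).map (F.app γ x))) ◁
            (F.omegaApp f g h x).hom ⊗≫
        F.app α ((F.map g').obj ((F.map h').obj x)) ◁
          ((F.map f).mapComp (F.app β ((F.map h').obj x)) ((F.map g).map (F.app γ x))).hom ▷
            (F.chiApp f g ((F.map h).obj x) ≫ F.chiApp (f ≫ g) h x) ⊗≫
        (F.app α ((F.map g').obj ((F.map h').obj x)) ≫
          (F.map f).map (F.app β ((F.map h').obj x))) ◁
            (F.chiCell f g (F.app γ x)).hom ▷ F.chiApp (f ≫ g) h x ⊗≫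
        (F.chiNatApp α β ((F.map h').obj x)).hom ▷
          ((F.map (f ≫ g)).map (F.app γ x) ≫ F.chiApp (f ≫ g) h x) ⊗≫
        F.chiApp f' g' ((F.map h').obj x) ◁ (F.chiNatApp (hcomp₂ α β) γ x).hom ⊗≫
        𝟙 ((F.chiApp f' g' ((F.map h').obj x) ≫ F.chiApp (f' ≫ g') h' x) ≫
          F.app (hcomp₂ (hcomp₂ α β) γ) x)
  /-- `γ` is natural. -/
  gamma_nat {a b : B} {f f' : a ⟶ b} (α : f ⟶ f') (x : F.obj b) :
    F.app α x ◁ (F.gammaApp f x).hom ⊗≫ 𝟙 (F.app α x) =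
      𝟙 (F.app α x ≫ (F.map f).map (F.iotaApp b x) ≫ F.chiApp f (𝟙 b) x ≫
          F.app (ρ_ f).inv x) ⊗≫
        (F.appNat α (F.iotaApp b x)).inv ▷ (F.chiApp f (𝟙 b) x ≫ F.app (ρ_ f).inv x) ⊗≫
        ((F.map f').map (F.iotaApp b x) ≫ F.app α ((F.map (𝟙 b)).obj x)) ◁
          (((F.map f).mapId ((F.map (𝟙 b)).obj x)).inv ≫
            (F.map f).map₂ (F.appId (𝟙 (𝟙 b)) rfl x).inv) ▷
              (F.chiApp f (𝟙 b) x ≫ F.app (ρ_ f).inv x) ⊗≫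
        (F.map f').map (F.iotaApp b x) ◁
          (F.chiNatApp α (𝟙 (𝟙 b)) x).hom ▷ F.app (ρ_ f).inv x ⊗≫
        ((F.map f').map (F.iotaApp b x) ≫ F.chiApp f' (𝟙 b) x) ◁
          ((F.appComp (ρ_ f).inv (hcomp₂ α (𝟙 (𝟙 b))) (α ≫ (ρ_ f').inv)
              (by simp [hcomp₂]) x).hom ≫
            (F.appComp α (ρ_ f').inv _ rfl x).inv) ⊗≫
        (F.gammaApp f' x).hom ▷ F.app α x ⊗≫ 𝟙 (F.app α x)
  /-- `δ` is natural. -/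
  delta_nat {a b : B} {f f' : a ⟶ b} (α : f ⟶ f') (x : F.obj b) :
    F.app α x ◁ (F.deltaApp f x).hom ⊗≫
        (F.iotaCell a (F.app α x)).hom ▷ F.chiApp (𝟙 a) f x ⊗≫
        F.iotaApp a ((F.map f').obj x) ◁
          (F.appId (𝟙 (𝟙 a)) rfl ((F.map f').obj x)).inv ▷
            ((F.map (𝟙 a)).map (F.app α x) ≫ F.chiApp (𝟙 a) f x) ⊗≫
        F.iotaApp a ((F.map f').obj x) ◁ (F.chiNatApp (𝟙 (𝟙 a)) α x).hom =
      ((F.appComp (λ_ f).hom α ((λ_ f).hom ≫ α) rfl x).hom ≫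
          (F.appComp (hcomp₂ (𝟙 (𝟙 a)) α) (λ_ f').hom _ (by simp [hcomp₂]) x).inv) ⊗≫
        (F.deltaApp f' x).hom ▷ F.app (hcomp₂ (𝟙 (𝟙 a)) α) x ⊗≫
        𝟙 (F.iotaApp a ((F.map f').obj x) ≫ F.chiApp (𝟙 a) f' x ≫
          F.app (hcomp₂ (𝟙 (𝟙 a)) α) x)
  /-- The associativity axiom, over the pentagon. -/
  assoc {a b c d e : B} (f : a ⟶ b) (g : b ⟶ c) (h : c ⟶ d) (k : d ⟶ e) (x : F.obj e) :
    𝟙 ((F.map f).map ((F.map g).map (F.chiApp h k x)) ≫ (F.map f).map (F.chiApp g (h ≫ k) x) ≫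
          F.chiApp f (g ≫ h ≫ k) x ≫ F.app (α_ f g (h ≫ k)).hom x ≫
          F.app (α_ (f ≫ g) h k).hom x) ⊗≫
        (F.map f).map ((F.map g).map (F.chiApp h k x)) ◁
          (F.omegaApp f g (h ≫ k) x).hom ▷ F.app (α_ (f ≫ g) h k).hom x ⊗≫
        (F.chiCell f g (F.chiApp h k x)).hom ▷
          (F.chiApp (f ≫ g) (h ≫ k) x ≫ F.app (α_ (f ≫ g) h k).hom x) ⊗≫
        F.chiApp f g ((F.map h).obj ((F.map k).obj x)) ◁ (F.omegaApp (f ≫ g) h k x).hom =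
      𝟙 ((F.map f).map ((F.map g).map (F.chiApp h k x)) ≫ (F.map f).map (F.chiApp g (h ≫ k) x) ≫
          F.chiApp f (g ≫ h ≫ k) x ≫ F.app (α_ f g (h ≫ k)).hom x ≫
          F.app (α_ (f ≫ g) h k).hom x) ⊗≫
        ((F.map f).map ((F.map g).map (F.chiApp h k x)) ≫ (F.map f).map (F.chiApp g (h ≫ k) x) ≫
          F.chiApp f (g ≫ h ≫ k) x) ◁
            ((F.appComp (α_ (f ≫ g) h k).hom (α_ f g (h ≫ k)).hom
                ((hcomp₂ (α_ f g h).hom (𝟙 k) ≫ (α_ f (g ≫ h) k).hom) ≫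
                  hcomp₂ (𝟙 f) (α_ g h k).hom) (by simp [hcomp₂]) x).hom ≫
              (F.appComp _ (hcomp₂ (𝟙 f) (α_ g h k).hom) _ rfl x).inv ≫
              F.app (hcomp₂ (𝟙 f) (α_ g h k).hom) x ◁
                (F.appComp (hcomp₂ (α_ f g h).hom (𝟙 k)) (α_ f (g ≫ h) k).hom _ rfl x).inv) ⊗≫
        ((F.map f).map ((F.map g).map (F.chiApp h k x)) ≫
          (F.map f).map (F.chiApp g (h ≫ k) x)) ◁
            (F.chiNatApp (𝟙 f) (α_ g h k).hom x).inv ▷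
              (F.app (α_ f (g ≫ h) k).hom x ≫ F.app (hcomp₂ (α_ f g h).hom (𝟙 k)) x) ⊗≫
        ((F.map f).map ((F.map g).map (F.chiApp h k x)) ≫
          (F.map f).map (F.chiApp g (h ≫ k) x)) ◁
            (F.appId (𝟙 f) rfl ((F.map (g ≫ h ≫ k)).obj x)).hom ▷
              ((F.map f).map (F.app (α_ g h k).hom x) ≫ F.chiApp f ((g ≫ h) ≫ k) x ≫
                F.app (α_ f (g ≫ h) k).hom x ≫ F.app (hcomp₂ (α_ f g h).hom (𝟙 k)) x) ⊗≫
        ((F.map f).map ((F.map g).map (F.chiApp h k x)) ◁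
            ((F.map f).mapComp (F.chiApp g (h ≫ k) x) (F.app (α_ g h k).hom x)).inv ≫
          ((F.map f).mapComp ((F.map g).map (F.chiApp h k x))
            (F.chiApp g (h ≫ k) x ≫ F.app (α_ g h k).hom x)).inv ≫
          (F.map f).map₂ (F.omegaApp g h k x).hom ≫
          ((F.map f).mapComp (F.chiApp g h ((F.map k).obj x)) (F.chiApp (g ≫ h) k x)).hom) ▷
            (F.chiApp f ((g ≫ h) ≫ k) x ≫ F.app (α_ f (g ≫ h) k).hom x ≫
              F.app (hcomp₂ (α_ f g h).hom (𝟙 k)) x) ⊗≫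
        (F.map f).map (F.chiApp g h ((F.map k).obj x)) ◁
          (F.omegaApp f (g ≫ h) k x).hom ▷ F.app (hcomp₂ (α_ f g h).hom (𝟙 k)) x ⊗≫
        ((F.map f).map (F.chiApp g h ((F.map k).obj x)) ≫
          F.chiApp f (g ≫ h) ((F.map k).obj x)) ◁
            (F.chiNatApp (α_ f g h).hom (𝟙 k) x).inv ⊗≫
        ((F.map f).map (F.chiApp g h ((F.map k).obj x)) ≫
          F.chiApp f (g ≫ h) ((F.map k).obj x) ≫ F.app (α_ f g h).hom ((F.map k).obj x)) ◁
            ((F.map ((f ≫ g) ≫ h)).map₂ (F.appId (𝟙 k) rfl x).hom ≫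
              ((F.map ((f ≫ g) ≫ h)).mapId ((F.map k).obj x)).hom) ▷
                F.chiApp ((f ≫ g) ≫ h) k x ⊗≫
        (F.omegaApp f g h ((F.map k).obj x)).hom ▷ F.chiApp ((f ≫ g) ≫ h) k x ⊗≫
        𝟙 (F.chiApp f g ((F.map h).obj ((F.map k).obj x)) ≫
          F.chiApp (f ≫ g) h ((F.map k).obj x) ≫ F.chiApp ((f ≫ g) ≫ h) k x)
  /-- The unit axiom, over the triangle. -/
  unit {a b c : B} (f : a ⟶ b) (g : b ⟶ c) (x : F.obj c) :
    (F.appId (𝟙 f) rfl ((F.map g).obj x)).inv ▷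
          ((F.map f).map (F.app (λ_ g).hom x) ≫ F.chiApp f (𝟙 b ≫ g) x ≫
            F.app (α_ f (𝟙 b) g).hom x ≫ F.app (hcomp₂ (ρ_ f).inv (𝟙 g)) x) ⊗≫
        (F.chiNatApp (𝟙 f) (λ_ g).hom x).hom ▷
          (F.app (α_ f (𝟙 b) g).hom x ≫ F.app (hcomp₂ (ρ_ f).inv (𝟙 g)) x) ⊗≫
        F.chiApp f g x ◁
          ((F.appComp (α_ f (𝟙 b) g).hom (hcomp₂ (𝟙 f) (λ_ g).hom) _ rfl x).hom ▷
              F.app (hcomp₂ (ρ_ f).inv (𝟙 g)) x ≫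
            (F.appComp (hcomp₂ (ρ_ f).inv (𝟙 g)) _ (𝟙 (f ≫ g)) (by simp [hcomp₂]) x).hom ≫
            (F.appId (𝟙 (f ≫ g)) rfl x).hom) ⊗≫
        𝟙 (F.chiApp f g x) =
      𝟙 (𝟙 ((F.map f).obj ((F.map g).obj x)) ≫ (F.map f).map (F.app (λ_ g).hom x) ≫
          F.chiApp f (𝟙 b ≫ g) x ≫ F.app (α_ f (𝟙 b) g).hom x ≫
          F.app (hcomp₂ (ρ_ f).inv (𝟙 g)) x) ⊗≫
        ((F.map f).map₂ (F.deltaApp g x).hom ≫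
          ((F.map f).mapComp (F.iotaApp b ((F.map g).obj x)) (F.chiApp (𝟙 b) g x)).hom) ▷
            (F.chiApp f (𝟙 b ≫ g) x ≫ F.app (α_ f (𝟙 b) g).hom x ≫
              F.app (hcomp₂ (ρ_ f).inv (𝟙 g)) x) ⊗≫
        (F.map f).map (F.iotaApp b ((F.map g).obj x)) ◁
          (F.omegaApp f (𝟙 b) g x).hom ▷ F.app (hcomp₂ (ρ_ f).inv (𝟙 g)) x ⊗≫
        ((F.map f).map (F.iotaApp b ((F.map g).obj x)) ≫ F.chiApp f (𝟙 b) ((F.map g).obj x)) ◁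
          (F.chiNatApp (ρ_ f).inv (𝟙 g) x).inv ⊗≫
        ((F.map f).map (F.iotaApp b ((F.map g).obj x)) ≫ F.chiApp f (𝟙 b) ((F.map g).obj x) ≫
          F.app (ρ_ f).inv ((F.map g).obj x)) ◁
            ((F.map f).map₂ (F.appId (𝟙 g) rfl x).hom ≫
              ((F.map f).mapId ((F.map g).obj x)).hom) ▷ F.chiApp f g x ⊗≫
        (F.gammaApp f ((F.map g).obj x)).hom ▷ F.chiApp f g x ⊗≫
        𝟙 (F.chiApp f g x)

/-- A trihomomorphism `Bᶜᵒᵒᵖ ⟶ Bicat`. -/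
structure Trihomomorphism (B : Type u₁) [Bicategory.{w₁, v₁} B] extends
    TrihomData.{w₁, w₂, v₁, v₂, u₁, u₂} B where
  isTrihom : toTrihomData.IsTrihom

/-! ### Bicategories from explicit data -/

/-- The data of a bicategory, in the classical presentation with a horizontal composition of
2-cells. The unit constraints are `1 ≫ f ⟶ f` and `f ⟶ f ≫ 1`. -/
structure BicategoryData (C : Type u₁) where
  Hom : C → C → Type v₁
  Hom₂ {x y : C} : Hom x y → Hom x y → Type w₁
  id (x : C) : Hom x x
  comp {x y z : C} : Hom x y → Hom y z → Hom x z
  id₂ {x y : C} (f : Hom x y) : Hom₂ f f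
  vcomp {x y : C} {f g h : Hom x y} : Hom₂ f g → Hom₂ g h → Hom₂ f h
  hcomp {x y z : C} {f f' : Hom x y} {g g' : Hom y z} :
    Hom₂ f f' → Hom₂ g g' → Hom₂ (comp f g) (comp f' g')
  assoc {x y z t : C} (f : Hom x y) (g : Hom y z) (h : Hom z t) :
    Hom₂ (comp (comp f g) h) (comp f (comp g h))
  unitDom {x y : C} (f : Hom x y) : Hom₂ (comp (id x) f) f
  unitCod {x y : C} (f : Hom x y) : Hom₂ f (comp f (id y))

namespace BicategoryData

variable {C : Type u₁} (D : BicategoryData.{w₁, v₁, u₁} C)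

/-- A 2-cell is invertible. -/
def IsInvertible {x y : C} {f g : D.Hom x y} (α : D.Hom₂ f g) : Prop :=
  ∃ β : D.Hom₂ g f, D.vcomp α β = D.id₂ f ∧ D.vcomp β α = D.id₂ g

/-- The axioms of a bicategory. -/
structure IsBicategory : Prop where
  id_vcomp {x y : C} {f g : D.Hom x y} (α : D.Hom₂ f g) : D.vcomp (D.id₂ f) α = α
  vcomp_id {x y : C} {f g : D.Hom x y} (α : D.Hom₂ f g) : D.vcomp α (D.id₂ g) = α
  vcomp_assoc {x y : C} {f g h k : D.Hom x y} (α : D.Hom₂ f g) (β : D.Hom₂ g h)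
    (γ : D.Hom₂ h k) : D.vcomp (D.vcomp α β) γ = D.vcomp α (D.vcomp β γ)
  hcomp_id {x y z : C} (f : D.Hom x y) (g : D.Hom y z) :
    D.hcomp (D.id₂ f) (D.id₂ g) = D.id₂ (D.comp f g)
  hcomp_vcomp {x y z : C} {f f' f'' : D.Hom x y} {g g' g'' : D.Hom y z} (α : D.Hom₂ f f')
    (α' : D.Hom₂ f' f'') (β : D.Hom₂ g g') (β' : D.Hom₂ g' g'') :
    D.hcomp (D.vcomp α α') (D.vcomp β β') = D.vcomp (D.hcomp α β) (D.hcomp α' β')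
  assoc_natural {x y z t : C} {f f' : D.Hom x y} {g g' : D.Hom y z} {h h' : D.Hom z t}
    (α : D.Hom₂ f f') (β : D.Hom₂ g g') (γ : D.Hom₂ h h') :
    D.vcomp (D.hcomp (D.hcomp α β) γ) (D.assoc f' g' h') =
      D.vcomp (D.assoc f g h) (D.hcomp α (D.hcomp β γ))
  unitDom_natural {x y : C} {f f' : D.Hom x y} (α : D.Hom₂ f f') :
    D.vcomp (D.hcomp (D.id₂ (D.id x)) α) (D.unitDom f') = D.vcomp (D.unitDom f) α
  unitCod_natural {x y : C} {f f' : D.Hom x y} (α : D.Hom₂ f f') :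
    D.vcomp α (D.unitCod f') = D.vcomp (D.unitCod f) (D.hcomp α (D.id₂ (D.id y)))
  assoc_invertible {x y z t : C} (f : D.Hom x y) (g : D.Hom y z) (h : D.Hom z t) :
    D.IsInvertible (D.assoc f g h)
  unitDom_invertible {x y : C} (f : D.Hom x y) : D.IsInvertible (D.unitDom f)
  unitCod_invertible {x y : C} (f : D.Hom x y) : D.IsInvertible (D.unitCod f)
  pentagon {x y z t s : C} (f : D.Hom x y) (g : D.Hom y z) (h : D.Hom z t) (k : D.Hom t s) :
    D.vcomp (D.vcomp (D.hcomp (D.assoc f g h) (D.id₂ k)) (D.assoc f (D.comp g h) k))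
        (D.hcomp (D.id₂ f) (D.assoc g h k)) =
      D.vcomp (D.assoc (D.comp f g) h k) (D.assoc f g (D.comp h k))
  triangle {x y z : C} (f : D.Hom x y) (g : D.Hom y z) :
    D.vcomp (D.vcomp (D.hcomp (D.unitCod f) (D.id₂ g)) (D.assoc f (D.id y) g))
        (D.hcomp (D.id₂ f) (D.unitDom g)) =
      D.id₂ (D.comp f g)

variable {D} (H : D.IsBicategory)

/-- The hom-categories. -/
abbrev homCategory (x y : C) : Category.{w₁} (D.Hom x y) where
  Hom f g := D.Hom₂ f g
  id f := D.id₂ f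
  comp α β := D.vcomp α β
  id_comp := H.id_vcomp
  comp_id := H.vcomp_id
  assoc := H.vcomp_assoc

/-- An invertible 2-cell as an isomorphism. -/
noncomputable def isoOf {x y : C} {f g : D.Hom x y} (α : D.Hom₂ f g) (h : D.IsInvertible α) :
    letI := homCategory H x y
    f ≅ g :=
  letI := homCategory H x y
  { hom := α
    inv := h.choose
    hom_inv_id := h.choose_spec.1
    inv_hom_id := h.choose_spec.2 }

/-- The Mathlib bicategory given by the data; whiskering is horizontal composition with an
identity 2-cell. -/
noncomputable abbrev toBicategory : Bicategory.{w₁, v₁} C where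
  Hom := D.Hom
  id := D.id
  comp := D.comp
  homCategory x y := homCategory H x y
  whiskerLeft f _ _ β := D.hcomp (D.id₂ f) β
  whiskerRight α g := D.hcomp α (D.id₂ g)
  associator f g h := isoOf H (D.assoc f g h) (H.assoc_invertible f g h)
  leftUnitor f := isoOf H (D.unitDom f) (H.unitDom_invertible f)
  rightUnitor f :=
    let _ := homCategory H
    (isoOf H (D.unitCod f) (H.unitCod_invertible f)).symm
  whiskerLeft_id f g := H.hcomp_id f g
  whiskerLeft_comp f _ _ _ η θ := by
    change D.hcomp (D.id₂ f) (D.vcomp η θ) =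
      D.vcomp (D.hcomp (D.id₂ f) η) (D.hcomp (D.id₂ f) θ)
    rw [← H.hcomp_vcomp, H.id_vcomp]
  id_whiskerLeft {x y f g} η := by
    let _ := homCategory H
    let e (k : D.Hom x y) := isoOf H (D.unitDom k) (H.unitDom_invertible k)
    have h : D.hcomp (D.id₂ (D.id x)) η ≫ (e g).hom = (e f).hom ≫ η := H.unitDom_natural η
    change D.hcomp (D.id₂ (D.id x)) η = (e f).hom ≫ η ≫ (e g).inv
    exact ((Iso.eq_comp_inv (e g)).2 h).trans (Category.assoc _ _ _)
  comp_whiskerLeft {x y z t} f g h h' η := by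
    let _ := homCategory H
    let e (k : D.Hom z t) := isoOf H (D.assoc f g k) (H.assoc_invertible f g k)
    have n : D.hcomp (D.hcomp (D.id₂ f) (D.id₂ g)) η ≫ (e h').hom =
      (e h).hom ≫ D.hcomp (D.id₂ f) (D.hcomp (D.id₂ g) η) := H.assoc_natural _ _ η
    rw [H.hcomp_id] at n
    change D.hcomp (D.id₂ (D.comp f g)) η =
      (e h).hom ≫ D.hcomp (D.id₂ f) (D.hcomp (D.id₂ g) η) ≫ (e h').inv
    exact ((Iso.eq_comp_inv (e h')).2 n).trans (Category.assoc _ _ _)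
  id_whiskerRight f g := H.hcomp_id f g
  comp_whiskerRight η θ g := by
    change D.hcomp (D.vcomp η θ) (D.id₂ g) =
      D.vcomp (D.hcomp η (D.id₂ g)) (D.hcomp θ (D.id₂ g))
    rw [← H.hcomp_vcomp, H.id_vcomp]
  whiskerRight_id {x y f g} η := by
    let _ := homCategory H
    let e (k : D.Hom x y) := isoOf H (D.unitCod k) (H.unitCod_invertible k)
    have h : η ≫ (e g).hom = (e f).hom ≫ D.hcomp η (D.id₂ (D.id y)) := H.unitCod_natural η
    change D.hcomp η (D.id₂ (D.id y)) = (e f).inv ≫ η ≫ (e g).hom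
    rw [h, Iso.inv_hom_id_assoc]
  whiskerRight_comp {x y z t f f'} η g h := by
    let _ := homCategory H
    let e (k : D.Hom x y) := isoOf H (D.assoc k g h) (H.assoc_invertible k g h)
    have n : D.hcomp (D.hcomp η (D.id₂ g)) (D.id₂ h) ≫ (e f').hom =
      (e f).hom ≫ D.hcomp η (D.hcomp (D.id₂ g) (D.id₂ h)) := H.assoc_natural η _ _
    rw [H.hcomp_id] at n
    change D.hcomp η (D.id₂ (D.comp g h)) =
      (e f).inv ≫ D.hcomp (D.hcomp η (D.id₂ g)) (D.id₂ h) ≫ (e f').hom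
    rw [n, Iso.inv_hom_id_assoc]
  whisker_assoc {x y z t} f g g' η h := by
    let _ := homCategory H
    let e (k : D.Hom y z) := isoOf H (D.assoc f k h) (H.assoc_invertible f k h)
    have n : D.hcomp (D.hcomp (D.id₂ f) η) (D.id₂ h) ≫ (e g').hom =
      (e g).hom ≫ D.hcomp (D.id₂ f) (D.hcomp η (D.id₂ h)) := H.assoc_natural _ η _
    change D.hcomp (D.hcomp (D.id₂ f) η) (D.id₂ h) =
      (e g).hom ≫ D.hcomp (D.id₂ f) (D.hcomp η (D.id₂ h)) ≫ (e g').inv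
    exact ((Iso.eq_comp_inv (e g')).2 n).trans (Category.assoc _ _ _)
  whisker_exchange {x y z f g h i} η θ := by
    change D.vcomp (D.hcomp (D.id₂ f) θ) (D.hcomp η (D.id₂ i)) =
      D.vcomp (D.hcomp η (D.id₂ h)) (D.hcomp (D.id₂ g) θ)
    rw [← H.hcomp_vcomp, ← H.hcomp_vcomp, H.id_vcomp, H.id_vcomp, H.vcomp_id, H.vcomp_id]
  pentagon f g h k := by
    have p := H.pentagon f g h k
    rw [H.vcomp_assoc] at p
    exact p
  triangle {x y z} f g := by
    let _ := homCategory H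
    let e := isoOf H (D.unitCod f) (H.unitCod_invertible f)
    have t := H.triangle f g
    rw [H.vcomp_assoc] at t
    have i : D.vcomp (D.hcomp e.inv (D.id₂ g)) (D.hcomp (D.unitCod f) (D.id₂ g)) =
        D.id₂ (D.comp (D.comp f (D.id y)) g) := by
      rw [← H.hcomp_vcomp, H.id_vcomp, ← H.hcomp_id]
      exact congrArg (fun s => D.hcomp s (D.id₂ g)) e.inv_hom_id
    change D.vcomp (D.assoc f (D.id y) g) (D.hcomp (D.id₂ f) (D.unitDom g)) =
      D.hcomp e.inv (D.id₂ g)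
    rw [← H.vcomp_id (D.hcomp e.inv (D.id₂ g)), ← t, ← H.vcomp_assoc, i, H.id_vcomp]

end BicategoryData

/-! ### Fibrations of bicategories -/

namespace Bifib

variable {E : Type u₁} [Bicategory.{w₁, v₁} E] {B : Type u₂} [Bicategory.{w₂, v₂} B]

/-- `(ĥ, α̂, β̂)` is a lift of `(h, α)` along `f`. -/
def IsLift (P : E ⥤ᵖ B) {x y z : E} (f : x ⟶ y) (g : z ⟶ y) (h : P.obj z ⟶ P.obj x)
    (α : h ≫ P.map f ≅ P.map g) (h' : z ⟶ x) (α' : h' ≫ f ≅ g) (β' : P.map h' ≅ h) : Prop :=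
  β'.hom ▷ P.map f ≫ α.hom = (P.mapComp h' f).inv ≫ P.map₂ α'.hom

/-- Cartesian 1-cells. -/
structure IsCartesian₁ (P : E ⥤ᵖ B) {x y : E} (f : x ⟶ y) : Prop where
  exists_lift {z : E} (g : z ⟶ y) (h : P.obj z ⟶ P.obj x) (α : h ≫ P.map f ≅ P.map g) :
    ∃ (h' : z ⟶ x) (α' : h' ≫ f ≅ g) (β' : P.map h' ≅ h), IsLift P f g h α h' α' β'
  existsUnique_lift {z : E} {g₁ g₂ : z ⟶ y} (σ : g₁ ⟶ g₂) {h₁ h₂ : P.obj z ⟶ P.obj x}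
    (α₁ : h₁ ≫ P.map f ≅ P.map g₁) (α₂ : h₂ ≫ P.map f ≅ P.map g₂)
    {h₁' h₂' : z ⟶ x} (α₁' : h₁' ≫ f ≅ g₁) (β₁' : P.map h₁' ≅ h₁)
    (α₂' : h₂' ≫ f ≅ g₂) (β₂' : P.map h₂' ≅ h₂)
    (_ : IsLift P f g₁ h₁ α₁ h₁' α₁' β₁') (_ : IsLift P f g₂ h₂ α₂ h₂' α₂' β₂')
    (δ : h₁ ⟶ h₂) (_ : δ ▷ P.map f ≫ α₂.hom = α₁.hom ≫ P.map₂ σ) :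
    ∃! δ' : h₁' ⟶ h₂', δ' ▷ f ≫ α₂'.hom = α₁'.hom ≫ σ ∧ β₁'.hom ≫ δ = P.map₂ δ' ≫ β₂'.hom

/-- Cartesian 2-cells: those cartesian for the functor on hom-categories. -/
def IsCartesian₂ (P : E ⥤ᵖ B) {x y : E} {f g : x ⟶ y} (α : f ⟶ g) : Prop :=
  (P.mapFunctor x y).IsStronglyCartesian (P.map₂ α) α

/-- Fibrations of bicategories. -/
structure IsFibration (P : E ⥤ᵖ B) : Prop where
  /-- Every 1-cell `f : b ⟶ P e` has a cartesian lift lying strictly over it. -/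
  exists_cartesian {e : E} {b : B} (f : b ⟶ P.obj e) :
    ∃ (a : E) (h : a ⟶ e), IsCartesian₁ P h ∧
      (⟨P.obj a, P.map h⟩ : Σ b' : B, b' ⟶ P.obj e) = ⟨b, f⟩
  /-- `P` is locally fibred. -/
  locally_fibred (x y : E) : (P.mapFunctor x y).IsFibered
  /-- Cartesian 2-cells are closed under horizontal composition. -/
  hcomp_cartesian {x y z : E} {f f' : x ⟶ y} {g g' : y ⟶ z} (α : f ⟶ f') (β : g ⟶ g') :
    IsCartesian₂ P α → IsCartesian₂ P β → IsCartesian₂ P (hcomp₂ α β)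

/-- Lifts along cartesian 1-cells can be chosen with `β̂` an identity. -/
def HasStrictLifts (P : E ⥤ᵖ B) : Prop :=
  ∀ {x y z : E} (f : x ⟶ y), IsCartesian₁ P f → ∀ (g : z ⟶ y) (h : P.obj z ⟶ P.obj x)
    (α : h ≫ P.map f ≅ P.map g), ∃ (h' : z ⟶ x) (α' : h' ≫ f ≅ g) (e : P.map h' = h),
      IsLift P f g h α h' α' (eqToIso e)

end Bifib

/-! ### The Grothendieck construction -/

namespace TrihomData

variable {B : Type u₁} [Bicategory.{w₁, v₁} B] (F : TrihomData.{w₁, w₂, v₁, v₂, u₁, u₂} B)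
  {a b c d : B}

/-! The fibre components of the 1-cells and 2-cells of the Grothendieck construction. -/

/-- Composition of 1-cells. -/
def elComp {f : a ⟶ b} {g : b ⟶ c} {x : F.obj a} {y : F.obj b} {z : F.obj c}
    (p : x ⟶ (F.map f).obj y) (q : y ⟶ (F.map g).obj z) : x ⟶ (F.map (f ≫ g)).obj z :=
  p ≫ (F.map f).map q ≫ F.chiApp f g z

/-- Identity 2-cells. -/
def elId₂ {f : a ⟶ b} {x : F.obj a} {y : F.obj b} (p : x ⟶ (F.map f).obj y) :
    p ⟶ p ≫ F.app (𝟙 f) y :=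
  (ρ_ p).inv ≫ p ◁ (F.appId (𝟙 f) rfl y).inv

/-- Vertical composition of 2-cells. -/
def elVcomp {f g h : a ⟶ b} {x : F.obj a} {y : F.obj b} {p : x ⟶ (F.map f).obj y}
    {q : x ⟶ (F.map g).obj y} {r : x ⟶ (F.map h).obj y} {α : f ⟶ g} {β : g ⟶ h}
    (s : p ⟶ q ≫ F.app α y) (t : q ⟶ r ≫ F.app β y) : p ⟶ r ≫ F.app (α ≫ β) y :=
  s ≫ t ▷ F.app α y ⊗≫ r ◁ (F.appComp α β (α ≫ β) rfl y).hom

/-- Horizontal composition of 2-cells. -/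
def elHcomp {f g : a ⟶ b} {j k : b ⟶ c} {x : F.obj a} {y : F.obj b} {z : F.obj c}
    {p : x ⟶ (F.map f).obj y} {q : x ⟶ (F.map g).obj y} {r : y ⟶ (F.map j).obj z}
    {s : y ⟶ (F.map k).obj z} {α : f ⟶ g} {β : j ⟶ k}
    (m : p ⟶ q ≫ F.app α y) (n : r ⟶ s ≫ F.app β z) :
    F.elComp p r ⟶ F.elComp q s ≫ F.app (hcomp₂ α β) z :=
  m ▷ ((F.map f).map r ≫ F.chiApp f j z) ⊗≫
    (q ≫ F.app α y) ◁ ((F.map f).map₂ n ≫ ((F.map f).mapComp s (F.app β z)).hom) ▷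
      F.chiApp f j z ⊗≫
    q ◁ (F.appNat α s).inv ▷ ((F.map f).map (F.app β z) ≫ F.chiApp f j z) ⊗≫
    (q ≫ (F.map g).map s) ◁ (F.chiNatApp α β z).hom ⊗≫
    𝟙 ((q ≫ (F.map g).map s ≫ F.chiApp g k z) ≫ F.app (hcomp₂ α β) z)

/-- The associativity constraint. -/
def elAssoc {f : a ⟶ b} {g : b ⟶ c} {h : c ⟶ d} {x : F.obj a} {y : F.obj b} {z : F.obj c}
    {t : F.obj d} (p : x ⟶ (F.map f).obj y) (q : y ⟶ (F.map g).obj z)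
    (r : z ⟶ (F.map h).obj t) :
    F.elComp (F.elComp p q) r ⟶ F.elComp p (F.elComp q r) ≫ F.app (α_ f g h).hom t :=
  𝟙 ((p ≫ (F.map f).map q ≫ F.chiApp f g z) ≫
      (F.map (f ≫ g)).map r ≫ F.chiApp (f ≫ g) h t) ⊗≫
    (p ≫ (F.map f).map q) ◁ (F.chiCell f g r).inv ▷ F.chiApp (f ≫ g) h t ⊗≫
    (p ≫ (F.map f).map q ≫ (F.map f).map ((F.map g).map r)) ◁ (F.omegaApp f g h t).inv ⊗≫
    p ◁ ((F.map f).map q ◁ ((F.map f).mapComp ((F.map g).map r) (F.chiApp g h t)).inv ≫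
        ((F.map f).mapComp q ((F.map g).map r ≫ F.chiApp g h t)).inv) ▷
      (F.chiApp f (g ≫ h) t ≫ F.app (α_ f g h).hom t) ⊗≫
    𝟙 ((p ≫ (F.map f).map (q ≫ (F.map g).map r ≫ F.chiApp g h t) ≫ F.chiApp f (g ≫ h) t) ≫
      F.app (α_ f g h).hom t)

/-- The unit constraint `f ⟶ f ≫ 1`. -/
def elUnitCod {f : a ⟶ b} {x : F.obj a} {y : F.obj b} (p : x ⟶ (F.map f).obj y) :
    p ⟶ F.elComp p (F.iotaApp b y) ≫ F.app (ρ_ f).inv y :=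
  (ρ_ p).inv ≫ p ◁ (F.gammaApp f y).inv ⊗≫
    𝟙 ((p ≫ (F.map f).map (F.iotaApp b y) ≫ F.chiApp f (𝟙 b) y) ≫ F.app (ρ_ f).inv y)

/-- The unit constraint `1 ≫ f ⟶ f`. -/
def elUnitDom {f : a ⟶ b} {x : F.obj a} {y : F.obj b} (p : x ⟶ (F.map f).obj y) :
    F.elComp (F.iotaApp a x) p ⟶ p ≫ F.app (λ_ f).hom y :=
  𝟙 (F.iotaApp a x ≫ (F.map (𝟙 a)).map p ≫ F.chiApp (𝟙 a) f y) ⊗≫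
    (F.iotaCell a p).inv ▷ F.chiApp (𝟙 a) f y ⊗≫
    p ◁ (F.deltaApp f y).inv

end TrihomData

/-- 0-cells of `el F`. -/
structure El {B : Type u₁} [Bicategory.{w₁, v₁} B]
    (F : Trihomomorphism.{w₁, w₂, v₁, v₂, u₁, u₂} B) where
  base : B
  fiber : F.obj base

namespace El

variable {B : Type u₁} [Bicategory.{w₁, v₁} B]
  {F : Trihomomorphism.{w₁, w₂, v₁, v₂, u₁, u₂} B}

/-- 1-cells of `el F`. -/
structure Hom (x y : El F) where
  base : x.base ⟶ y.base
  fiber : x.fiber ⟶ (F.map base).obj y.fiber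

/-- 2-cells of `el F`. -/
@[ext]
structure Hom₂ {x y : El F} (f g : Hom x y) where
  base : f.base ⟶ g.base
  fiber : f.fiber ⟶ g.fiber ≫ F.app base y.fiber

variable (F) in
/-- The Grothendieck construction `el F`, as the data of a bicategory. -/
def data : BicategoryData (El F) where
  Hom := Hom
  Hom₂ := Hom₂
  id x := ⟨𝟙 x.base, F.iotaApp x.base x.fiber⟩
  comp f g := ⟨f.base ≫ g.base, F.elComp f.fiber g.fiber⟩
  id₂ f := ⟨𝟙 f.base, F.elId₂ f.fiber⟩
  vcomp α β := ⟨α.base ≫ β.base, F.elVcomp α.fiber β.fiber⟩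
  hcomp α β := ⟨hcomp₂ α.base β.base, F.elHcomp α.fiber β.fiber⟩
  assoc f g h := ⟨(α_ f.base g.base h.base).hom, F.elAssoc f.fiber g.fiber h.fiber⟩
  unitDom f := ⟨(λ_ f.base).hom, F.elUnitDom f.fiber⟩
  unitCod f := ⟨(ρ_ f.base).inv, F.elUnitCod f.fiber⟩

variable (F) in
/-- The projection `P_F : el F ⟶ B`, as a homomorphism that strictly preserves composition and
identities. -/
def proj (H : (data F).IsBicategory) :
    letI := BicategoryData.toBicategory H
    StrictPseudofunctor (El F) B :=
  letI := BicategoryData.toBicategory H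
  { obj := fun x => x.base
    map := fun f => f.base
    map₂ := fun α => α.base
    mapId := fun x => Iso.refl (𝟙 x.base)
    mapComp := fun f g => Iso.refl (f.base ≫ g.base)
    map_id := fun _ => rfl
    map_comp := fun _ _ => rfl
    map₂_id := fun _ => rfl
    map₂_comp := fun _ _ => rfl
    mapId_eq_eqToIso := fun _ => rfl
    mapComp_eq_eqToIso := fun _ _ => rfl
    map₂_whisker_left := by
      intro x y z f g h η
      change 𝟙 f.base ▷ g.base ≫ f.base ◁ η.base =
        𝟙 (f.base ≫ g.base) ≫ f.base ◁ η.base ≫ 𝟙 (f.base ≫ h.base)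
      simp
    map₂_whisker_right := by
      intro x y z f g η h
      change η.base ▷ h.base ≫ g.base ◁ 𝟙 h.base =
        𝟙 (f.base ≫ h.base) ≫ η.base ▷ h.base ≫ 𝟙 (g.base ≫ h.base)
      simp
    map₂_associator := by
      intro x y z t f g h
      change (α_ f.base g.base h.base).hom = 𝟙 ((f.base ≫ g.base) ≫ h.base) ≫
        𝟙 (f.base ≫ g.base) ▷ h.base ≫ (α_ f.base g.base h.base).hom ≫
          f.base ◁ 𝟙 (g.base ≫ h.base) ≫ 𝟙 (f.base ≫ g.base ≫ h.base)
      simp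
    map₂_left_unitor := by
      intro x y f
      change (λ_ f.base).hom = 𝟙 (𝟙 x.base ≫ f.base) ≫ 𝟙 (𝟙 x.base) ▷ f.base ≫ (λ_ f.base).hom
      simp
    map₂_right_unitor := by
      intro x y (f : Hom x y)
      change (H.unitCod_invertible f).choose.base =
        𝟙 (f.base ≫ 𝟙 y.base) ≫ f.base ◁ 𝟙 (𝟙 y.base) ≫ (ρ_ f.base).hom
      have h : (ρ_ f.base).inv ≫ (H.unitCod_invertible f).choose.base = 𝟙 f.base :=
        congrArg Hom₂.base (H.unitCod_invertible f).choose_spec.1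
      refine ((Iso.inv_comp_eq (ρ_ f.base)).1 h).trans ?_
      simp }

/-- The 1-cell `(f, 1) : (x, F f y') ⟶ (y, y')`. -/
def lift₁ {x : B} (y : El F) (f : x ⟶ y.base) :
    (data F).Hom ⟨x, (F.map f).obj y.fiber⟩ y :=
  (⟨f, 𝟙 ((F.map f).obj y.fiber)⟩ : Hom _ _)

/-- The 2-cell `(α, 1) : (f, F α ∘ g') ⟶ (g, g')`. -/
def lift₂ {x y : El F} (g : Hom x y) {f : x.base ⟶ y.base} (α : f ⟶ g.base) :
    (data F).Hom₂ (⟨f, g.fiber ≫ F.app α y.fiber⟩ : Hom x y) g :=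
  (⟨α, 𝟙 (g.fiber ≫ F.app α y.fiber)⟩ : Hom₂ _ _)

end El

/-!
The fibre component of a 2-cell of `el F` is a pasting in some bicategory `F x`, so each axiom of a
bicategory for `el F` is an equation between pastings, to be deduced from an axiom of `F` whiskered
by the 1-cells of the diagram. To keep coherence isomorphisms out of these deductions, every
composite of 1-cells is bracketed to the left, and each structure 2-cell of `F` is replaced by its
action after an arbitrary 1-cell `u`: from `e : a ≫ b ≅ c ≫ d` one obtains
`act₂₂ e u : (u ≫ a) ≫ b ≅ (u ≫ c) ≫ d`, natural in `u`. A 2-cell is then a composite of whiskerings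
of such actions on the right, two successive factors that concern different parts of the composite
commute by naturality in `u`, and an axiom of `F` becomes an equation between actions
(`act_chi_id`, `act_chi_comp`, `act_omega_nat`, `act_gamma_nat`, `act_delta_nat`, `act_assoc`,
`act_unit`). In the same way `F f` turns a pasting of actions in `F y` into one in `F x`
(`map_act₂₂`, `map_act₃₂`, `map₂_elHcomp`, `map₂_elAssoc`), once the images of composites are split.

With this normal form the bicategory axioms correspond to the axioms of `F`: functoriality of
horizontal composition to pseudo-naturality of `χ` in 2-cells (`elHcomp_id`, `elHcomp_vcomp`),
naturality of the constraints to naturality of `ω`, `γ` and `δ` (`elAssoc_natural`,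
`elUnitCod_natural`, `elUnitDom_natural`), the pentagon to the axiom over the pentagon
(`act_pentagon`, `elPentagon`), and the triangle to the axiom over the triangle (`elTriangle`).

For the fibration property, a 2-cell `(α, m)` is cartesian exactly when `m` is invertible
(`El.isCartesian₂_of_isIso`, `El.isIso_of_isCartesian₂`). This gives the local fibrations, and
closure under horizontal composition because the horizontal composite of invertible fibre components
is a composite of invertible 2-cells. The 1-cell `(f, 1)` is cartesian because composition with it
after a 1-cell over `h` acts on fibre components by composition with `F h 1` and with a component of
`χ`, which are equivalences: it is essentially surjective on 1-cells (`exists_elComp_id_iso`) and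
bijective on 2-cells (`elHcomp_id_bijective`). Finally, any lift `(ĥ, α̂, β̂)` is made strict by
replacing `ĥ` with the source of the cartesian 2-cell over `β̂⁻¹`.
-/

/-! ### Coherence cells acting after a 1-cell -/

namespace LeftNormal

/-- Transport of an equation of 2-cells along a 1-cell `u`: both sides of `l = r` are whiskerings of
the sides of `η = θ` with `u`, up to the same 2-cells `i` and `j`, in practice coherence
isomorphisms. -/
lemma eq_of_whiskerLeft {X : Type u₁} [Bicategory.{w₁, v₁} X] {w x y : X}
    {a b : x ⟶ y} {η θ : a ⟶ b} (h : η = θ) (u : w ⟶ x) {c d : w ⟶ y} (i : c ⟶ u ≫ a)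
    (j : u ≫ b ⟶ d) {l r : c ⟶ d} (hl : l = i ≫ u ◁ η ≫ j) (hr : r = i ≫ u ◁ θ ≫ j) :
    l = r := by
  rw [hl, hr, h]

section Act

variable {X : Type u₁} [Bicategory.{w₁, v₁} X] {w x y z t s : X}

/-- The action of `e : a ≅ 1` after a 1-cell `u`. In `actₘₙ` the subscripts count the 1-cells in the
source and in the target of `e`; all composites are bracketed to the left. -/
def act₁₀ {a : x ⟶ x} (e : a ≅ 𝟙 x) (u : w ⟶ x) : u ≫ a ≅ u :=
  whiskerLeftIso u e ≪≫ ρ_ u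

/-- The action of `e : a ≫ b ≅ c` after a 1-cell `u`. -/
def act₂₁ {a : x ⟶ y} {b : y ⟶ z} {c : x ⟶ z} (e : a ≫ b ≅ c) (u : w ⟶ x) :
    (u ≫ a) ≫ b ≅ u ≫ c :=
  α_ u a b ≪≫ whiskerLeftIso u e

/-- The action of `e : a ≫ b ≅ c ≫ d` after a 1-cell `u`. -/
def act₂₂ {a : x ⟶ y} {b : y ⟶ z} {c : x ⟶ t} {d : t ⟶ z} (e : a ≫ b ≅ c ≫ d) (u : w ⟶ x) :
    (u ≫ a) ≫ b ≅ (u ≫ c) ≫ d :=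
  act₂₁ e u ≪≫ (α_ u c d).symm

/-- The action of `e : (a ≫ b) ≫ c ≅ 1` after a 1-cell `u`. -/
def act₃₀ {a : x ⟶ y} {b : y ⟶ z} {c : z ⟶ x} (e : (a ≫ b) ≫ c ≅ 𝟙 x) (u : w ⟶ x) :
    ((u ≫ a) ≫ b) ≫ c ≅ u :=
  whiskerRightIso (α_ u a b) c ≪≫ act₂₁ e u ≪≫ ρ_ u

/-- The action of `e : (a ≫ b) ≫ c ≅ d ≫ k` after a 1-cell `u`. -/
def act₃₂ {a : x ⟶ y} {b : y ⟶ z} {c : z ⟶ t} {d : x ⟶ s} {k : s ⟶ t}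
    (e : (a ≫ b) ≫ c ≅ d ≫ k) (u : w ⟶ x) :
    ((u ≫ a) ≫ b) ≫ c ≅ (u ≫ d) ≫ k :=
  whiskerRightIso (α_ u a b) c ≪≫ act₂₂ e u

/-- Actions are natural in the 1-cell after which they take place. This lemma and its analogues for
the other shapes express that 2-cells on disjoint parts of a composite commute. -/
lemma act₁₀_natural {a : x ⟶ x} (e : a ≅ 𝟙 x) {u v : w ⟶ x} (t : u ⟶ v) :
    t ▷ a ≫ (act₁₀ e v).hom = (act₁₀ e u).hom ≫ t := by
  simp [act₁₀, ← whisker_exchange_assoc]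

lemma act₂₁_natural {a : x ⟶ y} {b : y ⟶ z} {c : x ⟶ z} (e : a ≫ b ≅ c) {u v : w ⟶ x}
    (t : u ⟶ v) : t ▷ a ▷ b ≫ (act₂₁ e v).hom = (act₂₁ e u).hom ≫ t ▷ c := by
  simp [act₂₁, whisker_exchange]

lemma act₂₁_natural_assoc {a : x ⟶ y} {b : y ⟶ z} {c : x ⟶ z} (e : a ≫ b ≅ c) {u v : w ⟶ x}
    (t : u ⟶ v) {l : w ⟶ z} (k : v ≫ c ⟶ l) :
    t ▷ a ▷ b ≫ (act₂₁ e v).hom ≫ k = (act₂₁ e u).hom ≫ t ▷ c ≫ k :=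
  (reassoc_of% (act₂₁_natural e t)) k

lemma act₂₂_natural {a : x ⟶ y} {b : y ⟶ z} {c : x ⟶ t} {d : t ⟶ z} (e : a ≫ b ≅ c ≫ d)
    {u v : w ⟶ x} (t : u ⟶ v) :
    t ▷ a ▷ b ≫ (act₂₂ e v).hom = (act₂₂ e u).hom ≫ t ▷ c ▷ d := by
  simp [act₂₂, act₂₁_natural_assoc]

lemma act₃₀_natural {a : x ⟶ y} {b : y ⟶ z} {c : z ⟶ x} (e : (a ≫ b) ≫ c ≅ 𝟙 x)
    {u v : w ⟶ x} (t : u ⟶ v) :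
    t ▷ a ▷ b ▷ c ≫ (act₃₀ e v).hom = (act₃₀ e u).hom ≫ t := by
  have h := act₂₁_natural_assoc e t (ρ_ v).hom
  rw [rightUnitor_naturality] at h
  simp only [act₃₀, Iso.trans_hom, whiskerRightIso_hom, Category.assoc]
  rw [← h, ← comp_whiskerRight_assoc, associator_naturality_left, comp_whiskerRight_assoc]

lemma act₃₂_natural {a : x ⟶ y} {b : y ⟶ z} {c : z ⟶ t} {d : x ⟶ s} {k : s ⟶ t}
    (e : (a ≫ b) ≫ c ≅ d ≫ k) {u v : w ⟶ x} (t : u ⟶ v) :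
    t ▷ a ▷ b ▷ c ≫ (act₃₂ e v).hom = (act₃₂ e u).hom ≫ t ▷ d ▷ k := by
  simp only [act₃₂, Iso.trans_hom, whiskerRightIso_hom, Category.assoc]
  rw [← act₂₂_natural, ← comp_whiskerRight_assoc, associator_naturality_left,
    comp_whiskerRight_assoc]

lemma act₃₂_natural_assoc {a : x ⟶ y} {b : y ⟶ z} {c : z ⟶ t} {d : x ⟶ s} {k : s ⟶ t}
    (e : (a ≫ b) ≫ c ≅ d ≫ k) {u v : w ⟶ x} (m : u ⟶ v) {l : w ⟶ t} (n : (v ≫ d) ≫ k ⟶ l) :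
    m ▷ a ▷ b ▷ c ≫ (act₃₂ e v).hom ≫ n = (act₃₂ e u).hom ≫ m ▷ d ▷ k ≫ n :=
  (reassoc_of% (act₃₂_natural e m)) n

lemma act₁₀_natural_inv {a : x ⟶ x} (e : a ≅ 𝟙 x) {u v : w ⟶ x} (t : u ⟶ v) :
    t ≫ (act₁₀ e v).inv = (act₁₀ e u).inv ≫ t ▷ a := by
  rw [Iso.comp_inv_eq, Category.assoc, act₁₀_natural, Iso.inv_hom_id_assoc]

lemma act₃₂_natural_inv {a : x ⟶ y} {b : y ⟶ z} {c : z ⟶ t} {d : x ⟶ s} {k : s ⟶ t}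
    (e : (a ≫ b) ≫ c ≅ d ≫ k) {u v : w ⟶ x} (t : u ⟶ v) :
    t ▷ d ▷ k ≫ (act₃₂ e v).inv = (act₃₂ e u).inv ≫ t ▷ a ▷ b ▷ c := by
  rw [Iso.comp_inv_eq, Category.assoc, act₃₂_natural, Iso.inv_hom_id_assoc]

lemma act₃₂_natural_inv_assoc {a : x ⟶ y} {b : y ⟶ z} {c : z ⟶ t} {d : x ⟶ s} {k : s ⟶ t}
    (e : (a ≫ b) ≫ c ≅ d ≫ k) {u v : w ⟶ x} (m : u ⟶ v) {l : w ⟶ t}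
    (n : ((v ≫ a) ≫ b) ≫ c ⟶ l) :
    m ▷ d ▷ k ≫ (act₃₂ e v).inv ≫ n = (act₃₂ e u).inv ≫ m ▷ a ▷ b ▷ c ≫ n :=
  (reassoc_of% (act₃₂_natural_inv e m)) n

end Act

section Whisker

variable {X : Type u₁} [Bicategory.{w₁, v₁} X] {x y z t s : X}

/-- A commutative square of 2-cells stays one after whiskering; used to apply the naturality of
actions inside a longer composite of 1-cells. -/
lemma whiskerRight_comp_eq {a b c d : x ⟶ y} {η : a ⟶ b} {θ : b ⟶ d} {η' : a ⟶ c} {θ' : c ⟶ d}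
    (h : η ≫ θ = η' ≫ θ') (k : y ⟶ z) : η ▷ k ≫ θ ▷ k = η' ▷ k ≫ θ' ▷ k := by
  rw [← comp_whiskerRight, h, comp_whiskerRight]

lemma whiskerRight_comp_eq_assoc {a b c d : x ⟶ y} {η : a ⟶ b} {θ : b ⟶ d} {η' : a ⟶ c}
    {θ' : c ⟶ d} (h : η ≫ θ = η' ≫ θ') (k : y ⟶ z) {l : x ⟶ z} (m : d ≫ k ⟶ l) :
    η ▷ k ≫ θ ▷ k ≫ m = η' ▷ k ≫ θ' ▷ k ≫ m :=
  (reassoc_of% (whiskerRight_comp_eq h k)) m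

lemma hom_inv_whiskerRight₂ {a b : x ⟶ y} (e : a ≅ b) (k : y ⟶ z) (l : z ⟶ t) :
    e.hom ▷ k ▷ l ≫ e.inv ▷ k ▷ l = 𝟙 _ := by
  simp [← comp_whiskerRight]

lemma hom_inv_whiskerRight₂_assoc {a b : x ⟶ y} (e : a ≅ b) (k : y ⟶ z) (l : z ⟶ t)
    {c : x ⟶ t} (m : (a ≫ k) ≫ l ⟶ c) : e.hom ▷ k ▷ l ≫ e.inv ▷ k ▷ l ≫ m = m :=
  (reassoc_of% (hom_inv_whiskerRight₂ e k l)) m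

lemma inv_hom_whiskerRight₂ {a b : x ⟶ y} (e : a ≅ b) (k : y ⟶ z) (l : z ⟶ t) :
    e.inv ▷ k ▷ l ≫ e.hom ▷ k ▷ l = 𝟙 _ := by
  simp [← comp_whiskerRight]

lemma inv_hom_whiskerRight₂_assoc {a b : x ⟶ y} (e : a ≅ b) (k : y ⟶ z) (l : z ⟶ t)
    {c : x ⟶ t} (m : (b ≫ k) ≫ l ⟶ c) : e.inv ▷ k ▷ l ≫ e.hom ▷ k ▷ l ≫ m = m :=
  (reassoc_of% (inv_hom_whiskerRight₂ e k l)) m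

lemma hom_inv_whiskerRight₃_assoc {a b : x ⟶ y} (e : a ≅ b) (k : y ⟶ z) (l : z ⟶ t) (m : t ⟶ s)
    {c : x ⟶ s} (n : ((a ≫ k) ≫ l) ≫ m ⟶ c) :
    e.hom ▷ k ▷ l ▷ m ≫ e.inv ▷ k ▷ l ▷ m ≫ n = n := by
  rw [← comp_whiskerRight_assoc, hom_inv_whiskerRight₂, id_whiskerRight, Category.id_comp]

lemma inv_hom_whiskerRight₃_assoc {a b : x ⟶ y} (e : a ≅ b) (k : y ⟶ z) (l : z ⟶ t) (m : t ⟶ s)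
    {c : x ⟶ s} (n : ((b ≫ k) ≫ l) ≫ m ⟶ c) :
    e.inv ▷ k ▷ l ▷ m ≫ e.hom ▷ k ▷ l ▷ m ≫ n = n := by
  rw [← comp_whiskerRight_assoc, inv_hom_whiskerRight₂, id_whiskerRight, Category.id_comp]

/-- Composition with an equivalence is fully faithful on 2-cells. -/
lemma whiskerRight_bijective {k : y ⟶ z} {l : z ⟶ y} (e : k ≫ l ≅ 𝟙 y) (e' : l ≫ k ≅ 𝟙 z)
    (u v : x ⟶ y) :
    Function.Bijective fun t : u ⟶ v => t ▷ k := by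
  -- Whiskering with `k ≫ l` is bijective, being isomorphic to the identity.
  have c {x y z : X} {k : y ⟶ z} {l : z ⟶ y} (e : k ≫ l ≅ 𝟙 y) {u v : x ⟶ y} (t : u ⟶ v) :
      t ▷ k ▷ l = (act₂₁ e u).hom ≫ (ρ_ u).hom ≫ t ≫ (ρ_ v).inv ≫ (act₂₁ e v).inv := by
    have h := act₂₁_natural e t
    rw [← cancel_mono (act₂₁ e v).hom, h]
    simp
  have i {x y z : X} {k : y ⟶ z} {l : z ⟶ y} (e : k ≫ l ≅ 𝟙 y) (u v : x ⟶ y) :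
      Function.Injective fun t : u ⟶ v => t ▷ k := by
    intro t t' h
    have h' := congrArg (· ▷ l) h
    simpa [c e] using h'
  refine ⟨i e u v, fun s => ⟨(ρ_ u).inv ≫ (act₂₁ e u).inv ≫ s ▷ l ≫ (act₂₁ e v).hom ≫ (ρ_ v).hom,
    i e' _ _ ?_⟩⟩
  change (_ ▷ k) ▷ l = s ▷ l
  rw [c e]
  simp

end Whisker

section Split

variable {Y : Type u₁} [Bicategory.{w₁, v₁} Y] {X : Type u₂} [Bicategory.{w₂, v₂} X]
  {Z : Type u₃} [Bicategory.{w₃, v₃} Z] (G : Y ⥤ᵖ X) {p q r s t : Y} {w : X}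

/-- The compositor of `G` after a 1-cell `u`, as `u · G (k ≫ l) ≅ (u · G k) · G l`. -/
def split (k : p ⟶ q) (l : q ⟶ r) (u : w ⟶ G.obj p) :
    u ≫ G.map (k ≫ l) ≅ (u ≫ G.map k) ≫ G.map l :=
  whiskerLeftIso u (G.mapComp k l) ≪≫ (α_ _ _ _).symm

/-- The unitor of `G` after a 1-cell `u`, as `u · G 1 ≅ u`. -/
def splitId (p : Y) (u : w ⟶ G.obj p) : u ≫ G.map (𝟙 p) ≅ u := act₁₀ (G.mapId p) u

lemma split_natural (k : p ⟶ q) (l : q ⟶ r) {u v : w ⟶ G.obj p} (t : u ⟶ v) :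
    t ▷ G.map (k ≫ l) ≫ (split G k l v).hom =
      (split G k l u).hom ≫ t ▷ G.map k ▷ G.map l := by
  simp only [split, Iso.trans_hom, whiskerLeftIso_hom, Iso.symm_hom, Category.assoc]
  rw [← whisker_exchange_assoc, associator_inv_naturality_left]

lemma split_natural_assoc (k : p ⟶ q) (l : q ⟶ r) {u v : w ⟶ G.obj p} (t : u ⟶ v)
    {c : w ⟶ G.obj r} (m : (v ≫ G.map k) ≫ G.map l ⟶ c) :
    t ▷ G.map (k ≫ l) ≫ (split G k l v).hom ≫ m =
      (split G k l u).hom ≫ t ▷ G.map k ▷ G.map l ≫ m :=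
  (reassoc_of% (split_natural G k l t)) m

lemma split_natural_left {k k' : p ⟶ q} (η : k ⟶ k') (l : q ⟶ r) (u : w ⟶ G.obj p) :
    u ◁ G.map₂ (η ▷ l) ≫ (split G k' l u).hom =
      (split G k l u).hom ≫ (u ◁ G.map₂ η) ▷ G.map l := by
  simp [split]

lemma split_natural_left_assoc {k k' : p ⟶ q} (η : k ⟶ k') (l : q ⟶ r) (u : w ⟶ G.obj p)
    {c : w ⟶ G.obj r} (m : (u ≫ G.map k') ≫ G.map l ⟶ c) :
    u ◁ G.map₂ (η ▷ l) ≫ (split G k' l u).hom ≫ m =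
      (split G k l u).hom ≫ (u ◁ G.map₂ η) ▷ G.map l ≫ m :=
  (reassoc_of% (split_natural_left G η l u)) m

lemma split_natural_right (k : p ⟶ q) {l l' : q ⟶ r} (η : l ⟶ l') (u : w ⟶ G.obj p) :
    u ◁ G.map₂ (k ◁ η) ≫ (split G k l' u).hom =
      (split G k l u).hom ≫ (u ≫ G.map k) ◁ G.map₂ η := by
  simp [split]

lemma split_assoc (k : p ⟶ q) (l : q ⟶ r) (m : r ⟶ s) (u : w ⟶ G.obj p) :
    u ◁ G.map₂ (α_ k l m).hom ≫ (split G k (l ≫ m) u).hom ≫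
        (split G l m (u ≫ G.map k)).hom =
      (split G (k ≫ l) m u).hom ≫ (split G k l u).hom ▷ G.map m := by
  simp [split]

lemma split_assoc_inv (k : p ⟶ q) (l : q ⟶ r) (m : r ⟶ s) (u : w ⟶ G.obj p) :
    u ◁ G.map₂ (α_ k l m).inv ≫ (split G (k ≫ l) m u).hom ≫ (split G k l u).hom ▷ G.map m =
      (split G k (l ≫ m) u).hom ≫ (split G l m (u ≫ G.map k)).hom := by
  rw [← split_assoc, ← Bicategory.whiskerLeft_comp_assoc, ← G.map₂_comp]
  simp

lemma split_assoc' (k : p ⟶ q) (l : q ⟶ r) (m : r ⟶ s) (u : w ⟶ G.obj p) :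
    u ◁ G.map₂ (α_ k l m).hom ≫ (split G k (l ≫ m) u).hom =
      (split G (k ≫ l) m u).hom ≫ (split G k l u).hom ▷ G.map m ≫
        (split G l m (u ≫ G.map k)).inv := by
  rw [← reassoc_of% split_assoc, Iso.hom_inv_id, Category.comp_id]

/-- The image under `G` of `e : a ≫ b ≅ c ≫ d`, with the compositors of `G` inserted. -/
def mapIso₂₂ {a : p ⟶ q} {b : q ⟶ r} {c : p ⟶ s} {d : s ⟶ r} (e : a ≫ b ≅ c ≫ d) :
    G.map a ≫ G.map b ≅ G.map c ≫ G.map d :=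
  (G.mapComp a b).symm ≪≫ G.map₂Iso e ≪≫ G.mapComp c d

/-- The image under `G` of `e : a ≫ b ≅ c`, with the compositor of `G` inserted. -/
def mapIso₂₁ {a : p ⟶ q} {b : q ⟶ r} {c : p ⟶ r} (e : a ≫ b ≅ c) :
    G.map a ≫ G.map b ≅ G.map c :=
  (G.mapComp a b).symm ≪≫ G.map₂Iso e

/-- The image under `G` of `e : a ≅ 1`, with the unitor of `G` inserted. -/
def mapIso₁₀ {a : p ⟶ p} (e : a ≅ 𝟙 p) : G.map a ≅ 𝟙 (G.obj p) :=
  G.map₂Iso e ≪≫ G.mapId p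

/-- The image under `G` of `e : (a ≫ b) ≫ c ≅ d ≫ k`, with the compositors of `G` inserted. -/
def mapIso₃₂ {a : p ⟶ q} {b : q ⟶ r} {c : r ⟶ s} {d : p ⟶ t} {k : t ⟶ s}
    (e : (a ≫ b) ≫ c ≅ d ≫ k) : (G.map a ≫ G.map b) ≫ G.map c ≅ G.map d ≫ G.map k :=
  whiskerRightIso (G.mapComp a b).symm (G.map c) ≪≫ mapIso₂₂ G e

/-- A homomorphism sends the action of `e` after `v` to the action of the image of `e` after the
image of `v`, once the images of composites are split. Likewise for the other shapes below. -/
lemma map_act₁₀ {a : q ⟶ q} (e : a ≅ 𝟙 q) (v : p ⟶ q) (u : w ⟶ G.obj p) :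
    u ◁ G.map₂ (act₁₀ e v).hom =
      (split G v a u).hom ≫ (act₁₀ (mapIso₁₀ G e) (u ≫ G.map v)).hom := by
  have := split_natural_right G v e.hom u =≫ (splitId G q (u ≫ G.map v)).hom
  simp [act₁₀, mapIso₁₀, split, splitId, Pseudofunctor.map₂_right_unitor] at this ⊢

lemma map_act₂₁ {a : q ⟶ r} {b : r ⟶ s} {c : q ⟶ s} (e : a ≫ b ≅ c) (v : p ⟶ q)
    (u : w ⟶ G.obj p) :
    u ◁ G.map₂ (act₂₁ e v).hom ≫ (split G v c u).hom =
      (split G (v ≫ a) b u).hom ≫ (split G v a u).hom ▷ G.map b ≫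
        (act₂₁ (mapIso₂₁ G e) (u ≫ G.map v)).hom := by
  rw [← reassoc_of% split_assoc]
  simp [act₂₁, mapIso₂₁]
  simp [split]

lemma map_act₂₂ {a : q ⟶ r} {b : r ⟶ s} {c : q ⟶ t} {d : t ⟶ s} (e : a ≫ b ≅ c ≫ d)
    (v : p ⟶ q) (u : w ⟶ G.obj p) :
    u ◁ G.map₂ (act₂₂ e v).hom ≫ (split G (v ≫ c) d u).hom ≫ (split G v c u).hom ▷ G.map d =
      (split G (v ≫ a) b u).hom ≫ (split G v a u).hom ▷ G.map b ≫
        (act₂₂ (mapIso₂₂ G e) (u ≫ G.map v)).hom := by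
  have h := map_act₂₁ G e v u =≫ (split G c d (u ≫ G.map v)).hom
  simp only [Category.assoc] at h
  rw [← split_assoc_inv, ← Bicategory.whiskerLeft_comp_assoc, ← G.map₂_comp] at h
  refine h.trans ?_
  simp [act₂₂, act₂₁, mapIso₂₂, mapIso₂₁, split]

lemma map_act₃₂ {a : q ⟶ r} {b : r ⟶ s} {c : s ⟶ t} {r' : Y} {d : q ⟶ r'} {k : r' ⟶ t}
    (e : (a ≫ b) ≫ c ≅ d ≫ k)
    (v : p ⟶ q) (u : w ⟶ G.obj p) :
    u ◁ G.map₂ (act₃₂ e v).hom ≫ (split G (v ≫ d) k u).hom ≫ (split G v d u).hom ▷ G.map k =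
      (split G ((v ≫ a) ≫ b) c u).hom ≫ (split G (v ≫ a) b u).hom ▷ G.map c ≫
        (split G v a u).hom ▷ G.map b ▷ G.map c ≫
        (act₃₂ (mapIso₃₂ G e) (u ≫ G.map v)).hom := by
  have h := map_act₂₂ G e v u
  rw [act₃₂]
  simp only [Iso.trans_hom, G.map₂_comp, Bicategory.whiskerLeft_comp, Category.assoc, h,
    whiskerRightIso_hom, split_natural_left_assoc]
  rw [← comp_whiskerRight_assoc, split_assoc']
  simp only [act₃₂, mapIso₃₂, act₂₂, act₂₁, split, Iso.trans_hom, Iso.trans_inv,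
    whiskerRightIso_hom, whiskerLeftIso_hom, whiskerLeftIso_inv, Iso.symm_hom, Iso.symm_inv,
    Category.assoc, Bicategory.whiskerLeft_comp, comp_whiskerRight]
  bicategory

lemma map_act₃₂_inv {r' : Y} {a : q ⟶ r} {b : r ⟶ s}
    {c : s ⟶ t} {d : q ⟶ r'} {k : r' ⟶ t} (e : (a ≫ b) ≫ c ≅ d ≫ k) (v : p ⟶ q)
    (u : w ⟶ G.obj p) :
    u ◁ G.map₂ (act₃₂ e v).inv ≫ (split G ((v ≫ a) ≫ b) c u).hom ≫
        (split G (v ≫ a) b u).hom ▷ G.map c ≫ (split G v a u).hom ▷ G.map b ▷ G.map c =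
      (split G (v ≫ d) k u).hom ≫ (split G v d u).hom ▷ G.map k ≫
        (act₃₂ (mapIso₃₂ G e) (u ≫ G.map v)).inv := by
  rw [← cancel_epi (u ◁ G.map₂ (act₃₂ e v).hom), reassoc_of% map_act₃₂, Iso.hom_inv_id,
    ← Bicategory.whiskerLeft_comp_assoc, ← PrelaxFunctor.map₂_comp]
  simp

/-- The case of `map_act₂₂` with no 1-cell `v`. -/
lemma map_iso₂₂ {a : q ⟶ r} {b : r ⟶ s}
    {c : q ⟶ t} {d : t ⟶ s} (e : a ≫ b ≅ c ≫ d) (u : w ⟶ G.obj q) :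
    u ◁ G.map₂ e.hom ≫ (split G c d u).hom =
      (split G a b u).hom ≫ (act₂₂ (mapIso₂₂ G e) u).hom := by
  simp [split, act₂₂, act₂₁, mapIso₂₂]

/-- The two ways of splitting the image under `G` of a splitting for `K` agree. -/
lemma map_split {K : Z ⥤ᵖ Y} {p₀ : Y} {q r s : Z} (k : q ⟶ r) (l : r ⟶ s) (v : p₀ ⟶ K.obj q)
    (u : w ⟶ G.obj p₀) :
    u ◁ G.map₂ (split K k l v).hom ≫ (split G (v ≫ K.map k) (K.map l) u).hom ≫
        (split G v (K.map k) u).hom ▷ G.map (K.map l) =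
      (split G v (K.map (k ≫ l)) u).hom ≫ (u ≫ G.map v) ◁ G.map₂ (K.mapComp k l).hom ≫
        (split G (K.map k) (K.map l) (u ≫ G.map v)).hom := by
  rw [← reassoc_of% split_natural_right, ← split_assoc_inv]
  simp [split]

/-- The source of `mapIso₃₂ G e` has the image of `a ≫ b` split; without this splitting `e` acts
through `mapIso₂₂ G e`. -/
lemma act₃₂_mapIso₃₂_hom {a : p ⟶ q} {b : q ⟶ r} {c : r ⟶ s} {d : p ⟶ t} {k : t ⟶ s}
    (e : (a ≫ b) ≫ c ≅ d ≫ k) (u : w ⟶ G.obj p) :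
    (act₂₂ (mapIso₂₂ G e) u).hom =
      (split G a b u).hom ▷ G.map c ≫ (act₃₂ (mapIso₃₂ G e) u).hom := by
  simp [act₂₂, act₂₁, act₃₂, mapIso₃₂, split]

lemma mapIso₃₂_associator_hom {a : p ⟶ q} {b : q ⟶ r} {c : r ⟶ s} {d : p ⟶ t} {k : t ⟶ s}
    (e : a ≫ b ≫ c ≅ d ≫ k) :
    (mapIso₃₂ G (α_ a b c ≪≫ e)).hom = (α_ _ _ _).hom ≫ G.map a ◁ (G.mapComp b c).inv ≫
      (G.mapComp a (b ≫ c)).inv ≫ G.map₂ e.hom ≫ (G.mapComp d k).hom := by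
  simp only [mapIso₃₂, mapIso₂₂, Iso.trans_hom, Iso.symm_hom, whiskerRightIso_hom,
    PrelaxFunctor.map₂Iso_hom, PrelaxFunctor.map₂_comp, G.map₂_associator, Category.assoc,
    Iso.inv_hom_id_assoc]
  simp

end Split

section Transformation

variable {Y : Type u₁} [Bicategory.{w₁, v₁} Y] {X : Type u₂} [Bicategory.{w₂, v₂} X]
  {G H : Y ⥤ᵖ X} (η : G ⟶ H) {p q r : Y} {w : X}

/-- The naturality cell of a transformation, acting after `u`, is natural in the 1-cell `k`. -/
lemma act_naturality_natural {k k' : p ⟶ q} (θ : k ⟶ k') (u : w ⟶ G.obj p) :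
    (u ≫ η.app p) ◁ H.map₂ θ ≫ (act₂₂ (η.naturality k').symm u).hom =
      (act₂₂ (η.naturality k).symm u).hom ≫ (u ◁ G.map₂ θ) ▷ η.app q := by
  have h : η.app p ◁ H.map₂ θ ≫ (η.naturality k').inv =
      (η.naturality k).inv ≫ G.map₂ θ ▷ η.app q := by
    rw [Iso.comp_inv_eq, Category.assoc, η.naturality_naturality, Iso.inv_hom_id_assoc]
  refine eq_of_whiskerLeft h u ⊗𝟙.hom ⊗𝟙.hom ?_ ?_
  · simp only [act₂₂, act₂₁, Iso.trans_hom, whiskerLeftIso_hom, Iso.symm_hom]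
    bicategory
  · simp only [act₂₂, act₂₁, Iso.trans_hom, whiskerLeftIso_hom, Iso.symm_hom]
    bicategory

lemma act_naturality_comp (k : p ⟶ q) (l : q ⟶ r) (u : w ⟶ G.obj p) :
    (split H k l (u ≫ η.app p)).hom ≫ (act₂₂ (η.naturality k).symm u).hom ▷ H.map l ≫
        (act₂₂ (η.naturality l).symm (u ≫ G.map k)).hom =
      (act₂₂ (η.naturality (k ≫ l)).symm u).hom ≫ (split G k l u).hom ▷ η.app r := by
  have h : η.app p ◁ (H.mapComp k l).hom ≫ (α_ _ _ _).inv ≫ (η.naturality k).inv ▷ H.map l ≫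
      (α_ _ _ _).hom ≫ G.map k ◁ (η.naturality l).inv ≫ (α_ _ _ _).inv =
        (η.naturality (k ≫ l)).inv ≫ (G.mapComp k l).hom ▷ η.app r := by
    rw [Iso.eq_inv_comp, η.naturality_comp_assoc]
    simp
  refine eq_of_whiskerLeft h u ⊗𝟙.hom ⊗𝟙.hom ?_ ?_
  · simp only [act₂₂, act₂₁, split, Iso.trans_hom, whiskerLeftIso_hom, Iso.symm_hom]
    bicategory
  · simp only [act₂₂, act₂₁, split, Iso.trans_hom, whiskerLeftIso_hom, Iso.symm_hom]
    bicategory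

end Transformation

end LeftNormal

open LeftNormal Tricat

/-! ### Structure cells of a trihomomorphism acting after a 1-cell -/

namespace TrihomData

variable {B : Type u₁} [Bicategory.{w₁, v₁} B] (F : TrihomData.{w₁, w₂, v₁, v₂, u₁, u₂} B)
  {a b c d : B}

/-- The naturality cell of `F α` at `k`, acting after `u`: it moves `F α` past `k`. -/
abbrev actNat {f g : a ⟶ b} (α : f ⟶ g) {x y : F.obj b} (k : x ⟶ y) {w : F.obj a}
    (u : w ⟶ (F.map g).obj x) :
    (u ≫ F.app α x) ≫ (F.map f).map k ≅ (u ≫ (F.map g).map k) ≫ F.app α y :=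
  act₂₂ (F.appNat α k).symm u

/-- The composition constraint of `F` on 2-cells, acting after `u`. -/
abbrev actComp {f g h : a ⟶ b} (α : f ⟶ g) (β : g ⟶ h) (γ : f ⟶ h) (e : α ≫ β = γ)
    {x : F.obj b} {w : F.obj a} (u : w ⟶ (F.map h).obj x) :
    (u ≫ F.app β x) ≫ F.app α x ≅ u ≫ F.app γ x :=
  act₂₁ (F.appComp α β γ e x) u

/-- The identity constraint of `F` on 2-cells, acting after `u`. -/
abbrev actId {f : a ⟶ b} (α : f ⟶ f) (e : α = 𝟙 f) {x : F.obj b} {w : F.obj a}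
    (u : w ⟶ (F.map f).obj x) : u ≫ F.app α x ≅ u :=
  act₁₀ (F.appId α e x) u

/-- The naturality cell of `χ` at a 1-cell `k`, acting after `u`. -/
abbrev actChi (f : a ⟶ b) (g : b ⟶ c) {x y : F.obj c} (k : x ⟶ y) {w : F.obj a}
    (u : w ⟶ (F.map f).obj ((F.map g).obj x)) :
    (u ≫ F.chiApp f g x) ≫ (F.map (f ≫ g)).map k ≅
      (u ≫ (F.map f).map ((F.map g).map k)) ≫ F.chiApp f g y :=
  act₂₂ (F.chiCell f g k).symm u

/-- The naturality cell of `χ` at 2-cells `α` and `β`, acting after `u`. -/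
abbrev actChiNat {f f' : a ⟶ b} {g g' : b ⟶ c} (α : f ⟶ f') (β : g ⟶ g') {x : F.obj c}
    {w : F.obj a} (u : w ⟶ (F.map f').obj ((F.map g').obj x)) :
    ((u ≫ F.app α ((F.map g').obj x)) ≫ (F.map f).map (F.app β x)) ≫ F.chiApp f g x ≅
      (u ≫ F.chiApp f' g' x) ≫ F.app (hcomp₂ α β) x :=
  act₃₂ (F.chiNatApp α β x) u

/-- The component of `ω`, acting after `u`. -/
abbrev actOmega (f : a ⟶ b) (g : b ⟶ c) (h : c ⟶ d) {x : F.obj d} {w : F.obj a}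
    (u : w ⟶ (F.map f).obj ((F.map g).obj ((F.map h).obj x))) :
    ((u ≫ (F.map f).map (F.chiApp g h x)) ≫ F.chiApp f (g ≫ h) x) ≫ F.app (α_ f g h).hom x ≅
      (u ≫ F.chiApp f g ((F.map h).obj x)) ≫ F.chiApp (f ≫ g) h x :=
  act₃₂ (α_ _ _ _ ≪≫ F.omegaApp f g h x) u

/-- The component of `γ`, acting after `u`. -/
abbrev actGamma (f : a ⟶ b) {x : F.obj b} {w : F.obj a} (u : w ⟶ (F.map f).obj x) :
    ((u ≫ (F.map f).map (F.iotaApp b x)) ≫ F.chiApp f (𝟙 b) x) ≫ F.app (ρ_ f).inv x ≅ u :=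
  act₃₀ (α_ _ _ _ ≪≫ F.gammaApp f x) u

/-- The naturality cell of `ι` at a 1-cell `k`, acting after `u`. -/
abbrev actIota {x y : F.obj a} (k : x ⟶ y) {w : F.obj a} (u : w ⟶ x) :
    (u ≫ F.iotaApp a x) ≫ (F.map (𝟙 a)).map k ≅ (u ≫ k) ≫ F.iotaApp a y :=
  act₂₂ (F.iotaCell a k).symm u

/-- The inverse of the component of `δ`, acting after `u`. -/
abbrev actDelta (f : a ⟶ b) {x : F.obj b} {w : F.obj a} (u : w ⟶ (F.map f).obj x) :
    (u ≫ F.iotaApp a ((F.map f).obj x)) ≫ F.chiApp (𝟙 a) f x ≅ u ≫ F.app (λ_ f).hom x :=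
  act₂₁ (F.deltaApp f x).symm u

variable {F}

lemma actNat_natural {f g : a ⟶ b} (α : f ⟶ g) {x y : F.obj b} {k k' : x ⟶ y} (θ : k ⟶ k')
    {w : F.obj a} (u : w ⟶ (F.map g).obj x) :
    (u ≫ F.app α x) ◁ (F.map f).map₂ θ ≫ (F.actNat α k' u).hom =
      (F.actNat α k u).hom ≫ (u ◁ (F.map g).map₂ θ) ▷ F.app α y :=
  act_naturality_natural (F.map₂ α) θ u

lemma actNat_comp {f g : a ⟶ b} (α : f ⟶ g) {x y z : F.obj b} (k : x ⟶ y) (l : y ⟶ z)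
    {w : F.obj a} (u : w ⟶ (F.map g).obj x) :
    (split (F.map f) k l (u ≫ F.app α x)).hom ≫ (F.actNat α k u).hom ▷ (F.map f).map l ≫
        (F.actNat α l (u ≫ (F.map g).map k)).hom =
      (F.actNat α (k ≫ l) u).hom ≫ (split (F.map g) k l u).hom ▷ F.app α z :=
  act_naturality_comp (F.map₂ α) k l u

lemma actChi_natural (f : a ⟶ b) (g : b ⟶ c) {x y : F.obj c} {k k' : x ⟶ y} (θ : k ⟶ k')
    {w : F.obj a} (u : w ⟶ (F.map f).obj ((F.map g).obj x)) :
    (u ≫ F.chiApp f g x) ◁ (F.map (f ≫ g)).map₂ θ ≫ (F.actChi f g k' u).hom =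
      (F.actChi f g k u).hom ≫ (u ◁ (F.map f).map₂ ((F.map g).map₂ θ)) ▷ F.chiApp f g y :=
  act_naturality_natural (F.chi f g).hom θ u

lemma actChi_comp (f : a ⟶ b) (g : b ⟶ c) {x y z : F.obj c} (k : x ⟶ y) (l : y ⟶ z)
    {w : F.obj a} (u : w ⟶ (F.map f).obj ((F.map g).obj x)) :
    (split (F.map (f ≫ g)) k l (u ≫ F.chiApp f g x)).hom ≫
        (F.actChi f g k u).hom ▷ (F.map (f ≫ g)).map l ≫
        (F.actChi f g l (u ≫ (F.map f).map ((F.map g).map k))).hom =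
      (F.actChi f g (k ≫ l) u).hom ≫
        (u ◁ (F.map f).map₂ ((F.map g).mapComp k l).hom) ▷ F.chiApp f g z ≫
        (split (F.map f) ((F.map g).map k) ((F.map g).map l) u).hom ▷ F.chiApp f g z := by
  rw [← comp_whiskerRight]
  refine (act_naturality_comp (F.chi f g).hom k l u).trans ?_
  congr 2
  simp only [split, Iso.trans_hom, whiskerLeftIso_hom, ← Bicategory.whiskerLeft_comp_assoc]
  rfl

lemma iotaCell_natural {x y : F.obj a} {k k' : x ⟶ y} (θ : k ⟶ k') :
    F.iotaApp a x ◁ (F.map (𝟙 a)).map₂ θ ≫ (F.iotaCell a k').inv =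
      (F.iotaCell a k).inv ≫ θ ▷ F.iotaApp a y := by
  rw [Iso.comp_inv_eq, Category.assoc]
  exact (((F.iotaCell a k).inv_comp_eq).2 ((F.iota a).hom.naturality_naturality θ)).symm

/-- Compatibility of the naturality cell of `ι` with composition; the first of the two cells does
not act after any 1-cell. -/
lemma iotaCell_comp {x y z : F.obj a} (k : x ⟶ y) (l : y ⟶ z) :
    (split (F.map (𝟙 a)) k l (F.iotaApp a x)).hom ≫
        (F.iotaCell a k).inv ▷ (F.map (𝟙 a)).map l ≫ (F.actIota l k).hom =
      (F.iotaCell a (k ≫ l)).inv := by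
  have h : (F.iotaCell a (k ≫ l)).hom ≫ F.iotaApp a x ◁ ((F.map (𝟙 a)).mapComp k l).hom =
      𝟙 ((k ≫ l) ≫ F.iotaApp a z) ≫ (α_ _ _ _).hom ≫ k ◁ (F.iotaCell a l).hom ≫ (α_ _ _ _).inv ≫
        (F.iotaCell a k).hom ▷ (F.map (𝟙 a)).map l ≫ (α_ _ _ _).hom := by
    refine ((F.iota a).hom.naturality_comp k l).trans ?_
    exact congrArg (· ≫ _) (id_whiskerRight _ _)
  rw [← cancel_epi (F.iotaCell a (k ≫ l)).hom, Iso.hom_inv_id]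
  simp only [split, act₂₂, act₂₁, Iso.trans_hom, whiskerLeftIso_hom, Iso.symm_hom, Category.assoc]
  rw [reassoc_of% h]
  simp

/-- The composition constraint is a modification. -/
lemma actComp_nat {f g h : a ⟶ b} (α : f ⟶ g) (β : g ⟶ h) (γ : f ⟶ h) (e : α ≫ β = γ)
    {x y : F.obj b} (k : x ⟶ y) {w : F.obj a} (u : w ⟶ (F.map h).obj x) :
    (F.actComp α β γ e u).hom ▷ (F.map f).map k ≫ (F.actNat γ k u).hom =
      (F.actNat α k (u ≫ F.app β x)).hom ≫ (F.actNat β k u).hom ▷ F.app α y ≫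
        (F.actComp α β γ e (u ≫ (F.map h).map k)).hom := by
  have m : (F.map h).map k ◁ (F.appComp α β γ e y).hom ≫ (F.appNat γ k).hom =
      ((α_ _ _ _).inv ≫ (F.appNat β k).hom ▷ F.app α y ≫ (α_ _ _ _).hom ≫
        F.app β x ◁ (F.appNat α k).hom ≫ (α_ _ _ _).inv) ≫
          (F.appComp α β γ e x).hom ▷ (F.map f).map k :=
    (F.compIso α β γ e).hom.as.naturality k
  have m' : (α_ _ _ _).inv ≫ (F.appComp α β γ e x).hom ▷ (F.map f).map k ≫ (F.appNat γ k).inv =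
      F.app β x ◁ (F.appNat α k).inv ≫ (α_ _ _ _).inv ≫ (F.appNat β k).inv ▷ F.app α y ≫
        (α_ _ _ _).hom ≫ (F.map h).map k ◁ (F.appComp α β γ e y).hom := by
    rw [← cancel_mono (F.appNat γ k).hom]
    simp [m]
  refine eq_of_whiskerLeft m' u ⊗𝟙.hom ⊗𝟙.hom ?_ ?_
  · simp only [act₂₁, act₂₂, Iso.trans_hom, whiskerLeftIso_hom, Iso.symm_hom]
    bicategory
  · simp only [act₂₁, act₂₂, Iso.trans_hom, whiskerLeftIso_hom, Iso.symm_hom]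
    bicategory

/-- The identity constraint is a modification. -/
lemma actId_nat {f : a ⟶ b} (α : f ⟶ f) (e : α = 𝟙 f) {x y : F.obj b} (k : x ⟶ y) {w : F.obj a}
    (u : w ⟶ (F.map f).obj x) :
    (F.actNat α k u).hom ≫ (F.actId α e (u ≫ (F.map f).map k)).hom =
      (F.actId α e u).hom ▷ (F.map f).map k := by
  have m : (F.map f).map k ◁ (F.appId α e y).hom ≫ (ρ_ _).hom ≫ (λ_ _).inv =
      (F.appNat α k).hom ≫ (F.appId α e x).hom ▷ (F.map f).map k :=
    (F.idIso α e).hom.as.naturality k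
  rw [← Iso.inv_comp_eq] at m
  refine eq_of_whiskerLeft m u ⊗𝟙.hom ⊗𝟙.hom ?_ ?_
  · simp only [act₁₀, act₂₁, act₂₂, Iso.trans_hom, whiskerLeftIso_hom, Iso.symm_hom]
    bicategory
  · simp only [act₁₀, Iso.trans_hom, whiskerLeftIso_hom]
    bicategory

lemma actComp_assoc {f g h i : a ⟶ b} (α : f ⟶ g) (β : g ⟶ h) (γ : h ⟶ i)
    (αβ : f ⟶ h) (βγ : g ⟶ i) (αβγ : f ⟶ i) (e₁ : α ≫ β = αβ) (e₂ : β ≫ γ = βγ)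
    (e₃ : α ≫ βγ = αβγ) (e₄ : αβ ≫ γ = αβγ) {x : F.obj b}
    {w : F.obj a} (u : w ⟶ (F.map i).obj x) :
    (F.actComp β γ βγ e₂ u).hom ▷ F.app α x ≫ (F.actComp α βγ αβγ e₃ u).hom =
      (F.actComp α β αβ e₁ (u ≫ F.app γ x)).hom ≫ (F.actComp αβ γ αβγ e₄ u).hom := by
  have m : (F.appComp β γ βγ e₂ x).hom ▷ F.app α x ≫ (F.appComp α βγ αβγ e₃ x).hom =
      (α_ _ _ _).hom ≫ F.app γ x ◁ (F.appComp α β αβ e₁ x).hom ≫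
        (F.appComp αβ γ αβγ e₄ x).hom :=
    congrArg (fun m => m.as.app x)
      ((F.hom a b).mapComp'_inv_whiskerRight_mapComp'₀₂₃_inv γ.op.toLoc β.op.toLoc α.op.toLoc
        βγ.op.toLoc αβ.op.toLoc αβγ.op.toLoc (by subst e₂; rfl) (by subst e₁; rfl)
        (by subst e₃; rfl))
  refine eq_of_whiskerLeft m u ⊗𝟙.hom ⊗𝟙.hom ?_ ?_
  · simp only [act₂₁, Iso.trans_hom, whiskerLeftIso_hom]
    bicategory
  · simp only [act₂₁, Iso.trans_hom, whiskerLeftIso_hom]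
    bicategory

lemma actComp_id_left {f g : a ⟶ b} (ι : f ⟶ f) (e : ι = 𝟙 f) (α : f ⟶ g) (e' : ι ≫ α = α)
    {x : F.obj b} {w : F.obj a} (u : w ⟶ (F.map g).obj x) :
    (F.actComp ι α α e' u).hom = (F.actId ι e (u ≫ F.app α x)).hom := by
  subst e
  have m : (F.appComp (𝟙 f) α α e' x).hom =
      F.app α x ◁ (F.appId (𝟙 f) rfl x).hom ≫ (ρ_ _).hom := by
    refine (congrArg (fun m => m.as.app x)
      ((F.hom a b).mapComp'_comp_id_inv α.op.toLoc)).trans ?_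
    rw [← (F.hom a b).mapId'_eq_mapId]
    rfl
  refine eq_of_whiskerLeft m u ⊗𝟙.hom ⊗𝟙.hom ?_ ?_
  · simp only [act₂₁, Iso.trans_hom, whiskerLeftIso_hom]
    bicategory
  · simp only [act₁₀, Iso.trans_hom, whiskerLeftIso_hom]
    bicategory

lemma actComp_id_right {f g : a ⟶ b} (ι : g ⟶ g) (e : ι = 𝟙 g) (α : f ⟶ g) (e' : α ≫ ι = α)
    {x : F.obj b} {w : F.obj a} (u : w ⟶ (F.map g).obj x) :
    (F.actComp α ι α e' u).hom = (F.actId ι e u).hom ▷ F.app α x := by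
  subst e
  have m : (F.appComp α (𝟙 g) α e' x).hom =
      (F.appId (𝟙 g) rfl x).hom ▷ F.app α x ≫ (λ_ _).hom := by
    refine (congrArg (fun m => m.as.app x)
      ((F.hom a b).mapComp'_id_comp_inv α.op.toLoc)).trans ?_
    rw [← (F.hom a b).mapId'_eq_mapId]
    rfl
  refine eq_of_whiskerLeft m u ⊗𝟙.hom ⊗𝟙.hom ?_ ?_
  · simp only [act₂₁, Iso.trans_hom, whiskerLeftIso_hom]
    bicategory
  · simp only [act₁₀, Iso.trans_hom, whiskerLeftIso_hom]
    bicategory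

/-- The naturality cell of `χ` at 2-cells is a modification. -/
lemma actChiNat_nat {f f' : a ⟶ b} {g g' : b ⟶ c} (α : f ⟶ f') (β : g ⟶ g')
    {x y : F.obj c} (k : x ⟶ y) {w : F.obj a} (u : w ⟶ (F.map f').obj ((F.map g').obj x)) :
    (F.actChiNat α β (u ≫ (F.map f').map ((F.map g').map k))).hom ≫
        (F.actChi f' g' k u).inv ▷ F.app (hcomp₂ α β) y ≫
        (F.actNat (hcomp₂ α β) k (u ≫ F.chiApp f' g' x)).inv =
      (F.actNat α ((F.map g').map k) u).inv ▷ (F.map f).map (F.app β y) ▷ F.chiApp f g y ≫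
        (act₂₂ (mapIso₂₂ (F.map f) (F.appNat β k).symm) (u ≫ F.app α _)).inv ▷ F.chiApp f g y ≫
        (F.actChi f g k ((u ≫ F.app α _) ≫ (F.map f).map (F.app β x))).inv ≫
        (F.actChiNat α β u).hom ▷ (F.map (f ≫ g)).map k := by
  have m : (F.map f').map ((F.map g').map k) ◁ (F.chiNatApp α β y).hom ≫ ((α_ _ _ _).inv ≫
      (F.chiCell f' g' k).hom ▷ F.app (hcomp₂ α β) y ≫ (α_ _ _ _).hom ≫
        F.chiApp f' g' x ◁ (F.appNat (hcomp₂ α β) k).hom ≫ (α_ _ _ _).inv) =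
      ((α_ _ _ _).inv ≫ ((α_ _ _ _).inv ≫
        (F.appNat α ((F.map g').map k)).hom ▷ (F.map f).map (F.app β y) ≫
          (α_ _ _ _).hom ≫ F.app α ((F.map g').obj x) ◁
            (((F.map f).mapComp ((F.map g').map k) (F.app β y)).inv ≫
              (F.map f).map₂ (F.appNat β k).hom ≫
              ((F.map f).mapComp (F.app β x) ((F.map g).map k)).hom) ≫ (α_ _ _ _).inv) ▷
                F.chiApp f g y ≫ (α_ _ _ _).hom ≫
        (F.app α ((F.map g').obj x) ≫ (F.map f).map (F.app β x)) ◁ (F.chiCell f g k).hom ≫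
          (α_ _ _ _).inv) ≫ (F.chiNatApp α β x).hom ▷ (F.map (f ≫ g)).map k :=
    (F.chiNat α β).hom.as.naturality k
  refine eq_of_whiskerLeft m u ⊗𝟙.hom ⊗𝟙.hom ?_ ?_
  · simp only [act₂₁, act₂₂, act₃₂, Iso.trans_hom, Iso.trans_inv, whiskerLeftIso_hom,
      whiskerLeftIso_inv, Iso.symm_hom, Iso.symm_inv, whiskerRightIso_hom]
    bicategory
  · simp only [act₂₁, act₂₂, act₃₂, mapIso₂₂, Iso.trans_hom, Iso.trans_inv, whiskerLeftIso_hom,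
      whiskerLeftIso_inv, Iso.symm_hom, Iso.symm_inv, whiskerRightIso_hom,
      PrelaxFunctor.map₂Iso_inv]
    bicategory

/-- `ω` is a modification. -/
lemma actOmega_nat (f : a ⟶ b) (g : b ⟶ c) (h : c ⟶ d) {x y : F.obj d} (k : x ⟶ y)
    {w : F.obj a} (u : w ⟶ (F.map f).obj ((F.map g).obj ((F.map h).obj x))) :
    (F.actOmega f g h (u ≫ (F.map f).map ((F.map g).map ((F.map h).map k)))).hom ≫
        (F.actChi f g ((F.map h).map k) u).inv ▷ F.chiApp (f ≫ g) h y ≫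
        (F.actChi (f ≫ g) h k (u ≫ F.chiApp f g _)).inv =
      (act₂₂ (mapIso₂₂ (F.map f) (F.chiCell g h k).symm) u).inv ▷ F.chiApp f (g ≫ h) y ▷
          F.app (α_ f g h).hom y ≫
        (F.actChi f (g ≫ h) k (u ≫ (F.map f).map (F.chiApp g h x))).inv ▷
          F.app (α_ f g h).hom y ≫
        (F.actNat (α_ f g h).hom k ((u ≫ (F.map f).map (F.chiApp g h x)) ≫
          F.chiApp f (g ≫ h) x)).inv ≫
        (F.actOmega f g h u).hom ▷ (F.map ((f ≫ g) ≫ h)).map k := by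
  -- `omegaApp` is the component of `ω` up to a left unitor, since `assocTrans` has identity
  -- components; `o` abbreviates the component itself.
  obtain ⟨o, ho⟩ : ∃ o : ∀ z : F.obj d, (F.map f).map (F.chiApp g h z) ≫
      F.chiApp f (g ≫ h) z ≫ F.app (α_ f g h).hom z ⟶
        𝟙 _ ≫ F.chiApp f g ((F.map h).obj z) ≫ F.chiApp (f ≫ g) h z,
      ∀ z, o z = (F.omega f g h).hom.as.app z := ⟨_, fun _ => rfl⟩
  have ho' (z : F.obj d) : (F.omegaApp f g h z).hom = o z ≫ (λ_ _).hom := by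
    rw [ho]
    rfl
  have m : (F.map f).map ((F.map g).map ((F.map h).map k)) ◁ o y ≫
      ((α_ _ _ _).inv ≫ ((ρ_ _).hom ≫ (λ_ _).inv) ▷ (F.chiApp f g _ ≫ F.chiApp (f ≫ g) h y) ≫
        (α_ _ _ _).hom ≫ 𝟙 _ ◁ ((α_ _ _ _).inv ≫
          (F.chiCell f g ((F.map h).map k)).hom ▷ F.chiApp (f ≫ g) h y ≫ (α_ _ _ _).hom ≫
            F.chiApp f g _ ◁ (F.chiCell (f ≫ g) h k).hom ≫ (α_ _ _ _).inv) ≫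
              (α_ _ _ _).inv) =
      ((α_ _ _ _).inv ≫ (((F.map f).mapComp _ _).inv ≫ (F.map f).map₂ (F.chiCell g h k).hom ≫
          ((F.map f).mapComp _ _).hom) ▷ (F.chiApp f (g ≫ h) y ≫ F.app (α_ f g h).hom y) ≫
        (α_ _ _ _).hom ≫ (F.map f).map (F.chiApp g h x) ◁ ((α_ _ _ _).inv ≫
          (F.chiCell f (g ≫ h) k).hom ▷ F.app (α_ f g h).hom y ≫ (α_ _ _ _).hom ≫
            F.chiApp f (g ≫ h) x ◁ (F.appNat (α_ f g h).hom k).hom ≫ (α_ _ _ _).inv) ≫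
              (α_ _ _ _).inv) ≫
        o x ▷ (F.map ((f ≫ g) ≫ h)).map k := by
    rw [ho, ho]
    exact (F.omega f g h).hom.as.naturality k
  refine eq_of_whiskerLeft m u ⊗𝟙.hom ⊗𝟙.hom ?_ ?_
  · simp only [act₂₁, act₂₂, act₃₂, ho', Iso.trans_hom, Iso.trans_inv, whiskerLeftIso_hom,
      whiskerLeftIso_inv, Iso.symm_hom, Iso.symm_inv, whiskerRightIso_hom]
    bicategory
  · simp only [act₂₁, act₂₂, act₃₂, mapIso₂₂, ho', Iso.trans_hom, Iso.trans_inv,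
      whiskerLeftIso_hom, whiskerLeftIso_inv, Iso.symm_hom, Iso.symm_inv, whiskerRightIso_hom,
      PrelaxFunctor.map₂Iso_inv]
    bicategory

/-- `γ` is a modification. -/
lemma actGamma_nat (f : a ⟶ b) {x y : F.obj b} (k : x ⟶ y) {w : F.obj a}
    (u : w ⟶ (F.map f).obj x) :
    (F.actGamma f (u ≫ (F.map f).map k)).hom =
      (act₂₂ (mapIso₂₂ (F.map f) (F.iotaCell b k).symm) u).inv ▷ F.chiApp f (𝟙 b) y ▷
          F.app (ρ_ f).inv y ≫
        (F.actChi f (𝟙 b) k (u ≫ (F.map f).map (F.iotaApp b x))).inv ▷ F.app (ρ_ f).inv y ≫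
        (F.actNat (ρ_ f).inv k ((u ≫ (F.map f).map (F.iotaApp b x)) ≫ F.chiApp f (𝟙 b) x)).inv ≫
        (F.actGamma f u).hom ▷ (F.map f).map k := by
  have m : (F.map f).map k ◁ (F.gammaApp f y).hom ≫ ((ρ_ _).hom ≫ (λ_ _).inv) =
      ((α_ _ _ _).inv ≫ (((F.map f).mapComp _ _).inv ≫ (F.map f).map₂ (F.iotaCell b k).hom ≫
          ((F.map f).mapComp _ _).hom) ▷ (F.chiApp f (𝟙 b) y ≫ F.app (ρ_ f).inv y) ≫
        (α_ _ _ _).hom ≫ (F.map f).map (F.iotaApp b x) ◁ ((α_ _ _ _).inv ≫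
          (F.chiCell f (𝟙 b) k).hom ▷ F.app (ρ_ f).inv y ≫ (α_ _ _ _).hom ≫
            F.chiApp f (𝟙 b) x ◁ (F.appNat (ρ_ f).inv k).hom ≫ (α_ _ _ _).inv) ≫
              (α_ _ _ _).inv) ≫
        (F.gammaApp f x).hom ▷ (F.map f).map k :=
    (F.gamma f).hom.as.naturality k
  refine eq_of_whiskerLeft m u ⊗𝟙.hom ⊗𝟙.hom ?_ ?_
  · simp only [act₂₁, act₃₀, Iso.trans_hom, whiskerLeftIso_hom, whiskerRightIso_hom]
    bicategory
  · simp only [act₂₁, act₂₂, act₃₀, mapIso₂₂, Iso.trans_hom, Iso.trans_inv,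
      whiskerLeftIso_hom, whiskerLeftIso_inv, Iso.symm_inv, whiskerRightIso_hom,
      PrelaxFunctor.map₂Iso_inv]
    bicategory

/-! ### The axioms of a trihomomorphism -/

/-- Pseudo-naturality of `χ` at identity 2-cells, acting after `u`. -/
lemma act_chi_id (H : F.IsTrihom) (f : a ⟶ b) (g : b ⟶ c) {x : F.obj c} {w : F.obj a}
    (u : w ⟶ (F.map f).obj ((F.map g).obj x)) :
    (F.actChiNat (𝟙 f) (𝟙 g) u).hom ≫
        (F.actId (hcomp₂ (𝟙 f) (𝟙 g)) (by simp [hcomp₂]) (u ≫ F.chiApp f g x)).hom =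
      (F.actId (𝟙 f) rfl u).hom ▷ (F.map f).map (F.app (𝟙 g) x) ▷ F.chiApp f g x ≫
        (act₁₀ (mapIso₁₀ (F.map f) (F.appId (𝟙 g) rfl x)) u).hom ▷ F.chiApp f g x := by
  refine eq_of_whiskerLeft (H.chi_id f g x) u ⊗𝟙.hom ⊗𝟙.hom ?_ ?_
  · simp only [act₁₀, act₂₁, act₂₂, act₃₂, Iso.trans_hom, Iso.symm_hom, whiskerRightIso_hom,
      whiskerLeftIso_hom]
    bicategory
  · simp only [act₁₀, mapIso₁₀, Iso.trans_hom, whiskerLeftIso_hom, PrelaxFunctor.map₂Iso_hom]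
    bicategory

/-- Pseudo-naturality of `χ` at vertical composites of 2-cells, acting after `u`. -/
lemma act_chi_comp (H : F.IsTrihom) {f f' f'' : a ⟶ b} {g g' g'' : b ⟶ c} (α : f ⟶ f')
    (α' : f' ⟶ f'') (β : g ⟶ g') (β' : g' ⟶ g'') {x : F.obj c} {w : F.obj a}
    (u : w ⟶ (F.map f'').obj ((F.map g'').obj x)) :
    (F.actChiNat α β ((u ≫ F.app α' _) ≫ (F.map f').map (F.app β' x))).hom ≫
        (F.actChiNat α' β' u).hom ▷ F.app (hcomp₂ α β) x ≫
        (F.actComp (hcomp₂ α β) (hcomp₂ α' β') (hcomp₂ (α ≫ α') (β ≫ β'))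
          (by simp [hcomp₂, whisker_exchange_assoc]) (u ≫ F.chiApp f'' g'' x)).hom =
      (F.actNat α (F.app β' x) (u ≫ F.app α' _)).inv ▷ (F.map f).map (F.app β x) ▷
          F.chiApp f g x ≫
        (F.actComp α α' _ rfl u).hom ▷ (F.map f).map (F.app β' x) ▷ (F.map f).map (F.app β x) ▷
          F.chiApp f g x ≫
        (act₂₁ (mapIso₂₁ (F.map f) (F.appComp β β' _ rfl x)) (u ≫ F.app (α ≫ α') _)).hom ▷
          F.chiApp f g x ≫
        (F.actChiNat (α ≫ α') (β ≫ β') u).hom := by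
  refine eq_of_whiskerLeft (H.chi_comp α α' β β' x) u ⊗𝟙.hom ⊗𝟙.hom ?_ ?_
  · simp only [act₂₁, act₂₂, act₃₂, Iso.trans_hom, whiskerRightIso_hom, whiskerLeftIso_hom,
      Iso.symm_hom]
    bicategory
  · simp only [act₂₁, act₂₂, act₃₂, mapIso₂₁, Iso.trans_hom, whiskerRightIso_hom,
      whiskerLeftIso_hom, Iso.symm_hom, Iso.trans_inv, whiskerLeftIso_inv, Iso.symm_inv,
      PrelaxFunctor.map₂Iso_hom]
    bicategory

/-- Naturality of `ω` in its indices, acting after `u`. -/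
lemma act_omega_nat (H : F.IsTrihom) {f f' : a ⟶ b} {g g' : b ⟶ c} {h h' : c ⟶ d} (α : f ⟶ f')
    (β : g ⟶ g') (γ : h ⟶ h') {x : F.obj d} {w : F.obj a}
    (u : w ⟶ (F.map f').obj ((F.map g').obj ((F.map h').obj x))) :
    (act₃₂ (mapIso₃₂ (F.map f) (F.chiNatApp β γ x)) (u ≫ F.app α _)).hom ▷
          F.chiApp f (g ≫ h) x ▷ F.app (α_ f g h).hom x ≫
        (F.actNat α (F.chiApp g' h' x) u).hom ▷ (F.map f).map (F.app (hcomp₂ β γ) x) ▷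
          F.chiApp f (g ≫ h) x ▷ F.app (α_ f g h).hom x ≫
        (F.actChiNat α (hcomp₂ β γ) (u ≫ (F.map f').map (F.chiApp g' h' x))).hom ▷
          F.app (α_ f g h).hom x ≫
        (F.actComp (α_ f g h).hom (hcomp₂ α (hcomp₂ β γ))
          (hcomp₂ (hcomp₂ α β) γ ≫ (α_ f' g' h').hom) (by simp [hcomp₂])
          ((u ≫ (F.map f').map (F.chiApp g' h' x)) ≫
            F.chiApp f' (g' ≫ h') x)).hom ≫
        (F.actComp (hcomp₂ (hcomp₂ α β) γ) (α_ f' g' h').hom _ rfl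
          ((u ≫ (F.map f').map (F.chiApp g' h' x)) ≫ F.chiApp f' (g' ≫ h') x)).inv ≫
        (F.actOmega f' g' h' u).hom ▷ F.app (hcomp₂ (hcomp₂ α β) γ) x =
      (F.actOmega f g h (((u ≫ F.app α _) ≫ (F.map f).map (F.app β _)) ≫
          (F.map f).map ((F.map g).map (F.app γ x)))).hom ≫
        (F.actChi f g (F.app γ x) ((u ≫ F.app α _) ≫ (F.map f).map (F.app β _))).inv ▷
          F.chiApp (f ≫ g) h x ≫
        (F.actChiNat α β u).hom ▷ (F.map (f ≫ g)).map (F.app γ x) ▷ F.chiApp (f ≫ g) h x ≫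
        (F.actChiNat (hcomp₂ α β) γ (u ≫ F.chiApp f' g' _)).hom := by
  have hs := congrArg (· ▷ F.chiApp f (g ≫ h) x ▷ F.app (α_ f g h).hom x)
    (act₃₂_mapIso₃₂_hom (F.map f) (F.chiNatApp β γ x) (u ≫ F.app α _))
  simp only [comp_whiskerRight] at hs
  -- In `omega_nat` the image of `F β ≫ (F g) (F γ)` under `F f` is not split.
  rw [← cancel_epi ((split (F.map f) (F.app β ((F.map h').obj x)) ((F.map g).map (F.app γ x))
    (u ≫ F.app α _)).hom ▷ (F.map f).map (F.chiApp g h x) ▷ F.chiApp f (g ≫ h) x ▷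
      F.app (α_ f g h).hom x), ← reassoc_of% hs, act₃₂_natural_assoc]
  refine eq_of_whiskerLeft (H.omega_nat α β γ x) u ⊗𝟙.hom ⊗𝟙.hom ?_ ?_
  · simp only [act₂₁, act₂₂, act₃₂, mapIso₂₂, Iso.trans_hom, whiskerRightIso_hom,
      whiskerLeftIso_hom, Iso.symm_hom, Iso.trans_inv, whiskerLeftIso_inv,
      PrelaxFunctor.map₂Iso_hom]
    bicategory
  · simp only [act₂₁, act₂₂, act₃₂, split, Iso.trans_hom, whiskerRightIso_hom,
      whiskerLeftIso_hom, Iso.symm_hom, Iso.trans_inv, whiskerLeftIso_inv, Iso.symm_inv]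
    bicategory

/-- Naturality of `γ` in its index, acting after `u`. -/
lemma act_gamma_nat (H : F.IsTrihom) {f f' : a ⟶ b} (α : f ⟶ f') {x : F.obj b} {w : F.obj a}
    (u : w ⟶ (F.map f').obj x) :
    (F.actGamma f (u ≫ F.app α x)).hom =
      (F.actNat α (F.iotaApp b x) u).hom ▷ F.chiApp f (𝟙 b) x ▷ F.app (ρ_ f).inv x ≫
        (act₁₀ (mapIso₁₀ (F.map f) (F.appId (𝟙 (𝟙 b)) rfl x))
          ((u ≫ (F.map f').map (F.iotaApp b x)) ≫ F.app α _)).inv ▷ F.chiApp f (𝟙 b) x ▷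
            F.app (ρ_ f).inv x ≫
        (F.actChiNat α (𝟙 (𝟙 b)) (u ≫ (F.map f').map (F.iotaApp b x))).hom ▷
          F.app (ρ_ f).inv x ≫
        (F.actComp (ρ_ f).inv (hcomp₂ α (𝟙 (𝟙 b))) (α ≫ (ρ_ f').inv) (by simp [hcomp₂])
          ((u ≫ (F.map f').map (F.iotaApp b x)) ≫ F.chiApp f' (𝟙 b) x)).hom ≫
        (F.actComp α (ρ_ f').inv _ rfl
          ((u ≫ (F.map f').map (F.iotaApp b x)) ≫ F.chiApp f' (𝟙 b) x)).inv ≫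
        (F.actGamma f' u).hom ▷ F.app α x := by
  refine eq_of_whiskerLeft (H.gamma_nat α x) u ⊗𝟙.hom ⊗𝟙.hom ?_ ?_
  · simp only [act₂₁, act₃₀, Iso.trans_hom, whiskerRightIso_hom, whiskerLeftIso_hom]
    bicategory
  · simp only [act₁₀, act₂₁, act₂₂, act₃₂, act₃₀, mapIso₁₀, Iso.trans_hom, whiskerRightIso_hom,
      whiskerLeftIso_hom, Iso.symm_hom, Iso.trans_inv, whiskerLeftIso_inv,
      PrelaxFunctor.map₂Iso_inv]
    bicategory

/-- Naturality of `δ` in its index, acting after `u`. -/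
lemma act_delta_nat (H : F.IsTrihom) {f f' : a ⟶ b} (α : f ⟶ f') {x : F.obj b} {w : F.obj a}
    (u : w ⟶ (F.map f').obj x) :
    (F.actDelta f (u ≫ F.app α x)).inv ≫
        (F.actIota (F.app α x) u).inv ▷ F.chiApp (𝟙 a) f x ≫
        (F.actId (𝟙 (𝟙 a)) rfl (u ≫ F.iotaApp a _)).inv ▷ (F.map (𝟙 a)).map (F.app α x) ▷
          F.chiApp (𝟙 a) f x ≫
        (F.actChiNat (𝟙 (𝟙 a)) α (u ≫ F.iotaApp a _)).hom =
      (F.actComp (λ_ f).hom α _ rfl u).hom ≫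
        (F.actComp (hcomp₂ (𝟙 (𝟙 a)) α) (λ_ f').hom _ (by simp [hcomp₂]) u).inv ≫
        (F.actDelta f' u).inv ▷ F.app (hcomp₂ (𝟙 (𝟙 a)) α) x := by
  refine eq_of_whiskerLeft (H.delta_nat α x) u ⊗𝟙.hom ⊗𝟙.hom ?_ ?_
  · simp only [act₁₀, act₂₁, act₂₂, act₃₂, Iso.trans_hom, whiskerRightIso_hom,
      whiskerLeftIso_hom, Iso.symm_hom, Iso.trans_inv, whiskerLeftIso_inv, Iso.symm_inv]
    bicategory
  · simp only [act₂₁, Iso.trans_hom, whiskerLeftIso_hom, Iso.trans_inv, whiskerLeftIso_inv,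
      Iso.symm_inv]
    bicategory

/-- The axiom of a trihomomorphism over the pentagon, acting after `u`. -/
lemma act_assoc (H : F.IsTrihom) {e : B} (f : a ⟶ b) (g : b ⟶ c) (h : c ⟶ d) (k : d ⟶ e)
    {x : F.obj e} {w : F.obj a}
    (u : w ⟶ (F.map f).obj ((F.map g).obj ((F.map h).obj ((F.map k).obj x)))) :
    (F.actOmega f g (h ≫ k) (u ≫ (F.map f).map ((F.map g).map (F.chiApp h k x)))).hom ▷
          F.app (α_ (f ≫ g) h k).hom x ≫
        (F.actChi f g (F.chiApp h k x) u).inv ▷ F.chiApp (f ≫ g) (h ≫ k) x ▷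
          F.app (α_ (f ≫ g) h k).hom x ≫
        (F.actOmega (f ≫ g) h k (u ≫ F.chiApp f g _)).hom =
      (F.actComp (α_ (f ≫ g) h k).hom (α_ f g (h ≫ k)).hom
          ((hcomp₂ (α_ f g h).hom (𝟙 k) ≫ (α_ f (g ≫ h) k).hom) ≫ hcomp₂ (𝟙 f) (α_ g h k).hom)
          (by simp [hcomp₂]) (((u ≫ (F.map f).map ((F.map g).map (F.chiApp h k x))) ≫
            (F.map f).map (F.chiApp g (h ≫ k) x)) ≫ F.chiApp f (g ≫ h ≫ k) x)).hom ≫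
        (F.actComp (hcomp₂ (α_ f g h).hom (𝟙 k) ≫ (α_ f (g ≫ h) k).hom)
          (hcomp₂ (𝟙 f) (α_ g h k).hom) _ rfl
          (((u ≫ (F.map f).map ((F.map g).map (F.chiApp h k x))) ≫
            (F.map f).map (F.chiApp g (h ≫ k) x)) ≫ F.chiApp f (g ≫ h ≫ k) x)).inv ≫
        (F.actComp (hcomp₂ (α_ f g h).hom (𝟙 k)) (α_ f (g ≫ h) k).hom _ rfl
          ((((u ≫ (F.map f).map ((F.map g).map (F.chiApp h k x))) ≫
            (F.map f).map (F.chiApp g (h ≫ k) x)) ≫ F.chiApp f (g ≫ h ≫ k) x) ≫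
              F.app (hcomp₂ (𝟙 f) (α_ g h k).hom) x)).inv ≫
        (F.actChiNat (𝟙 f) (α_ g h k).hom
          ((u ≫ (F.map f).map ((F.map g).map (F.chiApp h k x))) ≫
            (F.map f).map (F.chiApp g (h ≫ k) x))).inv ▷ F.app (α_ f (g ≫ h) k).hom x ▷
              F.app (hcomp₂ (α_ f g h).hom (𝟙 k)) x ≫
        (F.actId (𝟙 f) rfl ((u ≫ (F.map f).map ((F.map g).map (F.chiApp h k x))) ≫
            (F.map f).map (F.chiApp g (h ≫ k) x))).hom ▷ (F.map f).map (F.app (α_ g h k).hom x) ▷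
              F.chiApp f ((g ≫ h) ≫ k) x ▷ F.app (α_ f (g ≫ h) k).hom x ▷
                F.app (hcomp₂ (α_ f g h).hom (𝟙 k)) x ≫
        (act₃₂ (mapIso₃₂ (F.map f) (α_ _ _ _ ≪≫ F.omegaApp g h k x)) u).hom ▷
              F.chiApp f ((g ≫ h) ≫ k) x ▷ F.app (α_ f (g ≫ h) k).hom x ▷
                F.app (hcomp₂ (α_ f g h).hom (𝟙 k)) x ≫
        (F.actOmega f (g ≫ h) k (u ≫ (F.map f).map (F.chiApp g h _))).hom ▷
          F.app (hcomp₂ (α_ f g h).hom (𝟙 k)) x ≫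
        (F.actChiNat (α_ f g h).hom (𝟙 k) ((u ≫ (F.map f).map (F.chiApp g h _)) ≫
          F.chiApp f (g ≫ h) _)).inv ≫
        (act₁₀ (mapIso₁₀ (F.map ((f ≫ g) ≫ h)) (F.appId (𝟙 k) rfl x))
          (((u ≫ (F.map f).map (F.chiApp g h _)) ≫ F.chiApp f (g ≫ h) _) ≫
            F.app (α_ f g h).hom _)).hom ▷ F.chiApp ((f ≫ g) ≫ h) k x ≫
        (F.actOmega f g h u).hom ▷ F.chiApp ((f ≫ g) ≫ h) k x := by
  refine eq_of_whiskerLeft (H.assoc f g h k x) u ⊗𝟙.hom ⊗𝟙.hom ?_ ?_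
  · simp only [act₂₁, act₂₂, act₃₂, Iso.trans_hom, whiskerRightIso_hom,
      whiskerLeftIso_hom, Iso.symm_hom, Iso.trans_inv, whiskerLeftIso_inv, Iso.symm_inv]
    bicategory
  · simp only [act₁₀, act₂₁, act₂₂, act₃₂, mapIso₁₀, mapIso₃₂_associator_hom, Iso.trans_hom,
      whiskerRightIso_hom, whiskerRightIso_inv,
      whiskerLeftIso_hom, Iso.symm_hom, Iso.trans_inv, whiskerLeftIso_inv, Iso.symm_inv,
      PrelaxFunctor.map₂Iso_hom]
    bicategory

/-- The axiom of a trihomomorphism over the triangle, acting after `u`. -/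
lemma act_unit (H : F.IsTrihom) (f : a ⟶ b) (g : b ⟶ c) {x : F.obj c} {w : F.obj a}
    (u : w ⟶ (F.map f).obj ((F.map g).obj x)) :
    (F.actId (𝟙 f) rfl u).inv ▷ (F.map f).map (F.app (λ_ g).hom x) ▷ F.chiApp f (𝟙 b ≫ g) x ▷
          F.app (α_ f (𝟙 b) g).hom x ▷ F.app (hcomp₂ (ρ_ f).inv (𝟙 g)) x ≫
        (F.actChiNat (𝟙 f) (λ_ g).hom u).hom ▷ F.app (α_ f (𝟙 b) g).hom x ▷
          F.app (hcomp₂ (ρ_ f).inv (𝟙 g)) x ≫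
        (F.actComp (α_ f (𝟙 b) g).hom (hcomp₂ (𝟙 f) (λ_ g).hom) _ rfl
          (u ≫ F.chiApp f g x)).hom ▷ F.app (hcomp₂ (ρ_ f).inv (𝟙 g)) x ≫
        (F.actComp (hcomp₂ (ρ_ f).inv (𝟙 g)) _ (𝟙 (f ≫ g)) (by simp [hcomp₂])
          (u ≫ F.chiApp f g x)).hom ≫
        (F.actId (𝟙 (f ≫ g)) rfl (u ≫ F.chiApp f g x)).hom =
      (act₂₁ (mapIso₂₁ (F.map f) (F.deltaApp g x).symm) u).inv ▷ F.chiApp f (𝟙 b ≫ g) x ▷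
          F.app (α_ f (𝟙 b) g).hom x ▷ F.app (hcomp₂ (ρ_ f).inv (𝟙 g)) x ≫
        (F.actOmega f (𝟙 b) g (u ≫ (F.map f).map (F.iotaApp b _))).hom ▷
          F.app (hcomp₂ (ρ_ f).inv (𝟙 g)) x ≫
        (F.actChiNat (ρ_ f).inv (𝟙 g) ((u ≫ (F.map f).map (F.iotaApp b _)) ≫
          F.chiApp f (𝟙 b) _)).inv ≫
        (act₁₀ (mapIso₁₀ (F.map f) (F.appId (𝟙 g) rfl x))
          (((u ≫ (F.map f).map (F.iotaApp b _)) ≫ F.chiApp f (𝟙 b) _) ≫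
            F.app (ρ_ f).inv _)).hom ▷ F.chiApp f g x ≫
        (F.actGamma f u).hom ▷ F.chiApp f g x := by
  refine eq_of_whiskerLeft (H.unit f g x) u ⊗𝟙.hom ⊗𝟙.hom ?_ ?_
  · simp only [act₁₀, act₂₁, act₂₂, act₃₂, Iso.trans_hom, whiskerRightIso_hom,
      whiskerLeftIso_hom, Iso.symm_hom, Iso.trans_inv, whiskerLeftIso_inv]
    bicategory
  · simp only [act₁₀, act₂₁, act₂₂, act₃₂, act₃₀, mapIso₁₀, mapIso₂₁, Iso.trans_hom,
      whiskerRightIso_hom, whiskerRightIso_inv,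
      whiskerLeftIso_hom, Iso.symm_hom, Iso.trans_inv, whiskerLeftIso_inv, Iso.symm_inv,
      PrelaxFunctor.map₂Iso_hom, PrelaxFunctor.map₂Iso_inv]
    bicategory

/-! ### The cells of the Grothendieck construction -/

variable (F) in
/-- The fibre component of a composite 1-cell, rebracketed to the left. -/
abbrev elCompIso {f : a ⟶ b} {g : b ⟶ c} {x : F.obj a} {y : F.obj b} {z : F.obj c}
    (p : x ⟶ (F.map f).obj y) (q : y ⟶ (F.map g).obj z) :
    F.elComp p q ≅ (p ≫ (F.map f).map q) ≫ F.chiApp f g z :=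
  (α_ _ _ _).symm

variable (F) in
/-- The compositors of `F f` that separate the three factors of the image of the composite
`elComp q r`. -/
abbrev splitComp (f : a ⟶ b) {g : b ⟶ c} {h : c ⟶ d} {y : F.obj b} {z : F.obj c}
    {t : F.obj d} (q : y ⟶ (F.map g).obj z) (r : z ⟶ (F.map h).obj t) {w : F.obj a}
    (u : w ⟶ (F.map f).obj y) :
    u ≫ (F.map f).map (F.elComp q r) ≅
      ((u ≫ (F.map f).map q) ≫ (F.map f).map ((F.map g).map r)) ≫
        (F.map f).map (F.chiApp g h t) :=
  split (F.map f) q ((F.map g).map r ≫ F.chiApp g h t) u ≪≫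
    split (F.map f) ((F.map g).map r) (F.chiApp g h t) (u ≫ (F.map f).map q)

lemma elId₂_eq {f : a ⟶ b} {x : F.obj a} {y : F.obj b} (p : x ⟶ (F.map f).obj y) :
    F.elId₂ p = (F.actId (𝟙 f) rfl p).inv := by
  simp [elId₂, act₁₀]

lemma elVcomp_eq {f g h : a ⟶ b} {x : F.obj a} {y : F.obj b} {p : x ⟶ (F.map f).obj y}
    {q : x ⟶ (F.map g).obj y} {r : x ⟶ (F.map h).obj y} {α : f ⟶ g} {β : g ⟶ h}
    (s : p ⟶ q ≫ F.app α y) (t : q ⟶ r ≫ F.app β y) :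
    F.elVcomp s t = s ≫ t ▷ F.app α y ≫ (F.actComp α β _ rfl r).hom := by
  simp only [elVcomp, act₂₁, Iso.trans_hom, whiskerLeftIso_hom]
  bicategory

/-- The part of a horizontal composite before `χ`: apply `m`, then the image of `n`, then move `F α`
past the image of `s`. -/
def elWhisk {f g : a ⟶ b} {j k : b ⟶ c} {x : F.obj a} {y : F.obj b} {z : F.obj c}
    {p : x ⟶ (F.map f).obj y} {q : x ⟶ (F.map g).obj y} {r : y ⟶ (F.map j).obj z}
    {s : y ⟶ (F.map k).obj z} {α : f ⟶ g} {β : j ⟶ k}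
    (m : p ⟶ q ≫ F.app α y) (n : r ⟶ s ≫ F.app β z) :
    p ≫ (F.map f).map r ⟶ ((q ≫ (F.map g).map s) ≫ F.app α _) ≫ (F.map f).map (F.app β z) :=
  m ▷ (F.map f).map r ≫ (q ≫ F.app α y) ◁ (F.map f).map₂ n ≫
    (split (F.map f) s (F.app β z) (q ≫ F.app α y)).hom ≫
    (F.actNat α s q).hom ▷ (F.map f).map (F.app β z)

/-- The fibre component of a horizontal composite, with 1-cells bracketed to the left. -/
def elHcompAct {f g : a ⟶ b} {j k : b ⟶ c} {x : F.obj a} {y : F.obj b} {z : F.obj c}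
    {p : x ⟶ (F.map f).obj y} {q : x ⟶ (F.map g).obj y} {r : y ⟶ (F.map j).obj z}
    {s : y ⟶ (F.map k).obj z} {α : f ⟶ g} {β : j ⟶ k}
    (m : p ⟶ q ≫ F.app α y) (n : r ⟶ s ≫ F.app β z) :
    (p ≫ (F.map f).map r) ≫ F.chiApp f j z ⟶
      ((q ≫ (F.map g).map s) ≫ F.chiApp g k z) ≫ F.app (hcomp₂ α β) z :=
  elWhisk m n ▷ F.chiApp f j z ≫ (F.actChiNat α β (q ≫ (F.map g).map s)).hom

lemma elHcomp_eq {f g : a ⟶ b} {j k : b ⟶ c} {x : F.obj a} {y : F.obj b} {z : F.obj c}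
    {p : x ⟶ (F.map f).obj y} {q : x ⟶ (F.map g).obj y} {r : y ⟶ (F.map j).obj z}
    {s : y ⟶ (F.map k).obj z} {α : f ⟶ g} {β : j ⟶ k}
    (m : p ⟶ q ≫ F.app α y) (n : r ⟶ s ≫ F.app β z) :
    F.elHcomp m n = (F.elCompIso p r).hom ≫ elHcompAct m n ≫
        (F.elCompIso q s).inv ▷ F.app (hcomp₂ α β) z := by
  simp only [elHcomp, elComp, elHcompAct, elWhisk, split, act₂₁, act₂₂, act₃₂, Iso.trans_hom,
    whiskerLeftIso_hom, whiskerRightIso_hom, Iso.symm_hom, Iso.symm_inv]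
  bicategory

lemma elAssoc_eq {f : a ⟶ b} {g : b ⟶ c} {h : c ⟶ d} {x : F.obj a} {y : F.obj b} {z : F.obj c}
    {t : F.obj d} (p : x ⟶ (F.map f).obj y) (q : y ⟶ (F.map g).obj z)
    (r : z ⟶ (F.map h).obj t) :
    F.elAssoc p q r = (F.elCompIso (F.elComp p q) r).hom ≫
      (F.elCompIso p q).hom ▷ (F.map (f ≫ g)).map r ▷ F.chiApp (f ≫ g) h t ≫
      (F.actChi f g r (p ≫ (F.map f).map q)).hom ▷ F.chiApp (f ≫ g) h t ≫
      (F.actOmega f g h ((p ≫ (F.map f).map q) ≫ (F.map f).map ((F.map g).map r))).inv ≫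
      (F.splitComp f q r p).inv ▷ F.chiApp f (g ≫ h) t ▷ F.app (α_ f g h).hom t ≫
      (F.elCompIso p (F.elComp q r)).inv ▷ F.app (α_ f g h).hom t := by
  simp only [elAssoc, elComp, splitComp, elCompIso, split, act₂₁, act₂₂, act₃₂, Iso.trans_hom,
    Iso.trans_inv, whiskerLeftIso_hom, whiskerLeftIso_inv, whiskerRightIso_inv,
    Iso.symm_hom, Iso.symm_inv]
  bicategory

lemma elUnitCod_eq {f : a ⟶ b} {x : F.obj a} {y : F.obj b} (p : x ⟶ (F.map f).obj y) :
    F.elUnitCod p = (F.actGamma f p).inv ≫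
      (F.elCompIso p (F.iotaApp b y)).inv ▷ F.app (ρ_ f).inv y := by
  simp only [elUnitCod, elComp, act₂₁, act₃₀, Iso.trans_inv, whiskerLeftIso_inv,
    whiskerRightIso_inv, Iso.symm_inv]
  bicategory

lemma elUnitDom_eq {f : a ⟶ b} {x : F.obj a} {y : F.obj b} (p : x ⟶ (F.map f).obj y) :
    F.elUnitDom p = (F.elCompIso (F.iotaApp a x) p).hom ≫
      (F.iotaCell a p).inv ▷ F.chiApp (𝟙 a) f y ≫ (F.actDelta f p).hom := by
  simp only [elUnitDom, elComp, act₂₁, Iso.trans_hom, whiskerLeftIso_hom, Iso.symm_hom]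
  bicategory

lemma id_elVcomp {f g : a ⟶ b} {x : F.obj a} {y : F.obj b} {p : x ⟶ (F.map f).obj y}
    {q : x ⟶ (F.map g).obj y} {α : f ⟶ g} (s : p ⟶ q ≫ F.app α y) (e : 𝟙 f ≫ α = α) :
    (F.actId (𝟙 f) rfl p).inv ≫ s ▷ F.app (𝟙 f) y ≫ (F.actComp (𝟙 f) α α e q).hom = s := by
  rw [actComp_id_left (𝟙 f) rfl, act₁₀_natural, Iso.inv_hom_id_assoc]

/-! ### Interchange -/

/-- Interchange for the part of a horizontal composite before `χ`. -/
lemma elWhisk_vcomp {f f' f'' : a ⟶ b} {j j' j'' : b ⟶ c} {x : F.obj a} {y : F.obj b}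
    {z : F.obj c} {p : x ⟶ (F.map f).obj y} {q : x ⟶ (F.map f').obj y}
    {q' : x ⟶ (F.map f'').obj y} {r : y ⟶ (F.map j).obj z} {s : y ⟶ (F.map j').obj z}
    {s' : y ⟶ (F.map j'').obj z} {α : f ⟶ f'} {α' : f' ⟶ f''} {β : j ⟶ j'} {β' : j' ⟶ j''}
    (m : p ⟶ q ≫ F.app α y) (m' : q ⟶ q' ≫ F.app α' y) (n : r ⟶ s ≫ F.app β z)
    (n' : s ⟶ s' ≫ F.app β' z) :
    elWhisk m n ≫ elWhisk m' n' ▷ F.app α _ ▷ (F.map f).map (F.app β z) ≫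
        (F.actNat α (F.app β' z) ((q' ≫ (F.map f'').map s') ≫ F.app α' _)).inv ▷
          (F.map f).map (F.app β z) ≫
        (F.actComp α α' _ rfl (q' ≫ (F.map f'').map s')).hom ▷ (F.map f).map (F.app β' z) ▷
          (F.map f).map (F.app β z) ≫
        (act₂₁ (mapIso₂₁ (F.map f) (F.appComp β β' _ rfl z))
          ((q' ≫ (F.map f'').map s') ≫ F.app (α ≫ α') _)).hom =
      elWhisk (m ≫ m' ▷ F.app α y ≫ (F.actComp α α' _ rfl q').hom)
        (n ≫ n' ▷ F.app β z ≫ (F.actComp β β' _ rfl s').hom) := by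
  simp only [elWhisk, comp_whiskerRight, Category.assoc, PrelaxFunctor.map₂_comp,
    Bicategory.whiskerLeft_comp]
  rw [← whiskerRight_comp_eq_assoc (act₂₂_natural (F.appNat α s).symm m'),
    ← split_natural_assoc, whisker_exchange_assoc,
    ← whiskerRight_comp_eq_assoc (actNat_natural α n' (q' ≫ F.app α' y)),
    ← split_natural_left_assoc]
  have e₁ := congrArg (· ▷ (F.map f).map (F.app β z))
    (actNat_comp α s' (F.app β' z) (q' ≫ F.app α' y))
  have e₂ := congrArg (· ▷ (F.map f).map (F.app β' z) ▷ (F.map f).map (F.app β z))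
    (actComp_nat α α' _ rfl s' q')
  simp only [comp_whiskerRight] at e₁ e₂
  rw [← reassoc_of% e₁,
    ← whiskerRight_comp_eq_assoc (act₂₂_natural (F.appNat α (F.app β' z)).symm
      (F.actNat α' s' q').hom),
    hom_inv_whiskerRight_assoc, ← reassoc_of% e₂,
    ← whiskerRight_comp_eq_assoc (split_natural _ _ _ (F.actComp α α' _ rfl q').hom),
    ← split_natural_assoc, whisker_exchange_assoc, whisker_exchange_assoc, reassoc_of% map_act₂₁,
    act₂₁_natural]

lemma elHcompAct_vcomp (H : F.IsTrihom) {f f' f'' : a ⟶ b} {j j' j'' : b ⟶ c} {x : F.obj a}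
    {y : F.obj b}
    {z : F.obj c} {p : x ⟶ (F.map f).obj y} {q : x ⟶ (F.map f').obj y}
    {q' : x ⟶ (F.map f'').obj y} {r : y ⟶ (F.map j).obj z} {s : y ⟶ (F.map j').obj z}
    {s' : y ⟶ (F.map j'').obj z} {α : f ⟶ f'} {α' : f' ⟶ f''} {β : j ⟶ j'} {β' : j' ⟶ j''}
    (m : p ⟶ q ≫ F.app α y) (m' : q ⟶ q' ≫ F.app α' y) (n : r ⟶ s ≫ F.app β z)
    (n' : s ⟶ s' ≫ F.app β' z) :
    elHcompAct m n ≫ elHcompAct m' n' ▷ F.app (hcomp₂ α β) z ≫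
      (F.actComp (hcomp₂ α β) (hcomp₂ α' β') (hcomp₂ (α ≫ α') (β ≫ β'))
          (by simp [hcomp₂, whisker_exchange_assoc]) _).hom =
    elHcompAct (m ≫ m' ▷ F.app α y ≫ (F.actComp α α' _ rfl q').hom)
        (n ≫ n' ▷ F.app β z ≫ (F.actComp β β' _ rfl s').hom) := by
  have e := congrArg (· ▷ F.chiApp f j z) (elWhisk_vcomp m m' n n')
  simp only [comp_whiskerRight] at e
  simp only [elHcompAct, comp_whiskerRight, Category.assoc]
  rw [← act₃₂_natural_assoc, act_chi_comp H, ← e]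
  simp only [Category.assoc]

lemma elHcomp_vcomp (H : F.IsTrihom) {f f' f'' : a ⟶ b} {j j' j'' : b ⟶ c} {x : F.obj a}
    {y : F.obj b}
    {z : F.obj c} {p : x ⟶ (F.map f).obj y} {q : x ⟶ (F.map f').obj y}
    {q' : x ⟶ (F.map f'').obj y} {r : y ⟶ (F.map j).obj z} {s : y ⟶ (F.map j').obj z}
    {s' : y ⟶ (F.map j'').obj z} {α : f ⟶ f'} {α' : f' ⟶ f''} {β : j ⟶ j'} {β' : j' ⟶ j''}
    (m : p ⟶ q ≫ F.app α y) (m' : q ⟶ q' ≫ F.app α' y) (n : r ⟶ s ≫ F.app β z)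
    (n' : s ⟶ s' ≫ F.app β' z) :
    F.elHcomp (F.elVcomp m m') (F.elVcomp n n') =
      F.elHcomp m n ≫ F.elHcomp m' n' ▷ F.app (hcomp₂ α β) z ≫
        (F.actComp (hcomp₂ α β) (hcomp₂ α' β') (hcomp₂ (α ≫ α') (β ≫ β'))
          (by simp [hcomp₂, whisker_exchange_assoc]) (F.elComp q' s')).hom := by
  simp only [elVcomp_eq]
  rw [elHcomp_eq, ← elHcompAct_vcomp H, elHcomp_eq, elHcomp_eq]
  simp only [comp_whiskerRight, Category.assoc, inv_hom_whiskerRight_assoc]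
  rw [act₂₁_natural]

lemma elHcompAct_id (H : F.IsTrihom) {f : a ⟶ b} {j : b ⟶ c} {x : F.obj a} {y : F.obj b}
    {z : F.obj c} (p : x ⟶ (F.map f).obj y) (r : y ⟶ (F.map j).obj z) :
    elHcompAct (F.actId (𝟙 f) rfl p).inv (F.actId (𝟙 j) rfl r).inv =
      (F.actId (hcomp₂ (𝟙 f) (𝟙 j)) (by simp [hcomp₂])
        ((p ≫ (F.map f).map r) ≫ F.chiApp f j z)).inv := by
  have e₁ := congrArg (· ▷ (F.map f).map (F.app (𝟙 j) z) ▷ F.chiApp f j z)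
    (actId_nat (𝟙 f) rfl r p)
  have e₂ := congrArg (· ▷ F.chiApp f j z) (map_act₁₀ (F.map f) (F.appId (𝟙 j) rfl z) r p)
  simp only [comp_whiskerRight] at e₁ e₂
  rw [← cancel_mono (F.actId (hcomp₂ (𝟙 f) (𝟙 j)) (by simp [hcomp₂])
      ((p ≫ (F.map f).map r) ≫ F.chiApp f j z)).hom,
    Iso.inv_hom_id, elHcompAct, Category.assoc, act_chi_id H]
  simp only [elWhisk, comp_whiskerRight, Category.assoc]
  rw [reassoc_of% e₁, ← whiskerRight_comp_eq_assoc (split_natural _ _ _ (F.actId (𝟙 f) rfl p).hom),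
    whiskerRight_comp_eq_assoc (whisker_exchange _ _).symm,
    inv_hom_whiskerRight₂_assoc, ← e₂, ← comp_whiskerRight, ← Bicategory.whiskerLeft_comp,
    ← PrelaxFunctor.map₂_comp]
  simp

lemma elHcomp_id (H : F.IsTrihom) {f : a ⟶ b} {j : b ⟶ c} {x : F.obj a} {y : F.obj b}
    {z : F.obj c} (p : x ⟶ (F.map f).obj y) (r : y ⟶ (F.map j).obj z) :
    F.elHcomp (F.elId₂ p) (F.elId₂ r) =
      (F.actId (hcomp₂ (𝟙 f) (𝟙 j)) (by simp [hcomp₂]) (F.elComp p r)).inv := by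
  rw [elId₂_eq, elId₂_eq, elHcomp_eq, elHcompAct_id H, ← act₁₀_natural_inv, Iso.hom_inv_id_assoc]

/-- Horizontal composition is natural with respect to 2-cells of the fibre in the first factor. -/
lemma elHcompAct_comp_left {f g : a ⟶ b} {j k : b ⟶ c} {x : F.obj a} {y : F.obj b}
    {z : F.obj c} {p p' : x ⟶ (F.map f).obj y} {q q' : x ⟶ (F.map g).obj y}
    {r : y ⟶ (F.map j).obj z} {s : y ⟶ (F.map k).obj z} {α : f ⟶ g} {β : j ⟶ k}
    (t : p' ⟶ p) (m : p ⟶ q ≫ F.app α y) (t' : q ⟶ q') (n : r ⟶ s ≫ F.app β z) :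
    elHcompAct (t ≫ m ≫ t' ▷ F.app α y) n =
      t ▷ (F.map f).map r ▷ F.chiApp f j z ≫ elHcompAct m n ≫
        t' ▷ (F.map g).map s ▷ F.chiApp g k z ▷ F.app (hcomp₂ α β) z := by
  simp only [elHcompAct, elWhisk, comp_whiskerRight, Category.assoc]
  rw [← act₃₂_natural, ← whiskerRight_comp_eq_assoc (whiskerRight_comp_eq
    (act₂₂_natural (F.appNat α s).symm t') _),
    ← whiskerRight_comp_eq_assoc (split_natural _ _ _ (t' ▷ F.app α y)),
    whiskerRight_comp_eq_assoc (whisker_exchange _ _).symm]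

/-! ### Naturality of the associativity constraint -/

/-- The image under `F f` of the fibre component of a horizontal composite, acting after `u`, with
all images of composites split. -/
def mapElHcomp (f : a ⟶ b) {g g' : b ⟶ c} {h h' : c ⟶ d} {y : F.obj b} {z : F.obj c}
    {t : F.obj d} {q : y ⟶ (F.map g).obj z} {q' : y ⟶ (F.map g').obj z}
    {r : z ⟶ (F.map h).obj t} {r' : z ⟶ (F.map h').obj t} {β : g ⟶ g'} {γ : h ⟶ h'}
    (n : q ⟶ q' ≫ F.app β z) (l : r ⟶ r' ≫ F.app γ t) {w : F.obj a}
    (u : w ⟶ (F.map f).obj y) :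
    ((u ≫ (F.map f).map q) ≫ (F.map f).map ((F.map g).map r)) ≫
        (F.map f).map (F.chiApp g h t) ⟶
      (((u ≫ (F.map f).map q') ≫ (F.map f).map ((F.map g').map r')) ≫
        (F.map f).map (F.chiApp g' h' t)) ≫ (F.map f).map (F.app (hcomp₂ β γ) t) :=
  (u ◁ (F.map f).map₂ n ≫ (split (F.map f) q' (F.app β z) u).hom) ▷
      (F.map f).map ((F.map g).map r) ▷ (F.map f).map (F.chiApp g h t) ≫
    (((u ≫ (F.map f).map q') ≫ (F.map f).map (F.app β z)) ◁
      ((F.map f).map₂ ((F.map g).map₂ l ≫ ((F.map g).mapComp r' (F.app γ t)).hom)) ≫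
      (split (F.map f) ((F.map g).map r') ((F.map g).map (F.app γ t))
        ((u ≫ (F.map f).map q') ≫ (F.map f).map (F.app β z))).hom) ▷
          (F.map f).map (F.chiApp g h t) ≫
    (act₂₂ (mapIso₂₂ (F.map f) (F.appNat β r').symm) (u ≫ (F.map f).map q')).hom ▷
      (F.map f).map ((F.map g).map (F.app γ t)) ▷ (F.map f).map (F.chiApp g h t) ≫
    (act₃₂ (mapIso₃₂ (F.map f) (F.chiNatApp β γ t))
      ((u ≫ (F.map f).map q') ≫ (F.map f).map ((F.map g').map r'))).hom

lemma splitComp_hom_eq (f : a ⟶ b) {g : b ⟶ c} {h : c ⟶ d} {y : F.obj b} {z : F.obj c}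
    {t : F.obj d} (q : y ⟶ (F.map g).obj z) (r : z ⟶ (F.map h).obj t) {w : F.obj a}
    (u : w ⟶ (F.map f).obj y) :
    (F.splitComp f q r u).hom =
      u ◁ (F.map f).map₂ (F.elCompIso q r).hom ≫
        (split (F.map f) (q ≫ (F.map g).map r) (F.chiApp g h t) u).hom ≫
          (split (F.map f) q ((F.map g).map r) u).hom ▷ (F.map f).map (F.chiApp g h t) :=
  (split_assoc_inv (F.map f) q ((F.map g).map r) (F.chiApp g h t) u).symm

/-- `mapElHcomp` is indeed the image of `elHcomp`. -/
lemma map₂_elHcomp (f : a ⟶ b) {g g' : b ⟶ c} {h h' : c ⟶ d} {y : F.obj b} {z : F.obj c}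
    {t : F.obj d} {q : y ⟶ (F.map g).obj z} {q' : y ⟶ (F.map g').obj z}
    {r : z ⟶ (F.map h).obj t} {r' : z ⟶ (F.map h').obj t} {β : g ⟶ g'} {γ : h ⟶ h'}
    (n : q ⟶ q' ≫ F.app β z) (l : r ⟶ r' ≫ F.app γ t) {w : F.obj a}
    (u : w ⟶ (F.map f).obj y) :
    u ◁ (F.map f).map₂ (F.elHcomp n l) ≫
        (split (F.map f) (F.elComp q' r') (F.app (hcomp₂ β γ) t) u).hom ≫
        (F.splitComp f q' r' u).hom ▷ (F.map f).map (F.app (hcomp₂ β γ) t) =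
      (F.splitComp f q r u).hom ≫ mapElHcomp f n l u := by
  have e₁ : (F.map f).map₂ (F.elHcomp n l) =
      (F.map f).map₂ (F.elCompIso q r).hom ≫ (F.map f).map₂ (elHcompAct n l) ≫
        (F.map f).map₂ ((F.elCompIso q' r').inv ▷ F.app (hcomp₂ β γ) t) := by
    rw [elHcomp_eq, PrelaxFunctor.map₂_comp, PrelaxFunctor.map₂_comp]
  have e₂ : (u ◁ (F.map f).map₂ (F.elCompIso q' r').inv) ▷ (F.map f).map (F.app (hcomp₂ β γ) t) ≫
      (u ◁ (F.map f).map₂ (F.elCompIso q' r').hom) ▷ (F.map f).map (F.app (hcomp₂ β γ) t) =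
        𝟙 _ := by
    rw [← comp_whiskerRight, ← Bicategory.whiskerLeft_comp, ← PrelaxFunctor.map₂_comp,
      Iso.inv_hom_id, PrelaxFunctor.map₂_id, Bicategory.whiskerLeft_id, id_whiskerRight]
  rw [splitComp_hom_eq, splitComp_hom_eq, e₁]
  simp only [Bicategory.whiskerLeft_comp, comp_whiskerRight, Category.assoc]
  rw [split_natural_left_assoc, reassoc_of% e₂]
  congr 1
  simp only [elHcompAct, elWhisk, mapElHcomp, PrelaxFunctor.map₂_comp,
    Bicategory.whiskerLeft_comp, comp_whiskerRight, Category.assoc]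
  have e₃ := congrArg (· ▷ (F.map f).map ((F.map g).map (F.app γ t)) ▷
    (F.map f).map (F.chiApp g h t)) (map_act₂₂ (F.map f) (F.appNat β r').symm q' u)
  have e₄ := congrArg (· ▷ (F.map f).map (F.chiApp g h t))
    (map_split (F.map f) (K := F.map g) r' (F.app γ t) (q' ≫ F.app β z) u)
  simp only [comp_whiskerRight] at e₃ e₄
  rw [reassoc_of% map_act₃₂, ← act₃₂_natural, split_natural_left_assoc,
    whiskerRight_comp_eq_assoc (split_natural_left _ _ _ _), reassoc_of% e₃,
    split_natural_left_assoc, reassoc_of% e₄,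
    ← whiskerRight_comp_eq_assoc (whisker_exchange
      (split (F.map f) q' (F.app β z) u).hom ((F.map f).map₂ ((F.map g).map₂ l))),
    ← whiskerRight_comp_eq_assoc (whisker_exchange
      (split (F.map f) q' (F.app β z) u).hom
      ((F.map f).map₂ ((F.map g).mapComp r' (F.app γ t)).hom)),
    ← whiskerRight_comp_eq_assoc (split_natural _ _ _ (split (F.map f) q' (F.app β z) u).hom)]
  rw [split_natural_left_assoc, whiskerRight_comp_eq_assoc (split_natural_right _ _ _ _),
    split_natural_left_assoc, whiskerRight_comp_eq_assoc (split_natural_left _ _ _ _)]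

lemma splitComp_natural (f : a ⟶ b) {g : b ⟶ c} {h : c ⟶ d} {y : F.obj b} {z : F.obj c}
    {t : F.obj d} (q : y ⟶ (F.map g).obj z) (r : z ⟶ (F.map h).obj t) {w : F.obj a}
    {u v : w ⟶ (F.map f).obj y} (m : u ⟶ v) :
    m ▷ (F.map f).map (F.elComp q r) ≫ (F.splitComp f q r v).hom =
      (F.splitComp f q r u).hom ≫
        m ▷ (F.map f).map q ▷ (F.map f).map ((F.map g).map r) ▷
          (F.map f).map (F.chiApp g h t) := by
  simp only [splitComp, elComp, Iso.trans_hom, Category.assoc]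
  rw [← split_natural, ← split_natural_assoc]

/-- Moving `F α` past a composite 1-cell is moving it past the three factors. -/
lemma actNat_elComp {f f' : a ⟶ b} (α : f ⟶ f') {g : b ⟶ c} {h : c ⟶ d} {y : F.obj b}
    {z : F.obj c} {t : F.obj d} (q : y ⟶ (F.map g).obj z) (r : z ⟶ (F.map h).obj t)
    {w : F.obj a} (u : w ⟶ (F.map f').obj y) :
    (F.actNat α (F.elComp q r) u).hom ≫ (F.splitComp f' q r u).hom ▷ F.app α _ =
      (F.splitComp f q r (u ≫ F.app α y)).hom ≫
        (F.actNat α q u).hom ▷ (F.map f).map ((F.map g).map r) ▷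
          (F.map f).map (F.chiApp g h t) ≫
        (F.actNat α ((F.map g).map r) (u ≫ (F.map f').map q)).hom ▷
          (F.map f).map (F.chiApp g h t) ≫
        (F.actNat α (F.chiApp g h t) ((u ≫ (F.map f').map q) ≫
          (F.map f').map ((F.map g).map r))).hom := by
  simp only [splitComp, elComp, Iso.trans_hom, Category.assoc, comp_whiskerRight]
  rw [← split_natural_assoc, actNat_comp, reassoc_of% actNat_comp]

/-- The first part of the composite of `m` with a horizontal composite, after splitting: apply `m`
and the image of the horizontal composite, then move `F α` past the three factors. -/
lemma elWhisk_elHcomp {f f' : a ⟶ b} {g g' : b ⟶ c} {h h' : c ⟶ d} {x : F.obj a} {y : F.obj b}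
    {z : F.obj c} {t : F.obj d} {p : x ⟶ (F.map f).obj y} {p' : x ⟶ (F.map f').obj y}
    {q : y ⟶ (F.map g).obj z} {q' : y ⟶ (F.map g').obj z}
    {r : z ⟶ (F.map h).obj t} {r' : z ⟶ (F.map h').obj t} {α : f ⟶ f'} {β : g ⟶ g'}
    {γ : h ⟶ h'} (m : p ⟶ p' ≫ F.app α y)
    (n : q ⟶ q' ≫ F.app β z) (l : r ⟶ r' ≫ F.app γ t) :
    elWhisk m (F.elHcomp n l) ≫ (F.splitComp f' q' r' p').hom ▷ F.app α _ ▷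
        (F.map f).map (F.app (hcomp₂ β γ) t) =
      (F.splitComp f q r p).hom ≫
        m ▷ (F.map f).map q ▷ (F.map f).map ((F.map g).map r) ▷
          (F.map f).map (F.chiApp g h t) ≫
        mapElHcomp f n l (p' ≫ F.app α y) ≫
        (F.actNat α q' p').hom ▷ (F.map f).map ((F.map g').map r') ▷
          (F.map f).map (F.chiApp g' h' t) ▷ (F.map f).map (F.app (hcomp₂ β γ) t) ≫
        (F.actNat α ((F.map g').map r') (p' ≫ (F.map f').map q')).hom ▷
          (F.map f).map (F.chiApp g' h' t) ▷ (F.map f).map (F.app (hcomp₂ β γ) t) ≫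
        (F.actNat α (F.chiApp g' h' t) ((p' ≫ (F.map f').map q') ≫
          (F.map f').map ((F.map g').map r'))).hom ▷ (F.map f).map (F.app (hcomp₂ β γ) t) := by
  have e := congrArg (· ▷ (F.map f).map (F.app (hcomp₂ β γ) t)) (actNat_elComp α q' r' p')
  simp only [comp_whiskerRight] at e
  have e₂ := map₂_elHcomp f n l (p' ≫ F.app α y)
  have e₃ := splitComp_natural f q r m
  rw [← reassoc_of% e₃, ← reassoc_of% e₂]
  simp only [elWhisk, Category.assoc]
  rw [e]

lemma hcomp₂_associator {X : Type u₂} [Bicategory.{w₂, v₂} X] {a b c d : X} {f f' : a ⟶ b}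
    {g g' : b ⟶ c} {h h' : c ⟶ d} (α : f ⟶ f') (β : g ⟶ g') (γ : h ⟶ h') :
    (α_ f g h).hom ≫ hcomp₂ α (hcomp₂ β γ) =
      hcomp₂ (hcomp₂ α β) γ ≫ (α_ f' g' h').hom := by
  simp [hcomp₂]

/-- `actChiNat_nat` with the naturality cells of `χ` and `F α` not inverted. -/
lemma actChiNat_nat_hom {f f' : a ⟶ b} {g g' : b ⟶ c} (α : f ⟶ f') (β : g ⟶ g')
    {x y : F.obj c} (k : x ⟶ y) {w : F.obj a} (u : w ⟶ (F.map f').obj ((F.map g').obj x)) :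
    (F.actChiNat α β u).hom ▷ (F.map (f ≫ g)).map k ≫
        (F.actNat (hcomp₂ α β) k (u ≫ F.chiApp f' g' x)).hom ≫
        (F.actChi f' g' k u).hom ▷ F.app (hcomp₂ α β) y =
      (F.actChi f g k ((u ≫ F.app α _) ≫ (F.map f).map (F.app β x))).hom ≫
        (act₂₂ (mapIso₂₂ (F.map f) (F.appNat β k).symm) (u ≫ F.app α _)).hom ▷ F.chiApp f g y ≫
        (F.actNat α ((F.map g').map k) u).hom ▷ (F.map f).map (F.app β y) ▷ F.chiApp f g y ≫
        (F.actChiNat α β (u ≫ (F.map f').map ((F.map g').map k))).hom := by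
  rw [← cancel_mono ((F.actChi f' g' k u).inv ▷ F.app (hcomp₂ α β) y ≫
    (F.actNat (hcomp₂ α β) k (u ≫ F.chiApp f' g' x)).inv)]
  simp only [Category.assoc]
  rw [actChiNat_nat, hom_inv_whiskerRight₂_assoc, hom_inv_whiskerRight_assoc,
    hom_inv_whiskerRight_assoc, Iso.hom_inv_id_assoc, Iso.hom_inv_id, Category.comp_id]

/-- Naturality of `ω`, solved for the naturality cells of `χ` followed by `ω⁻¹`. -/
lemma act_omega_nat_inv (H : F.IsTrihom) {f f' : a ⟶ b} {g g' : b ⟶ c} {h h' : c ⟶ d}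
    (α : f ⟶ f') (β : g ⟶ g') (γ : h ⟶ h') {x : F.obj d} {w : F.obj a}
    (u : w ⟶ (F.map f').obj ((F.map g').obj ((F.map h').obj x))) :
    (F.actChiNat α β u).hom ▷ (F.map (f ≫ g)).map (F.app γ x) ▷ F.chiApp (f ≫ g) h x ≫
        (F.actChiNat (hcomp₂ α β) γ (u ≫ F.chiApp f' g' _)).hom ≫
        (F.actOmega f' g' h' u).inv ▷ F.app (hcomp₂ (hcomp₂ α β) γ) x ≫
        (F.actComp (hcomp₂ (hcomp₂ α β) γ) (α_ f' g' h').hom _ rfl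
          ((u ≫ (F.map f').map (F.chiApp g' h' x)) ≫ F.chiApp f' (g' ≫ h') x)).hom =
      (F.actChi f g (F.app γ x) ((u ≫ F.app α _) ≫ (F.map f).map (F.app β _))).hom ▷
          F.chiApp (f ≫ g) h x ≫
        (F.actOmega f g h (((u ≫ F.app α _) ≫ (F.map f).map (F.app β _)) ≫
          (F.map f).map ((F.map g).map (F.app γ x)))).inv ≫
        (act₃₂ (mapIso₃₂ (F.map f) (F.chiNatApp β γ x)) (u ≫ F.app α _)).hom ▷
          F.chiApp f (g ≫ h) x ▷ F.app (α_ f g h).hom x ≫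
        (F.actNat α (F.chiApp g' h' x) u).hom ▷ (F.map f).map (F.app (hcomp₂ β γ) x) ▷
          F.chiApp f (g ≫ h) x ▷ F.app (α_ f g h).hom x ≫
        (F.actChiNat α (hcomp₂ β γ) (u ≫ (F.map f').map (F.chiApp g' h' x))).hom ▷
          F.app (α_ f g h).hom x ≫
        (F.actComp (α_ f g h).hom (hcomp₂ α (hcomp₂ β γ))
          (hcomp₂ (hcomp₂ α β) γ ≫ (α_ f' g' h').hom)
          (hcomp₂_associator α β γ) ((u ≫ (F.map f').map (F.chiApp g' h' x)) ≫
            F.chiApp f' (g' ≫ h') x)).hom := by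
  have o := act_omega_nat H α β γ u
  rw [← cancel_epi ((F.actOmega f g h (((u ≫ F.app α _) ≫ (F.map f).map (F.app β _)) ≫
      (F.map f).map ((F.map g).map (F.app γ x)))).hom ≫
    (F.actChi f g (F.app γ x) ((u ≫ F.app α _) ≫ (F.map f).map (F.app β _))).inv ▷
      F.chiApp (f ≫ g) h x)]
  simp only [Category.assoc]
  rw [← reassoc_of% o]
  simp only [inv_hom_whiskerRight_assoc, hom_inv_whiskerRight_assoc, Iso.hom_inv_id_assoc,
    Iso.inv_hom_id, Category.comp_id]

set_option maxHeartbeats 800000 in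
/-- Naturality of the associativity constraint for composites bracketed to the left: the naturality
cells of `χ` at `r` and at 2-cells are exchanged by `actChiNat_nat_hom`, and naturality of `ω` does
the rest. -/
lemma elAssoc_natural_act (H : F.IsTrihom)
    {f f' : a ⟶ b} {g g' : b ⟶ c} {h h' : c ⟶ d} {x : F.obj a} {y : F.obj b}
    {z : F.obj c} {t : F.obj d} {p : x ⟶ (F.map f).obj y} {p' : x ⟶ (F.map f').obj y}
    {q : y ⟶ (F.map g).obj z} {q' : y ⟶ (F.map g').obj z}
    {r : z ⟶ (F.map h).obj t} {r' : z ⟶ (F.map h').obj t} {α : f ⟶ f'} {β : g ⟶ g'}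
    {γ : h ⟶ h'} (m : p ⟶ p' ≫ F.app α y)
    (n : q ⟶ q' ≫ F.app β z) (l : r ⟶ r' ≫ F.app γ t) :
    elHcompAct (elHcompAct m n) l ≫
        (F.actChi f' g' r' (p' ≫ (F.map f').map q')).hom ▷ F.chiApp (f' ≫ g') h' t ▷
          F.app (hcomp₂ (hcomp₂ α β) γ) t ≫
        (F.actOmega f' g' h' ((p' ≫ (F.map f').map q') ≫ (F.map f').map ((F.map g').map r'))).inv ▷
          F.app (hcomp₂ (hcomp₂ α β) γ) t ≫
        (F.actComp (hcomp₂ (hcomp₂ α β) γ) (α_ f' g' h').hom _ rfl _).hom =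
      (F.actChi f g r (p ≫ (F.map f).map q)).hom ▷ F.chiApp (f ≫ g) h t ≫
        (F.actOmega f g h ((p ≫ (F.map f).map q) ≫ (F.map f).map ((F.map g).map r))).inv ≫
        (m ▷ (F.map f).map q ▷ (F.map f).map ((F.map g).map r) ▷
          (F.map f).map (F.chiApp g h t)) ▷ F.chiApp f (g ≫ h) t ▷ F.app (α_ f g h).hom t ≫
        mapElHcomp f n l (p' ≫ F.app α y) ▷ F.chiApp f (g ≫ h) t ▷ F.app (α_ f g h).hom t ≫
        (F.actNat α q' p').hom ▷ (F.map f).map ((F.map g').map r') ▷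
          (F.map f).map (F.chiApp g' h' t) ▷ (F.map f).map (F.app (hcomp₂ β γ) t) ▷
            F.chiApp f (g ≫ h) t ▷ F.app (α_ f g h).hom t ≫
        (F.actNat α ((F.map g').map r') (p' ≫ (F.map f').map q')).hom ▷
          (F.map f).map (F.chiApp g' h' t) ▷ (F.map f).map (F.app (hcomp₂ β γ) t) ▷
            F.chiApp f (g ≫ h) t ▷ F.app (α_ f g h).hom t ≫
        (F.actNat α (F.chiApp g' h' t) ((p' ≫ (F.map f').map q') ≫
          (F.map f').map ((F.map g').map r'))).hom ▷ (F.map f).map (F.app (hcomp₂ β γ) t) ▷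
            F.chiApp f (g ≫ h) t ▷ F.app (α_ f g h).hom t ≫
        (F.actChiNat α (hcomp₂ β γ) (((p' ≫ (F.map f').map q') ≫
          (F.map f').map ((F.map g').map r')) ≫ (F.map f').map (F.chiApp g' h' t))).hom ▷
            F.app (α_ f g h).hom t ≫
        (F.actComp (α_ f g h).hom (hcomp₂ α (hcomp₂ β γ)) _ (hcomp₂_associator α β γ) _).hom := by
  have k := congrArg (· ▷ (F.map (f ≫ g)).map (F.app γ t) ▷ F.chiApp (f ≫ g) h t)
    (actChiNat_nat_hom α β r' (p' ≫ (F.map f').map q'))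
  simp only [comp_whiskerRight] at k
  have c := congrArg (· ▷ F.chiApp (f ≫ g) h t) (actChi_comp f g r' (F.app γ t)
    (((p' ≫ (F.map f').map q') ≫ F.app α _) ≫ (F.map f).map (F.app β _)))
  simp only [comp_whiskerRight] at c
  -- The cells of `l` and `χ` are moved past those of `m` and `n`, until naturality of `ω` applies.
  rw [elHcompAct, elWhisk, elHcompAct]
  simp only [comp_whiskerRight, Category.assoc]
  rw [← act₃₂_natural_assoc]
  rw [whiskerRight_comp_eq_assoc (whisker_exchange (F.actChiNat α β _).hom _).symm]
  rw [whiskerRight_comp_eq_assoc (split_natural _ _ _ (F.actChiNat α β _).hom)]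
  rw [reassoc_of% k, act_omega_nat_inv H]
  rw [whiskerRight_comp_eq_assoc (act₂₂_natural (F.chiCell f g (F.app γ t)).symm _),
    whiskerRight_comp_eq_assoc (act₂₂_natural (F.chiCell f g (F.app γ t)).symm _)]
  rw [reassoc_of% c]
  rw [whiskerRight_comp_eq_assoc (actChi_natural _ _ _ _)]
  rw [whiskerRight_comp_eq_assoc (act₂₂_natural (F.chiCell f g r).symm (elWhisk m n))]
  simp only [act₃₂_natural_inv_assoc]
  simp only [elWhisk, mapElHcomp, comp_whiskerRight, Category.assoc]
  simp only [PrelaxFunctor.map₂_comp, Bicategory.whiskerLeft_comp, comp_whiskerRight,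
    Category.assoc]
  -- The remaining cells act on disjoint factors.
  congr 4
  rw [whiskerRight_comp_eq_assoc (whiskerRight_comp_eq (act₃₂_natural
      (mapIso₃₂ (F.map f) (F.chiNatApp β γ t)) _) _),
    whiskerRight_comp_eq_assoc (whiskerRight_comp_eq (whiskerRight_comp_eq (whisker_exchange
      ((F.actNat α q' p').hom ▷ (F.map f).map (F.app β z)) _).symm _) _),
    whiskerRight_comp_eq_assoc (whiskerRight_comp_eq (whiskerRight_comp_eq (whisker_exchange
      ((F.actNat α q' p').hom ▷ (F.map f).map (F.app β z)) _).symm _) _),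
    whiskerRight_comp_eq_assoc (whiskerRight_comp_eq (whiskerRight_comp_eq (split_natural _ _ _
      ((F.actNat α q' p').hom ▷ (F.map f).map (F.app β z))) _) _),
    whiskerRight_comp_eq_assoc (whiskerRight_comp_eq (whiskerRight_comp_eq (whiskerRight_comp_eq
      (act₂₂_natural (mapIso₂₂ (F.map f) (F.appNat β r').symm) _) _) _) _),
    whiskerRight_comp_eq_assoc (whiskerRight_comp_eq (act₃₂_natural
      (mapIso₃₂ (F.map f) (F.chiNatApp β γ t)) _) _)]

lemma elAssoc_natural (H : F.IsTrihom)
    {f f' : a ⟶ b} {g g' : b ⟶ c} {h h' : c ⟶ d} {x : F.obj a} {y : F.obj b}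
    {z : F.obj c} {t : F.obj d} {p : x ⟶ (F.map f).obj y} {p' : x ⟶ (F.map f').obj y}
    {q : y ⟶ (F.map g).obj z} {q' : y ⟶ (F.map g').obj z}
    {r : z ⟶ (F.map h).obj t} {r' : z ⟶ (F.map h').obj t} {α : f ⟶ f'} {β : g ⟶ g'}
    {γ : h ⟶ h'} (m : p ⟶ p' ≫ F.app α y)
    (n : q ⟶ q' ≫ F.app β z) (l : r ⟶ r' ≫ F.app γ t) :
    F.elHcomp (F.elHcomp m n) l ≫
        F.elAssoc p' q' r' ▷ F.app (hcomp₂ (hcomp₂ α β) γ) t ≫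
        (F.actComp (hcomp₂ (hcomp₂ α β) γ) (α_ f' g' h').hom _ rfl
          (F.elComp p' (F.elComp q' r'))).hom =
      F.elAssoc p q r ≫ F.elHcomp m (F.elHcomp n l) ▷ F.app (α_ f g h).hom t ≫
        (F.actComp (α_ f g h).hom (hcomp₂ α (hcomp₂ β γ)) _ (hcomp₂_associator α β γ)
          (F.elComp p' (F.elComp q' r'))).hom := by
  have e := elWhisk_elHcomp m n l
  replace e := (Iso.eq_comp_inv (whiskerRightIso (whiskerRightIso (F.splitComp f' q' r' p')
    (F.app α _)) ((F.map f).map (F.app (hcomp₂ β γ) t)))).2 e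
  have e₁ := elAssoc_natural_act H m n l
  have e₂ := elHcompAct_comp_left (F.elCompIso p q).hom (elHcompAct m n) (F.elCompIso p' q').inv l
  rw [elHcomp_eq, elAssoc_eq, elAssoc_eq, elHcomp_eq m (F.elHcomp n l), elHcomp_eq m n, e₂]
  simp only [elHcompAct] at e₁ ⊢
  rw [e]
  simp only [comp_whiskerRight, Category.assoc, whiskerRightIso_inv] at e₁ ⊢
  simp only [inv_hom_whiskerRight_assoc, inv_hom_whiskerRight₂_assoc, act₂₁_natural]
  have e₃ := (act₃₂_natural (F.chiNatApp α (hcomp₂ β γ) t) (F.splitComp f' q' r' p').inv)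
  have e₄ := (act₂₁_natural (F.appComp (hcomp₂ (hcomp₂ α β) γ) (α_ f' g' h').hom _ rfl t)
    ((F.splitComp f' q' r' p').inv ▷ F.chiApp f' (g' ≫ h') t))
  have e₅ := (act₂₁_natural (F.appComp (α_ f g h).hom (hcomp₂ α (hcomp₂ β γ)) _
    (hcomp₂_associator α β γ) t) ((F.splitComp f' q' r' p').inv ▷ F.chiApp f' (g' ≫ h') t))
  rw [inv_hom_whiskerRight₃_assoc, reassoc_of% e₄, whiskerRight_comp_eq_assoc e₃, reassoc_of% e₅,
    reassoc_of% e₁]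

/-! ### Vertical composition and naturality of the unit constraints -/

lemma elVcomp_id {f g : a ⟶ b} {x : F.obj a} {y : F.obj b} {p : x ⟶ (F.map f).obj y}
    {q : x ⟶ (F.map g).obj y} {α : f ⟶ g} (m : p ⟶ q ≫ F.app α y) (e : α ≫ 𝟙 g = α) :
    m ≫ (F.actId (𝟙 g) rfl q).inv ▷ F.app α y ≫ (F.actComp α (𝟙 g) α e q).hom = m := by
  rw [actComp_id_right (𝟙 g) rfl, inv_hom_whiskerRight, Category.comp_id]

lemma elVcomp_assoc {f g h i : a ⟶ b} {x : F.obj a} {y : F.obj b} {p : x ⟶ (F.map f).obj y}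
    {q : x ⟶ (F.map g).obj y} {r : x ⟶ (F.map h).obj y} {s : x ⟶ (F.map i).obj y} {α : f ⟶ g}
    {β : g ⟶ h} {γ : h ⟶ i} (m : p ⟶ q ≫ F.app α y) (n : q ⟶ r ≫ F.app β y)
    (l : r ⟶ s ≫ F.app γ y) :
    (m ≫ n ▷ F.app α y ≫ (F.actComp α β _ rfl r).hom) ≫ l ▷ F.app (α ≫ β) y ≫
        (F.actComp (α ≫ β) γ (α ≫ β ≫ γ) (Category.assoc _ _ _) s).hom =
      m ≫ (n ≫ l ▷ F.app β y ≫ (F.actComp β γ _ rfl s).hom) ▷ F.app α y ≫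
        (F.actComp α (β ≫ γ) _ rfl s).hom := by
  simp only [comp_whiskerRight, Category.assoc]
  rw [← act₂₁_natural_assoc, actComp_assoc α β γ (α ≫ β) (β ≫ γ) (α ≫ β ≫ γ)]

lemma elWhisk_id_left {f : a ⟶ b} {j k : b ⟶ c} {x : F.obj a} {y : F.obj b} {z : F.obj c}
    (p : x ⟶ (F.map f).obj y) {r : y ⟶ (F.map j).obj z} {s : y ⟶ (F.map k).obj z} {β : j ⟶ k}
    (n : r ⟶ s ≫ F.app β z) :
    elWhisk (F.actId (𝟙 f) rfl p).inv n =
      p ◁ (F.map f).map₂ n ≫ (split (F.map f) s (F.app β z) p).hom ≫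
        (F.actId (𝟙 f) rfl (p ≫ (F.map f).map s)).inv ▷ (F.map f).map (F.app β z) := by
  have e : (F.actId (𝟙 f) rfl p).inv ▷ (F.map f).map s ≫ (F.actNat (𝟙 f) s p).hom =
      (F.actId (𝟙 f) rfl (p ≫ (F.map f).map s)).inv := by
    rw [← cancel_mono (F.actId (𝟙 f) rfl (p ≫ (F.map f).map s)).hom, Category.assoc,
      actId_nat, Iso.inv_hom_id, inv_hom_whiskerRight]
  rw [elWhisk, ← whisker_exchange_assoc, split_natural_assoc, ← comp_whiskerRight, e]

lemma elWhisk_id_right {f g : a ⟶ b} {j : b ⟶ c} {x : F.obj a} {y : F.obj b} {z : F.obj c}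
    {p : x ⟶ (F.map f).obj y} {q : x ⟶ (F.map g).obj y} {α : f ⟶ g} (m : p ⟶ q ≫ F.app α y)
    (r : y ⟶ (F.map j).obj z) :
    elWhisk m (F.actId (𝟙 j) rfl r).inv =
      m ▷ (F.map f).map r ≫ (F.actNat α r q).hom ≫
        (act₁₀ (mapIso₁₀ (F.map f) (F.appId (𝟙 j) rfl z))
          ((q ≫ (F.map g).map r) ≫ F.app α _)).inv := by
  have e : (q ≫ F.app α y) ◁ (F.map f).map₂ (F.actId (𝟙 j) rfl r).inv ≫
      (split (F.map f) r (F.app (𝟙 j) z) (q ≫ F.app α y)).hom =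
      (act₁₀ (mapIso₁₀ (F.map f) (F.appId (𝟙 j) rfl z))
        ((q ≫ F.app α y) ≫ (F.map f).map r)).inv := by
    rw [← cancel_mono (act₁₀ (mapIso₁₀ (F.map f) (F.appId (𝟙 j) rfl z))
      ((q ≫ F.app α y) ≫ (F.map f).map r)).hom, Category.assoc, ← map_act₁₀, Iso.inv_hom_id,
      ← Bicategory.whiskerLeft_comp, ← PrelaxFunctor.map₂_comp]
    simp
  rw [elWhisk, reassoc_of% e, act₁₀_natural_inv]

lemma elUnitDom_natural (H : F.IsTrihom) {f f' : a ⟶ b} {x : F.obj a} {y : F.obj b}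
    {p : x ⟶ (F.map f).obj y} {p' : x ⟶ (F.map f').obj y} {α : f ⟶ f'}
    (m : p ⟶ p' ≫ F.app α y) (γ : _) (e₁ : hcomp₂ (𝟙 (𝟙 a)) α ≫ (λ_ f').hom = γ)
    (e₂ : (λ_ f).hom ≫ α = γ) :
    F.elHcomp (F.elId₂ (F.iotaApp a x)) m ≫
        F.elUnitDom p' ▷ F.app (hcomp₂ (𝟙 (𝟙 a)) α) y ≫
        (F.actComp (hcomp₂ (𝟙 (𝟙 a)) α) (λ_ f').hom γ e₁ p').hom =
      F.elUnitDom p ≫ m ▷ F.app (λ_ f).hom y ≫ (F.actComp (λ_ f).hom α γ e₂ p').hom := by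
  subst e₂
  have n := act_delta_nat H α p'
  have n' : (F.actId (𝟙 (𝟙 a)) rfl (p' ≫ F.iotaApp a _)).inv ▷ (F.map (𝟙 a)).map (F.app α y) ▷
        F.chiApp (𝟙 a) f y ≫ (F.actChiNat (𝟙 (𝟙 a)) α (p' ≫ F.iotaApp a _)).hom ≫
      (F.actDelta f' p').hom ▷ F.app (hcomp₂ (𝟙 (𝟙 a)) α) y ≫
        (F.actComp (hcomp₂ (𝟙 (𝟙 a)) α) (λ_ f').hom _ e₁ p').hom =
      (F.actIota (F.app α y) p').hom ▷ F.chiApp (𝟙 a) f y ≫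
        (F.actDelta f (p' ≫ F.app α y)).hom ≫ (F.actComp (λ_ f).hom α _ rfl p').hom := by
    rw [← cancel_epi ((F.actDelta f (p' ≫ F.app α y)).inv ≫
      (F.actIota (F.app α y) p').inv ▷ F.chiApp (𝟙 a) f y)]
    simp only [Category.assoc]
    rw [reassoc_of% n]
    simp only [inv_hom_whiskerRight_assoc, Iso.inv_hom_id_assoc, Iso.inv_hom_id, Category.comp_id]
  have k := congrArg (· ▷ F.chiApp (𝟙 a) f y) (iotaCell_comp p' (F.app α y))
  simp only [comp_whiskerRight] at k
  rw [elId₂_eq, elHcomp_eq, elHcompAct, elWhisk_id_left, elUnitDom_eq, elUnitDom_eq]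
  simp only [comp_whiskerRight, Category.assoc, inv_hom_whiskerRight_assoc]
  rw [← act₃₂_natural_assoc,
    whiskerRight_comp_eq_assoc (whiskerRight_comp_eq (act₁₀_natural_inv _ _).symm _),
    n', reassoc_of% k, whiskerRight_comp_eq_assoc (iotaCell_natural _), act₂₁_natural_assoc]

lemma elUnitCod_natural (H : F.IsTrihom) {f f' : a ⟶ b} {x : F.obj a} {y : F.obj b}
    {p : x ⟶ (F.map f).obj y} {p' : x ⟶ (F.map f').obj y} {α : f ⟶ f'}
    (m : p ⟶ p' ≫ F.app α y) (e : (ρ_ f).inv ≫ hcomp₂ α (𝟙 (𝟙 b)) = α ≫ (ρ_ f').inv) :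
    m ≫ F.elUnitCod p' ▷ F.app α y ≫ (F.actComp α (ρ_ f').inv _ rfl _).hom =
      F.elUnitCod p ≫ F.elHcomp m (F.elId₂ (F.iotaApp b y)) ▷ F.app (ρ_ f).inv y ≫
        (F.actComp (ρ_ f).inv (hcomp₂ α (𝟙 (𝟙 b))) _ e _).hom := by
  have n := act_gamma_nat H α p'
  have n' : (F.actNat α (F.iotaApp b y) p').hom ▷ F.chiApp f (𝟙 b) y ▷ F.app (ρ_ f).inv y ≫
        (act₁₀ (mapIso₁₀ (F.map f) (F.appId (𝟙 (𝟙 b)) rfl y))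
          ((p' ≫ (F.map f').map (F.iotaApp b y)) ≫ F.app α _)).inv ▷ F.chiApp f (𝟙 b) y ▷
            F.app (ρ_ f).inv y ≫
        (F.actChiNat α (𝟙 (𝟙 b)) (p' ≫ (F.map f').map (F.iotaApp b y))).hom ▷
          F.app (ρ_ f).inv y ≫
        (F.actComp (ρ_ f).inv (hcomp₂ α (𝟙 (𝟙 b))) (α ≫ (ρ_ f').inv) e
          ((p' ≫ (F.map f').map (F.iotaApp b y)) ≫ F.chiApp f' (𝟙 b) y)).hom =
      (F.actGamma f (p' ≫ F.app α y)).hom ≫ (F.actGamma f' p').inv ▷ F.app α y ≫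
        (F.actComp α (ρ_ f').inv _ rfl
          ((p' ≫ (F.map f').map (F.iotaApp b y)) ≫ F.chiApp f' (𝟙 b) y)).hom := by
    rw [n]
    simp only [Category.assoc, hom_inv_whiskerRight_assoc, Iso.inv_hom_id, Category.comp_id]
  rw [elUnitCod_eq, elUnitCod_eq, elId₂_eq, elHcomp_eq, elHcompAct, elWhisk_id_right]
  simp only [comp_whiskerRight, Category.assoc, inv_hom_whiskerRight_assoc, act₂₁_natural]
  rw [reassoc_of% n', reassoc_of% act₃₀_natural, Iso.inv_hom_id_assoc]

/-! ### The pentagon -/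

variable (F) in
/-- The compositors of `F f` and `F g` that separate the three factors of the image of `elComp q r`
under both. -/
abbrev splitComp₂ (f : a ⟶ b) (g : b ⟶ c) {h : c ⟶ d} {e : B} {k : d ⟶ e} {z : F.obj c}
    {t : F.obj d} {s : F.obj e} (q : z ⟶ (F.map h).obj t) (r : t ⟶ (F.map k).obj s) {w : F.obj a}
    (u : w ⟶ (F.map f).obj ((F.map g).obj z)) :
    u ≫ (F.map f).map ((F.map g).map (F.elComp q r)) ≅
      ((u ≫ (F.map f).map ((F.map g).map q)) ≫
        (F.map f).map ((F.map g).map ((F.map h).map r))) ≫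
          (F.map f).map ((F.map g).map (F.chiApp h k s)) :=
  whiskerLeftIso u ((F.map f).map₂Iso ((F.map g).mapComp q ((F.map h).map r ≫ F.chiApp h k s))) ≪≫
    split (F.map f) ((F.map g).map q) ((F.map g).map ((F.map h).map r ≫ F.chiApp h k s)) u ≪≫
    whiskerLeftIso _ ((F.map f).map₂Iso ((F.map g).mapComp ((F.map h).map r) (F.chiApp h k s))) ≪≫
    split (F.map f) ((F.map g).map ((F.map h).map r)) ((F.map g).map (F.chiApp h k s))
      (u ≫ (F.map f).map ((F.map g).map q))

/-- The naturality cell of `χ` at a composite 1-cell is composed of those at the three factors. -/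
lemma actChi_elComp (f : a ⟶ b) (g : b ⟶ c) {h : c ⟶ d} {e : B} {k : d ⟶ e} {z : F.obj c}
    {t : F.obj d} {s : F.obj e} (q : z ⟶ (F.map h).obj t) (r : t ⟶ (F.map k).obj s) {w : F.obj a}
    (u : w ⟶ (F.map f).obj ((F.map g).obj z)) :
    (F.splitComp (f ≫ g) q r (u ≫ F.chiApp f g z)).hom ≫
        (F.actChi f g q u).hom ▷ (F.map (f ≫ g)).map ((F.map h).map r) ▷
          (F.map (f ≫ g)).map (F.chiApp h k s) ≫
        (F.actChi f g ((F.map h).map r) (u ≫ (F.map f).map ((F.map g).map q))).hom ▷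
          (F.map (f ≫ g)).map (F.chiApp h k s) ≫
        (F.actChi f g (F.chiApp h k s) ((u ≫ (F.map f).map ((F.map g).map q)) ≫
          (F.map f).map ((F.map g).map ((F.map h).map r)))).hom =
      (F.actChi f g (F.elComp q r) u).hom ≫ (F.splitComp₂ f g q r u).hom ▷ F.chiApp f g _ := by
  simp only [splitComp, splitComp₂, elComp, Iso.trans_hom, Category.assoc, comp_whiskerRight,
    whiskerLeftIso_hom, PrelaxFunctor.map₂Iso_hom]
  rw [← split_natural_assoc, actChi_comp, reassoc_of% actChi_comp]

/-- Splitting for `F g` and then its image for `F f` is splitting for both. -/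
lemma map₂_splitComp (f : a ⟶ b) {g : b ⟶ c} {h : c ⟶ d} {e : B} {k : d ⟶ e} {y : F.obj b}
    {z : F.obj c} {t : F.obj d} {s : F.obj e} (p : y ⟶ (F.map g).obj z)
    (q : z ⟶ (F.map h).obj t) (r : t ⟶ (F.map k).obj s) {w : F.obj a}
    (u : w ⟶ (F.map f).obj y) :
    u ◁ (F.map f).map₂ (F.splitComp g q r p).hom ≫
        (split (F.map f) ((p ≫ (F.map g).map q) ≫ (F.map g).map ((F.map h).map r))
          ((F.map g).map (F.chiApp h k s)) u).hom ≫
        (split (F.map f) (p ≫ (F.map g).map q) ((F.map g).map ((F.map h).map r)) u).hom ▷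
          (F.map f).map ((F.map g).map (F.chiApp h k s)) ≫
        (split (F.map f) p ((F.map g).map q) u).hom ▷
          (F.map f).map ((F.map g).map ((F.map h).map r)) ▷
          (F.map f).map ((F.map g).map (F.chiApp h k s)) =
      (split (F.map f) p ((F.map g).map (F.elComp q r)) u).hom ≫
        (F.splitComp₂ f g q r (u ≫ (F.map f).map p)).hom := by
  simp only [splitComp, splitComp₂, elComp, Iso.trans_hom, Category.assoc,
    whiskerLeftIso_hom, PrelaxFunctor.map₂Iso_hom, PrelaxFunctor.map₂_comp,
    Bicategory.whiskerLeft_comp]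
  rw [reassoc_of% map_split, ← split_natural, whisker_exchange_assoc, reassoc_of% map_split]

set_option maxHeartbeats 800000 in
/-- The image under `F f` of the associativity constraint, acting after `u`, with all images of
composites split. -/
lemma map₂_elAssoc (f : a ⟶ b) {g : b ⟶ c} {h : c ⟶ d} {e : B} {k : d ⟶ e} {y : F.obj b}
    {z : F.obj c} {t : F.obj d} {s : F.obj e} (p : y ⟶ (F.map g).obj z)
    (q : z ⟶ (F.map h).obj t) (r : t ⟶ (F.map k).obj s) {w : F.obj a}
    (u : w ⟶ (F.map f).obj y) :
    u ◁ (F.map f).map₂ (F.elAssoc p q r) ≫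
        (split (F.map f) (F.elComp p (F.elComp q r)) (F.app (α_ g h k).hom s) u).hom ≫
        (F.splitComp f p (F.elComp q r) u).hom ▷ (F.map f).map (F.app (α_ g h k).hom s) ≫
        (F.splitComp₂ f g q r (u ≫ (F.map f).map p)).hom ▷
          (F.map f).map (F.chiApp g (h ≫ k) s) ▷ (F.map f).map (F.app (α_ g h k).hom s) =
      (F.splitComp f (F.elComp p q) r u).hom ≫
        (F.splitComp f p q u).hom ▷ (F.map f).map ((F.map (g ≫ h)).map r) ▷
          (F.map f).map (F.chiApp (g ≫ h) k s) ≫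
        (act₂₂ (mapIso₂₂ (F.map f) (F.chiCell g h r).symm)
          ((u ≫ (F.map f).map p) ≫ (F.map f).map ((F.map g).map q))).hom ▷
            (F.map f).map (F.chiApp (g ≫ h) k s) ≫
        (act₃₂ (mapIso₃₂ (F.map f) (α_ _ _ _ ≪≫ F.omegaApp g h k s))
          (((u ≫ (F.map f).map p) ≫ (F.map f).map ((F.map g).map q)) ≫
            (F.map f).map ((F.map g).map ((F.map h).map r)))).inv := by
  have c (A B : y ⟶ (F.map (g ≫ h ≫ k)).obj s) (i : A ≅ B) :
    (u ◁ (F.map f).map₂ i.inv) ▷ (F.map f).map (F.app (α_ g h k).hom s) ≫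
      (u ◁ (F.map f).map₂ i.hom) ▷ (F.map f).map (F.app (α_ g h k).hom s) = 𝟙 _ := by
    rw [← comp_whiskerRight, ← Bicategory.whiskerLeft_comp, ← PrelaxFunctor.map₂_comp,
      Iso.inv_hom_id, PrelaxFunctor.map₂_id, Bicategory.whiskerLeft_id, id_whiskerRight]
  have w₁ := map₂_splitComp f p q r u
  have w₁' := congrArg (fun t => t ▷ (F.map f).map (F.chiApp g (h ≫ k) s) ▷
    (F.map f).map (F.app (α_ g h k).hom s)) w₁
  have w₃ := map_act₂₂ (F.map f) (F.chiCell g h r).symm (p ≫ (F.map g).map q) u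
  have w₃' := congrArg (fun t => t ▷ (F.map f).map (F.chiApp (g ≫ h) k s)) w₃
  rw [elAssoc_eq]
  rw [splitComp_hom_eq f p (F.elComp q r), splitComp_hom_eq f (F.elComp p q),
    splitComp_hom_eq f p q]
  simp only [PrelaxFunctor.map₂_comp, Bicategory.whiskerLeft_comp, comp_whiskerRight,
    Category.assoc] at w₁' w₃' ⊢
  rw [split_natural_left_assoc, reassoc_of% c]
  simp only [split_natural_left_assoc]
  have c' : (u ◁ (F.map f).map₂ (F.splitComp g q r p).inv) ▷ (F.map f).map (F.chiApp g (h ≫ k) s) ▷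
      (F.map f).map (F.app (α_ g h k).hom s) ≫
      (u ◁ (F.map f).map₂ (F.splitComp g q r p).hom) ▷ (F.map f).map (F.chiApp g (h ≫ k) s) ▷
      (F.map f).map (F.app (α_ g h k).hom s) = 𝟙 _ := by
    rw [← comp_whiskerRight, ← comp_whiskerRight, ← Bicategory.whiskerLeft_comp,
      ← PrelaxFunctor.map₂_comp, Iso.inv_hom_id, PrelaxFunctor.map₂_id,
      Bicategory.whiskerLeft_id, id_whiskerRight, id_whiskerRight]
  rw [whiskerRight_comp_eq_assoc (split_natural_left _ _ _ _), ← w₁', reassoc_of% c',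
    reassoc_of% map_act₃₂_inv, ← act₃₂_natural_inv_assoc, ← act₃₂_natural_inv,
    split_natural_left_assoc, reassoc_of% w₃', ← whiskerRight_comp_eq_assoc (act₂₂_natural
      (mapIso₂₂ (F.map f) (F.chiCell g h r).symm) _), split_natural_left_assoc,
    whiskerRight_comp_eq_assoc (split_natural_left _ _ _ _)]

set_option maxHeartbeats 800000 in
/-- The axiom over the pentagon with both sides inverted and the composition constraint moved to the
other side. The composite `γ` is kept as a variable so that it may be given by either side of the
pentagon in the base. -/
lemma act_assoc_inv (H : F.IsTrihom) {e : B} (f : a ⟶ b) (g : b ⟶ c) (h : c ⟶ d) (k : d ⟶ e)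
    {x : F.obj e} {w : F.obj a}
    (u : w ⟶ (F.map f).obj ((F.map g).obj ((F.map h).obj ((F.map k).obj x)))) (γ : _)
    (e₁ : (α_ (f ≫ g) h k).hom ≫ (α_ f g (h ≫ k)).hom = γ)
    (e₂ : (hcomp₂ (α_ f g h).hom (𝟙 k) ≫ (α_ f (g ≫ h) k).hom) ≫ hcomp₂ (𝟙 f) (α_ g h k).hom = γ) :
    (F.actOmega (f ≫ g) h k (u ≫ F.chiApp f g _)).inv ≫
        (F.actChi f g (F.chiApp h k x) u).hom ▷ F.chiApp (f ≫ g) (h ≫ k) x ▷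
          F.app (α_ (f ≫ g) h k).hom x ≫
        (F.actOmega f g (h ≫ k) (u ≫ (F.map f).map ((F.map g).map (F.chiApp h k x)))).inv ▷
          F.app (α_ (f ≫ g) h k).hom x ≫
        (F.actComp (α_ (f ≫ g) h k).hom (α_ f g (h ≫ k)).hom γ e₁
          (((u ≫ (F.map f).map ((F.map g).map (F.chiApp h k x))) ≫
            (F.map f).map (F.chiApp g (h ≫ k) x)) ≫ F.chiApp f (g ≫ h ≫ k) x)).hom =
      (F.actOmega f g h u).inv ▷ F.chiApp ((f ≫ g) ≫ h) k x ≫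
        (act₁₀ (mapIso₁₀ (F.map ((f ≫ g) ≫ h)) (F.appId (𝟙 k) rfl x))
          (((u ≫ (F.map f).map (F.chiApp g h _)) ≫ F.chiApp f (g ≫ h) _) ≫
            F.app (α_ f g h).hom _)).inv ▷ F.chiApp ((f ≫ g) ≫ h) k x ≫
        (F.actChiNat (α_ f g h).hom (𝟙 k) ((u ≫ (F.map f).map (F.chiApp g h _)) ≫
          F.chiApp f (g ≫ h) _)).hom ≫
        (F.actOmega f (g ≫ h) k (u ≫ (F.map f).map (F.chiApp g h _))).inv ▷
          F.app (hcomp₂ (α_ f g h).hom (𝟙 k)) x ≫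
        (act₃₂ (mapIso₃₂ (F.map f) (α_ _ _ _ ≪≫ F.omegaApp g h k x)) u).inv ▷
              F.chiApp f ((g ≫ h) ≫ k) x ▷ F.app (α_ f (g ≫ h) k).hom x ▷
                F.app (hcomp₂ (α_ f g h).hom (𝟙 k)) x ≫
        (F.actId (𝟙 f) rfl ((u ≫ (F.map f).map ((F.map g).map (F.chiApp h k x))) ≫
            (F.map f).map (F.chiApp g (h ≫ k) x))).inv ▷ (F.map f).map (F.app (α_ g h k).hom x) ▷
              F.chiApp f ((g ≫ h) ≫ k) x ▷ F.app (α_ f (g ≫ h) k).hom x ▷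
                F.app (hcomp₂ (α_ f g h).hom (𝟙 k)) x ≫
        (F.actChiNat (𝟙 f) (α_ g h k).hom
          ((u ≫ (F.map f).map ((F.map g).map (F.chiApp h k x))) ≫
            (F.map f).map (F.chiApp g (h ≫ k) x))).hom ▷ F.app (α_ f (g ≫ h) k).hom x ▷
              F.app (hcomp₂ (α_ f g h).hom (𝟙 k)) x ≫
        (F.actComp (hcomp₂ (α_ f g h).hom (𝟙 k)) (α_ f (g ≫ h) k).hom _ rfl
          ((((u ≫ (F.map f).map ((F.map g).map (F.chiApp h k x))) ≫
            (F.map f).map (F.chiApp g (h ≫ k) x)) ≫ F.chiApp f (g ≫ h ≫ k) x) ≫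
              F.app (hcomp₂ (𝟙 f) (α_ g h k).hom) x)).hom ≫
        (F.actComp (hcomp₂ (α_ f g h).hom (𝟙 k) ≫ (α_ f (g ≫ h) k).hom)
          (hcomp₂ (𝟙 f) (α_ g h k).hom) γ e₂
          (((u ≫ (F.map f).map ((F.map g).map (F.chiApp h k x))) ≫
            (F.map f).map (F.chiApp g (h ≫ k) x)) ≫ F.chiApp f (g ≫ h ≫ k) x)).hom := by
  subst e₂
  have h₁ := IsIso.inv_eq_inv.mpr (act_assoc H f g h k u)
  simp only [IsIso.inv_comp, IsIso.Iso.inv_hom, IsIso.Iso.inv_inv, inv_whiskerRight,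
    Category.assoc] at h₁
  rw [reassoc_of% h₁, Iso.inv_hom_id, Category.comp_id]

/-- `actOmega_nat` with both sides inverted. -/
lemma actOmega_nat_inv (f : a ⟶ b) (g : b ⟶ c) (h : c ⟶ d) {x y : F.obj d} (k : x ⟶ y)
    {w : F.obj a} (u : w ⟶ (F.map f).obj ((F.map g).obj ((F.map h).obj x))) :
    (F.actChi (f ≫ g) h k (u ≫ F.chiApp f g _)).hom ≫
        (F.actChi f g ((F.map h).map k) u).hom ▷ F.chiApp (f ≫ g) h y ≫
        (F.actOmega f g h (u ≫ (F.map f).map ((F.map g).map ((F.map h).map k)))).inv =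
      (F.actOmega f g h u).inv ▷ (F.map ((f ≫ g) ≫ h)).map k ≫
        (F.actNat (α_ f g h).hom k ((u ≫ (F.map f).map (F.chiApp g h x)) ≫
          F.chiApp f (g ≫ h) x)).hom ≫
        (F.actChi f (g ≫ h) k (u ≫ (F.map f).map (F.chiApp g h x))).hom ▷
          F.app (α_ f g h).hom y ≫
        (act₂₂ (mapIso₂₂ (F.map f) (F.chiCell g h k).symm) u).hom ▷ F.chiApp f (g ≫ h) y ▷
          F.app (α_ f g h).hom y := by
  have o := IsIso.inv_eq_inv.mpr (actOmega_nat f g h k u)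
  simp only [IsIso.inv_comp, IsIso.Iso.inv_hom, IsIso.Iso.inv_inv, inv_whiskerRight,
    Category.assoc] at o
  exact o

set_option maxHeartbeats 800000 in
/-- The pentagon in the fibre, without the splitting of composites: `act_assoc_inv` with the 1-cell
`s` inserted between the third and the fourth instance of `F`, past which every cell is moved by
naturality. -/
lemma act_pentagon (H : F.IsTrihom) {e : B} (f : a ⟶ b) (g : b ⟶ c) (h : c ⟶ d) (k : d ⟶ e)
    {t : F.obj d} {x : F.obj e} (s : t ⟶ (F.map k).obj x) {w : F.obj a}
    (v : w ⟶ (F.map f).obj ((F.map g).obj ((F.map h).obj t))) (γ : _)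
    (e₁ : (α_ (f ≫ g) h k).hom ≫ (α_ f g (h ≫ k)).hom = γ)
    (e₂ : (hcomp₂ (α_ f g h).hom (𝟙 k) ≫ (α_ f (g ≫ h) k).hom) ≫ hcomp₂ (𝟙 f) (α_ g h k).hom = γ) :
    (F.actOmega f g h v).inv ▷ (F.map ((f ≫ g) ≫ h)).map s ▷ F.chiApp ((f ≫ g) ≫ h) k x ≫
        (F.actNat (α_ f g h).hom s ((v ≫ (F.map f).map (F.chiApp g h _)) ≫
          F.chiApp f (g ≫ h) _)).hom ▷ F.chiApp ((f ≫ g) ≫ h) k x ≫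
        (act₁₀ (mapIso₁₀ (F.map ((f ≫ g) ≫ h)) (F.appId (𝟙 k) rfl x))
          ((((v ≫ (F.map f).map (F.chiApp g h _)) ≫ F.chiApp f (g ≫ h) _) ≫
            (F.map (f ≫ g ≫ h)).map s) ≫ F.app (α_ f g h).hom _)).inv ▷
              F.chiApp ((f ≫ g) ≫ h) k x ≫
        (F.actChiNat (α_ f g h).hom (𝟙 k) (((v ≫ (F.map f).map (F.chiApp g h _)) ≫
          F.chiApp f (g ≫ h) _) ≫ (F.map (f ≫ g ≫ h)).map s)).hom ≫
        (F.actChi f (g ≫ h) s (v ≫ (F.map f).map (F.chiApp g h t))).hom ▷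
          F.chiApp (f ≫ g ≫ h) k x ▷ F.app (hcomp₂ (α_ f g h).hom (𝟙 k)) x ≫
        (F.actOmega f (g ≫ h) k ((v ≫ (F.map f).map (F.chiApp g h _)) ≫
          (F.map f).map ((F.map (g ≫ h)).map s))).inv ▷
          F.app (hcomp₂ (α_ f g h).hom (𝟙 k)) x ≫
        (act₂₂ (mapIso₂₂ (F.map f) (F.chiCell g h s).symm) v).hom ▷
          (F.map f).map (F.chiApp (g ≫ h) k x) ▷
              F.chiApp f ((g ≫ h) ≫ k) x ▷ F.app (α_ f (g ≫ h) k).hom x ▷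
                F.app (hcomp₂ (α_ f g h).hom (𝟙 k)) x ≫
        (act₃₂ (mapIso₃₂ (F.map f) (α_ _ _ _ ≪≫ F.omegaApp g h k x))
          (v ≫ (F.map f).map ((F.map g).map ((F.map h).map s)))).inv ▷
              F.chiApp f ((g ≫ h) ≫ k) x ▷ F.app (α_ f (g ≫ h) k).hom x ▷
                F.app (hcomp₂ (α_ f g h).hom (𝟙 k)) x ≫
        (F.actId (𝟙 f) rfl (((v ≫ (F.map f).map ((F.map g).map ((F.map h).map s))) ≫
          (F.map f).map ((F.map g).map (F.chiApp h k x))) ≫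
            (F.map f).map (F.chiApp g (h ≫ k) x))).inv ▷ (F.map f).map (F.app (α_ g h k).hom x) ▷
              F.chiApp f ((g ≫ h) ≫ k) x ▷ F.app (α_ f (g ≫ h) k).hom x ▷
                F.app (hcomp₂ (α_ f g h).hom (𝟙 k)) x ≫
        (F.actChiNat (𝟙 f) (α_ g h k).hom
          (((v ≫ (F.map f).map ((F.map g).map ((F.map h).map s))) ≫
            (F.map f).map ((F.map g).map (F.chiApp h k x))) ≫
            (F.map f).map (F.chiApp g (h ≫ k) x))).hom ▷ F.app (α_ f (g ≫ h) k).hom x ▷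
              F.app (hcomp₂ (α_ f g h).hom (𝟙 k)) x ≫
        (F.actComp (hcomp₂ (α_ f g h).hom (𝟙 k)) (α_ f (g ≫ h) k).hom _ rfl _).hom ≫
        (F.actComp (hcomp₂ (α_ f g h).hom (𝟙 k) ≫ (α_ f (g ≫ h) k).hom)
          (hcomp₂ (𝟙 f) (α_ g h k).hom) γ e₂ _).hom =
      (F.actChi (f ≫ g) h s (v ≫ F.chiApp f g _)).hom ▷ F.chiApp ((f ≫ g) ≫ h) k x ≫
        (F.actChi f g ((F.map h).map s) v).hom ▷ F.chiApp (f ≫ g) h _ ▷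
          F.chiApp ((f ≫ g) ≫ h) k x ≫
        (F.actOmega (f ≫ g) h k ((v ≫ (F.map f).map ((F.map g).map ((F.map h).map s))) ≫
          F.chiApp f g _)).inv ≫
        (F.actChi f g (F.chiApp h k x) (v ≫ (F.map f).map ((F.map g).map ((F.map h).map s)))).hom ▷
          F.chiApp (f ≫ g) (h ≫ k) x ▷ F.app (α_ (f ≫ g) h k).hom x ≫
        (F.actOmega f g (h ≫ k) ((v ≫ (F.map f).map ((F.map g).map ((F.map h).map s))) ≫
          (F.map f).map ((F.map g).map (F.chiApp h k x)))).inv ▷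
          F.app (α_ (f ≫ g) h k).hom x ≫
        (F.actComp (α_ (f ≫ g) h k).hom (α_ f g (h ≫ k)).hom γ e₁ _).hom := by
  have o := congrArg (· ▷ F.chiApp ((f ≫ g) ≫ h) k x) (actOmega_nat_inv f g h s v)
  simp only [comp_whiskerRight] at o
  have fx := act₁₀_natural_inv (mapIso₁₀ (F.map ((f ≫ g) ≫ h)) (F.appId (𝟙 k) rfl x))
    ((act₂₂ (mapIso₂₂ (F.map f) (F.chiCell g h s).symm) v).hom ▷ F.chiApp f (g ≫ h) _ ▷
      F.app (α_ f g h).hom _)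
  have x₁ := act₁₀_natural_inv (mapIso₁₀ (F.map ((f ≫ g) ≫ h)) (F.appId (𝟙 k) rfl x))
    ((F.actChi f (g ≫ h) s (v ≫ (F.map f).map (F.chiApp g h t))).hom ▷ F.app (α_ f g h).hom _)
  rw [act_assoc_inv H f g h k _ γ e₁ e₂, reassoc_of% o,
    whiskerRight_comp_eq_assoc fx, whiskerRight_comp_eq_assoc x₁,
    act₃₂_natural_assoc, act₃₂_natural_assoc]
  have o₂ := act₃₂_natural_inv (α_ _ _ _ ≪≫ F.omegaApp f (g ≫ h) k x)
    ((act₂₂ (mapIso₂₂ (F.map f) (F.chiCell g h s).symm) v).hom)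
  rw [whiskerRight_comp_eq_assoc o₂]

lemma splitComp_inv_natural (f : a ⟶ b) {g : b ⟶ c} {h : c ⟶ d} {y : F.obj b} {z : F.obj c}
    {t : F.obj d} (q : y ⟶ (F.map g).obj z) (r : z ⟶ (F.map h).obj t) {w : F.obj a}
    {u v : w ⟶ (F.map f).obj y} (m : u ⟶ v) :
    m ▷ (F.map f).map q ▷ (F.map f).map ((F.map g).map r) ▷
          (F.map f).map (F.chiApp g h t) ≫ (F.splitComp f q r v).inv =
      (F.splitComp f q r u).inv ≫ m ▷ (F.map f).map (F.elComp q r) := by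
  rw [Iso.comp_inv_eq, Category.assoc, splitComp_natural, Iso.inv_hom_id_assoc]

lemma actChi_elComp_inv (f : a ⟶ b) (g : b ⟶ c) {h : c ⟶ d} {e : B} {k : d ⟶ e} {z : F.obj c}
    {t : F.obj d} {s : F.obj e} (q : z ⟶ (F.map h).obj t) (r : t ⟶ (F.map k).obj s) {w : F.obj a}
    (u : w ⟶ (F.map f).obj ((F.map g).obj z)) :
    (F.splitComp (f ≫ g) q r (u ≫ F.chiApp f g z)).inv ≫ (F.actChi f g (F.elComp q r) u).hom =
        (F.actChi f g q u).hom ▷ (F.map (f ≫ g)).map ((F.map h).map r) ▷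
          (F.map (f ≫ g)).map (F.chiApp h k s) ≫
        (F.actChi f g ((F.map h).map r) (u ≫ (F.map f).map ((F.map g).map q))).hom ▷
          (F.map (f ≫ g)).map (F.chiApp h k s) ≫
        (F.actChi f g (F.chiApp h k s) ((u ≫ (F.map f).map ((F.map g).map q)) ≫
          (F.map f).map ((F.map g).map ((F.map h).map r)))).hom ≫
        (F.splitComp₂ f g q r u).inv ▷ F.chiApp f g _ := by
  have e := actChi_elComp f g q r u
  rw [Iso.inv_comp_eq]
  refine ((Iso.eq_comp_inv (whiskerRightIso (F.splitComp₂ f g q r u) (F.chiApp f g _))).2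
    e.symm).trans ?_
  simp only [Category.assoc, whiskerRightIso_inv]

set_option maxHeartbeats 800000 in
/-- The side of the pentagon with two associativity constraints, in the form to which `act_pentagon`
applies. -/
lemma elPentagon_right {e : B} {f : a ⟶ b} {g : b ⟶ c} {h : c ⟶ d} {k : d ⟶ e}
    {x : F.obj a} {y : F.obj b} {z : F.obj c} {t : F.obj d} {x' : F.obj e}
    (p : x ⟶ (F.map f).obj y) (q : y ⟶ (F.map g).obj z) (r : z ⟶ (F.map h).obj t)
    (s : t ⟶ (F.map k).obj x') (γ : _)
    (e₁ : (α_ (f ≫ g) h k).hom ≫ (α_ f g (h ≫ k)).hom = γ) :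
    F.elAssoc (F.elComp p q) r s ≫ F.elAssoc p q (F.elComp r s) ▷ F.app (α_ (f ≫ g) h k).hom x' ≫
        (F.actComp (α_ (f ≫ g) h k).hom (α_ f g (h ≫ k)).hom γ e₁ _).hom =
      (F.elCompIso (F.elComp (F.elComp p q) r) s).hom ≫
        (F.elCompIso (F.elComp p q) r).hom ▷ (F.map ((f ≫ g) ≫ h)).map s ▷
          F.chiApp ((f ≫ g) ≫ h) k x' ≫
        ((F.elCompIso p q).hom ▷ (F.map (f ≫ g)).map r ▷ F.chiApp (f ≫ g) h t ≫
          (F.actChi f g r (p ≫ (F.map f).map q)).hom ▷ F.chiApp (f ≫ g) h t) ▷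
            (F.map ((f ≫ g) ≫ h)).map s ▷ F.chiApp ((f ≫ g) ≫ h) k x' ≫
        (F.actChi (f ≫ g) h s (((p ≫ (F.map f).map q) ≫ (F.map f).map ((F.map g).map r)) ≫
          F.chiApp f g _)).hom ▷ F.chiApp ((f ≫ g) ≫ h) k x' ≫
        (F.actChi f g ((F.map h).map s) ((p ≫ (F.map f).map q) ≫
          (F.map f).map ((F.map g).map r))).hom ▷ F.chiApp (f ≫ g) h _ ▷
          F.chiApp ((f ≫ g) ≫ h) k x' ≫
        (F.actOmega (f ≫ g) h k ((((p ≫ (F.map f).map q) ≫ (F.map f).map ((F.map g).map r)) ≫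
          (F.map f).map ((F.map g).map ((F.map h).map s))) ≫ F.chiApp f g _)).inv ≫
        (F.actChi f g (F.chiApp h k x') (((p ≫ (F.map f).map q) ≫
          (F.map f).map ((F.map g).map r)) ≫ (F.map f).map ((F.map g).map ((F.map h).map s)))).hom ▷
          F.chiApp (f ≫ g) (h ≫ k) x' ▷ F.app (α_ (f ≫ g) h k).hom x' ≫
        (F.actOmega f g (h ≫ k) ((((p ≫ (F.map f).map q) ≫ (F.map f).map ((F.map g).map r)) ≫
          (F.map f).map ((F.map g).map ((F.map h).map s))) ≫
          (F.map f).map ((F.map g).map (F.chiApp h k x')))).inv ▷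
          F.app (α_ (f ≫ g) h k).hom x' ≫
        (F.actComp (α_ (f ≫ g) h k).hom (α_ f g (h ≫ k)).hom γ e₁ _).hom ≫
        (((F.splitComp₂ f g r s (p ≫ (F.map f).map q)).inv ▷ (F.map f).map (F.chiApp g (h ≫ k) x') ≫
          (F.splitComp f q (F.elComp r s) p).inv) ▷ F.chiApp f (g ≫ h ≫ k) x' ≫
            (F.elCompIso p (F.elComp q (F.elComp r s))).inv) ▷ F.app γ x' := by
  rw [elAssoc_eq, elAssoc_eq]
  simp only [comp_whiskerRight, Category.assoc, inv_hom_whiskerRight_assoc]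
  have n₁ := splitComp_inv_natural (f ≫ g) r s (F.elCompIso p q).hom
  have n₂ := actChi_elComp_inv f g r s (p ≫ (F.map f).map q)
  have n₂' := congrArg (· ▷ F.chiApp (f ≫ g) (h ≫ k) x' ▷ F.app (α_ (f ≫ g) h k).hom x') n₂
  simp only [comp_whiskerRight] at n₂'
  rw [← whiskerRight_comp_eq_assoc (whiskerRight_comp_eq n₁ _), reassoc_of% n₂',
    ← act₃₂_natural_inv_assoc]
  have o₁ := act₃₂_natural_inv (α_ _ _ _ ≪≫ F.omegaApp (f ≫ g) h k x')
    ((F.actChi f g r (p ≫ (F.map f).map q)).hom ▷ (F.map (f ≫ g)).map ((F.map h).map s))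
  have o₂ := act₃₂_natural_inv (α_ _ _ _ ≪≫ F.omegaApp (f ≫ g) h k x')
    (F.actChi f g ((F.map h).map s)
      ((p ≫ (F.map f).map q) ≫ (F.map f).map ((F.map g).map r))).hom
  have x₁ := act₂₂_natural (F.chiCell (f ≫ g) h s).symm
    ((F.elCompIso p q).hom ▷ (F.map (f ≫ g)).map r)
  have x₂ := act₂₂_natural (F.chiCell (f ≫ g) h s).symm
    (F.actChi f g r (p ≫ (F.map f).map q)).hom
  have o₃ := act₃₂_natural_inv (α_ _ _ _ ≪≫ F.omegaApp f g (h ≫ k) x')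
    (F.splitComp₂ f g r s (p ≫ (F.map f).map q)).inv
  rw [← reassoc_of% o₁, ← reassoc_of% o₂, ← whiskerRight_comp_eq_assoc x₁,
    ← whiskerRight_comp_eq_assoc x₂, whiskerRight_comp_eq_assoc o₃, act₂₁_natural,
    act₂₁_natural_assoc, act₂₁_natural_assoc]

/-- `map₂_elAssoc` with the splittings on the other sides of the equation. -/
lemma map₂_elAssoc_inv (f : a ⟶ b) {g : b ⟶ c} {h : c ⟶ d} {e : B} {k : d ⟶ e} {y : F.obj b}
    {z : F.obj c} {t : F.obj d} {s : F.obj e} (p : y ⟶ (F.map g).obj z)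
    (q : z ⟶ (F.map h).obj t) (r : t ⟶ (F.map k).obj s) {w : F.obj a}
    (u : w ⟶ (F.map f).obj y) :
    (F.splitComp f p q u).inv ▷ (F.map f).map ((F.map (g ≫ h)).map r) ▷
          (F.map f).map (F.chiApp (g ≫ h) k s) ≫
        (F.splitComp f (F.elComp p q) r u).inv ≫
        u ◁ (F.map f).map₂ (F.elAssoc p q r) ≫
        (split (F.map f) (F.elComp p (F.elComp q r)) (F.app (α_ g h k).hom s) u).hom =
      (act₂₂ (mapIso₂₂ (F.map f) (F.chiCell g h r).symm)
          ((u ≫ (F.map f).map p) ≫ (F.map f).map ((F.map g).map q))).hom ▷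
            (F.map f).map (F.chiApp (g ≫ h) k s) ≫
        (act₃₂ (mapIso₃₂ (F.map f) (α_ _ _ _ ≪≫ F.omegaApp g h k s))
          (((u ≫ (F.map f).map p) ≫ (F.map f).map ((F.map g).map q)) ≫
            (F.map f).map ((F.map g).map ((F.map h).map r)))).inv ≫
        ((F.splitComp₂ f g q r (u ≫ (F.map f).map p)).inv ▷
          (F.map f).map (F.chiApp g (h ≫ k) s) ≫ (F.splitComp f p (F.elComp q r) u).inv) ▷
            (F.map f).map (F.app (α_ g h k).hom s) := by
  have e := map₂_elAssoc f p q r u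
  rw [← cancel_mono ((F.splitComp f p (F.elComp q r) u).hom ▷
    (F.map f).map (F.app (α_ g h k).hom s)),
    ← cancel_mono ((F.splitComp₂ f g q r (u ≫ (F.map f).map p)).hom ▷
          (F.map f).map (F.chiApp g (h ≫ k) s) ▷ (F.map f).map (F.app (α_ g h k).hom s))]
  simp only [comp_whiskerRight, Category.assoc] at e ⊢
  rw [e, Iso.inv_hom_id_assoc, inv_hom_whiskerRight₂_assoc, inv_hom_whiskerRight_assoc,
    inv_hom_whiskerRight₂, Category.comp_id]

lemma elHcompAct_id_right {f g : a ⟶ b} {j : b ⟶ c} {x : F.obj a} {y : F.obj b} {z : F.obj c}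
    {p : x ⟶ (F.map f).obj y} {q : x ⟶ (F.map g).obj y} {α : f ⟶ g} (m : p ⟶ q ≫ F.app α y)
    (r : y ⟶ (F.map j).obj z) :
    elHcompAct m (F.elId₂ r) =
      m ▷ (F.map f).map r ▷ F.chiApp f j z ≫ (F.actNat α r q).hom ▷ F.chiApp f j z ≫
        (act₁₀ (mapIso₁₀ (F.map f) (F.appId (𝟙 j) rfl z))
          ((q ≫ (F.map g).map r) ≫ F.app α _)).inv ▷ F.chiApp f j z ≫
        (F.actChiNat α (𝟙 j) (q ≫ (F.map g).map r)).hom := by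
  rw [elHcompAct, elId₂_eq, elWhisk_id_right]
  simp only [comp_whiskerRight, Category.assoc]

lemma elHcompAct_id_left {f : a ⟶ b} {j k : b ⟶ c} {x : F.obj a} {y : F.obj b} {z : F.obj c}
    (p : x ⟶ (F.map f).obj y) {r : y ⟶ (F.map j).obj z} {s : y ⟶ (F.map k).obj z} {β : j ⟶ k}
    (n : r ⟶ s ≫ F.app β z) :
    elHcompAct (F.elId₂ p) n =
      (p ◁ (F.map f).map₂ n) ▷ F.chiApp f j z ≫
        (split (F.map f) s (F.app β z) p).hom ▷ F.chiApp f j z ≫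
        (F.actId (𝟙 f) rfl (p ≫ (F.map f).map s)).inv ▷ (F.map f).map (F.app β z) ▷
          F.chiApp f j z ≫
        (F.actChiNat (𝟙 f) β (p ≫ (F.map f).map s)).hom := by
  rw [elHcompAct, elId₂_eq, elWhisk_id_left]
  simp only [comp_whiskerRight, Category.assoc]

set_option maxHeartbeats 1600000 in
/-- The fibre component of the pentagon identity. -/
lemma elPentagon (H : F.IsTrihom) {e : B} {f : a ⟶ b} {g : b ⟶ c} {h : c ⟶ d} {k : d ⟶ e}
    {x : F.obj a} {y : F.obj b} {z : F.obj c} {t : F.obj d} {x' : F.obj e}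
    (p : x ⟶ (F.map f).obj y) (q : y ⟶ (F.map g).obj z) (r : z ⟶ (F.map h).obj t)
    (s : t ⟶ (F.map k).obj x') (γ : _)
    (e₁ : (α_ (f ≫ g) h k).hom ≫ (α_ f g (h ≫ k)).hom = γ)
    (e₂ : (hcomp₂ (α_ f g h).hom (𝟙 k) ≫ (α_ f (g ≫ h) k).hom) ≫ hcomp₂ (𝟙 f) (α_ g h k).hom = γ) :
    F.elHcomp (F.elAssoc p q r) (F.elId₂ s) ≫
        F.elAssoc p (F.elComp q r) s ▷ F.app (hcomp₂ (α_ f g h).hom (𝟙 k)) x' ≫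
        (F.actComp (hcomp₂ (α_ f g h).hom (𝟙 k)) (α_ f (g ≫ h) k).hom _ rfl _).hom ≫
        F.elHcomp (F.elId₂ p) (F.elAssoc q r s) ▷
          F.app (hcomp₂ (α_ f g h).hom (𝟙 k) ≫ (α_ f (g ≫ h) k).hom) x' ≫
        (F.actComp (hcomp₂ (α_ f g h).hom (𝟙 k) ≫ (α_ f (g ≫ h) k).hom)
          (hcomp₂ (𝟙 f) (α_ g h k).hom) γ e₂ _).hom =
      F.elAssoc (F.elComp p q) r s ≫ F.elAssoc p q (F.elComp r s) ▷ F.app (α_ (f ≫ g) h k).hom x' ≫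
        (F.actComp (α_ (f ≫ g) h k).hom (α_ f g (h ≫ k)).hom γ e₁ _).hom := by
  rw [elPentagon_right]
  -- Bracketed so that `elHcompAct_comp_left` separates the coherence cells from the middle part.
  have hA : F.elAssoc p q r =
      ((F.elCompIso (F.elComp p q) r).hom ≫
        (F.elCompIso p q).hom ▷ (F.map (f ≫ g)).map r ▷ F.chiApp (f ≫ g) h t) ≫
      ((F.actChi f g r (p ≫ (F.map f).map q)).hom ▷ F.chiApp (f ≫ g) h t ≫
      (F.actOmega f g h ((p ≫ (F.map f).map q) ≫ (F.map f).map ((F.map g).map r))).inv) ≫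
      ((F.splitComp f q r p).inv ▷ F.chiApp f (g ≫ h) t ≫
        (F.elCompIso p (F.elComp q r)).inv) ▷ F.app (α_ f g h).hom t := by
    rw [elAssoc_eq]
    simp only [comp_whiskerRight, Category.assoc]
  have m := congrArg (fun i => i ▷ F.chiApp f ((g ≫ h) ≫ k) x' ▷ F.app (α_ f (g ≫ h) k).hom x' ▷
    F.app (hcomp₂ (α_ f g h).hom (𝟙 k)) x') (map₂_elAssoc_inv f q r s p)
  have P := act_pentagon H f g h k s ((p ≫ (F.map f).map q) ≫ (F.map f).map ((F.map g).map r))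
    γ e₁ e₂
  have n₁ := act₂₂_natural (F.chiCell f (g ≫ h) s).symm (F.splitComp f q r p).inv
  have n₂ := act₃₂_natural_inv (α_ _ _ _ ≪≫ F.omegaApp f (g ≫ h) k x')
    ((F.splitComp f q r p).inv ▷ (F.map f).map ((F.map (g ≫ h)).map s))
  rw [elHcomp_eq, hA, elHcompAct_comp_left, elHcompAct_id_right, elAssoc_eq p (F.elComp q r) s,
    ← act₂₁_natural_assoc, elHcomp_eq, elHcompAct_id_left]
  simp only [comp_whiskerRight, Category.assoc, inv_hom_whiskerRight_assoc,
    inv_hom_whiskerRight₂_assoc] at m P ⊢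
  rw [inv_hom_whiskerRight₃_assoc, whiskerRight_comp_eq_assoc (whiskerRight_comp_eq n₁ _),
    whiskerRight_comp_eq_assoc n₂, reassoc_of% m]
  have i₁ := act₁₀_natural_inv (F.appId (𝟙 f) rfl _) (F.splitComp f q (F.elComp r s) p).inv
  have i₂ := act₁₀_natural_inv (F.appId (𝟙 f) rfl _)
    ((F.splitComp₂ f g r s (p ≫ (F.map f).map q)).inv ▷ (F.map f).map (F.chiApp g (h ≫ k) x'))
  have x₁ := act₃₂_natural (F.chiNatApp (𝟙 f) (α_ g h k).hom x')
    (F.splitComp f q (F.elComp r s) p).inv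
  have x₂ := act₃₂_natural (F.chiNatApp (𝟙 f) (α_ g h k).hom x')
    ((F.splitComp₂ f g r s (p ≫ (F.map f).map q)).inv ▷ (F.map f).map (F.chiApp g (h ≫ k) x'))
  rw [whiskerRight_comp_eq_assoc (whiskerRight_comp_eq (whiskerRight_comp_eq
      (whiskerRight_comp_eq i₁ _) _) _),
    whiskerRight_comp_eq_assoc (whiskerRight_comp_eq (whiskerRight_comp_eq
      (whiskerRight_comp_eq i₂ _) _) _),
    whiskerRight_comp_eq_assoc (whiskerRight_comp_eq x₁ _),
    whiskerRight_comp_eq_assoc (whiskerRight_comp_eq x₂ _)]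
  simp only [act₂₁_natural_assoc, act₂₁_natural] at P ⊢
  rw [reassoc_of% P]

/-! ### The triangle -/

/-- The image under `F f` of the unit constraint at the domain, acting after `u`, with all images of
composites split. -/
lemma map₂_elUnitDom_inv (f : a ⟶ b) {g : b ⟶ c} {y : F.obj b} {z : F.obj c}
    (q : y ⟶ (F.map g).obj z) {w : F.obj a} (u : w ⟶ (F.map f).obj y) :
    (F.splitComp f (F.iotaApp b y) q u).inv ≫ u ◁ (F.map f).map₂ (F.elUnitDom q) ≫
        (split (F.map f) q (F.app (λ_ g).hom z) u).hom =
      (act₂₂ (mapIso₂₂ (F.map f) (F.iotaCell b q).symm) u).hom ▷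
          (F.map f).map (F.chiApp (𝟙 b) g z) ≫
        (act₂₁ (mapIso₂₁ (F.map f) (F.deltaApp g z).symm) (u ≫ (F.map f).map q)).hom := by
  have w₁ := congrArg (· ▷ (F.map f).map (F.chiApp (𝟙 b) g z))
    (map_iso₂₂ (F.map f) (F.iotaCell b q).symm u)
  simp only [comp_whiskerRight, Iso.symm_hom] at w₁
  have w₂ := map_act₂₁ (F.map f) (F.deltaApp g z).symm q u
  rw [Iso.inv_comp_eq, splitComp_hom_eq, elUnitDom_eq]
  simp only [PrelaxFunctor.map₂_comp, Bicategory.whiskerLeft_comp, Category.assoc]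
  rw [w₂, split_natural_left_assoc, reassoc_of% w₁]

/-- The fibre component of the triangle identity. -/
lemma elTriangle (H : F.IsTrihom) {f : a ⟶ b} {g : b ⟶ c}
    {x : F.obj a} {y : F.obj b} {z : F.obj c}
    (p : x ⟶ (F.map f).obj y) (q : y ⟶ (F.map g).obj z)
    (e : hcomp₂ (ρ_ f).inv (𝟙 g) ≫ (α_ f (𝟙 b) g).hom ≫ hcomp₂ (𝟙 f) (λ_ g).hom = 𝟙 (f ≫ g)) :
    F.elHcomp (F.elUnitCod p) (F.elId₂ q) ≫
        F.elAssoc p (F.iotaApp b y) q ▷ F.app (hcomp₂ (ρ_ f).inv (𝟙 g)) z ≫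
        F.elHcomp (F.elId₂ p) (F.elUnitDom q) ▷ F.app (α_ f (𝟙 b) g).hom z ▷
          F.app (hcomp₂ (ρ_ f).inv (𝟙 g)) z ≫
        (F.actComp (α_ f (𝟙 b) g).hom (hcomp₂ (𝟙 f) (λ_ g).hom) _ rfl _).hom ▷
          F.app (hcomp₂ (ρ_ f).inv (𝟙 g)) z ≫
        (F.actComp (hcomp₂ (ρ_ f).inv (𝟙 g)) _ (𝟙 (f ≫ g)) e _).hom =
      F.elId₂ (F.elComp p q) := by
  -- The identity is the first of the three factors in `elHcompAct_comp_left`.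
  have hU : F.elUnitCod p = 𝟙 _ ≫ (F.actGamma f p).inv ≫
      (F.elCompIso p (F.iotaApp b y)).inv ▷ F.app (ρ_ f).inv y := by
    rw [elUnitCod_eq, Category.id_comp]
  have U := act_unit H f g (p ≫ (F.map f).map q)
  have G := IsIso.inv_eq_inv.mpr (actGamma_nat f q p)
  simp only [IsIso.inv_comp, IsIso.Iso.inv_hom, IsIso.Iso.inv_inv, inv_whiskerRight,
    Category.assoc] at G
  have G' := congrArg (· ▷ F.chiApp f g z) G
  have D := congrArg (· ▷ F.chiApp f (𝟙 b ≫ g) z ▷ F.app (α_ f (𝟙 b) g).hom z ▷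
    F.app (hcomp₂ (ρ_ f).inv (𝟙 g)) z) (map₂_elUnitDom_inv f q p)
  rw [elHcomp_eq, hU, elHcompAct_comp_left, elHcompAct_id_right, elAssoc_eq p (F.iotaApp b y) q,
    elHcomp_eq, elHcompAct_id_left]
  simp only [comp_whiskerRight, Category.assoc, inv_hom_whiskerRight_assoc,
    inv_hom_whiskerRight₂_assoc, inv_hom_whiskerRight₃_assoc, id_whiskerRight,
    Category.id_comp] at D G' ⊢
  rw [reassoc_of% D]
  have n₁ := act₃₂_natural_inv (α_ _ _ _ ≪≫ F.omegaApp f (𝟙 b) g z)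
    (act₂₂ (mapIso₂₂ (F.map f) (F.iotaCell b q).symm) p).hom
  have n₂ := act₃₂_natural (F.chiNatApp (ρ_ f).inv (𝟙 g) z)
    (F.actChi f (𝟙 b) q (p ≫ (F.map f).map (F.iotaApp b y))).hom
  have n₃ := act₃₂_natural (F.chiNatApp (ρ_ f).inv (𝟙 g) z)
    ((act₂₂ (mapIso₂₂ (F.map f) (F.iotaCell b q).symm) p).hom ▷ F.chiApp f (𝟙 b) _)
  rw [← whiskerRight_comp_eq_assoc n₁, ← reassoc_of% n₂]
  have i₁ := act₁₀_natural_inv (mapIso₁₀ (F.map f) (F.appId (𝟙 g) rfl z))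
    ((F.actChi f (𝟙 b) q (p ≫ (F.map f).map (F.iotaApp b y))).hom ▷ F.app (ρ_ f).inv _)
  have i₂ := act₁₀_natural_inv (mapIso₁₀ (F.map f) (F.appId (𝟙 g) rfl z))
    ((act₂₂ (mapIso₂₂ (F.map f) (F.iotaCell b q).symm) p).hom ▷ F.chiApp f (𝟙 b) _ ▷
      F.app (ρ_ f).inv _)
  have c := act₂₁_natural (F.appComp (α_ f (𝟙 b) g).hom (hcomp₂ (𝟙 f) (λ_ g).hom) _ rfl z)
    (F.elCompIso p q).inv
  rw [← reassoc_of% n₃, ← whiskerRight_comp_eq_assoc i₁, ← whiskerRight_comp_eq_assoc i₂,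
    ← reassoc_of% G', whiskerRight_comp_eq_assoc c, act₂₁_natural, elId₂_eq]
  rw [← cancel_mono (F.actId (𝟙 (f ≫ g)) rfl (F.elComp p q)).hom, Iso.inv_hom_id]
  simp only [Category.assoc]
  rw [act₁₀_natural, reassoc_of% U]
  simp only [hom_inv_whiskerRight₃_assoc, inv_hom_whiskerRight_assoc, Iso.hom_inv_id_assoc,
    Iso.hom_inv_id]

/-! ### Whiskering with the lift of a 1-cell of the base -/

/-- Composition with the lift `(g, 1)` is fully faithful on fibre components over a fixed 2-cell:
up to invertible 2-cells it is composition with `F f 1 ≅ 1` and with the equivalence `χ`. -/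
lemma elHcomp_id_bijective {f f' : a ⟶ b} (g : b ⟶ c) {x : F.obj a} {z : F.obj c}
    (p : x ⟶ (F.map f).obj ((F.map g).obj z)) (q : x ⟶ (F.map f').obj ((F.map g).obj z))
    (α : f ⟶ f') :
    Function.Bijective fun t : p ⟶ q ≫ F.app α _ =>
      F.elHcomp t (F.elId₂ (𝟙 ((F.map g).obj z))) := by
  have b₁ := whiskerRight_bijective (k := (F.map f).map (𝟙 ((F.map g).obj z)))
    (l := 𝟙 _) (ρ_ _ ≪≫ (F.map f).mapId _) (λ_ _ ≪≫ (F.map f).mapId _) p (q ≫ F.app α _)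
  have b₂ := whiskerRight_bijective (isoApp (F.chi f g).unit z).symm
    (isoApp (F.chi f g).counit z) (p ≫ (F.map f).map (𝟙 ((F.map g).obj z)))
      ((q ≫ F.app α _) ≫ (F.map f).map (𝟙 ((F.map g).obj z)))
  -- The invertible 2-cells that remain of the horizontal composite besides the two whiskerings.
  let e := F.actNat α (𝟙 _) q ≪≫ (act₁₀ (mapIso₁₀ (F.map f) (F.appId (𝟙 g) rfl z))
          ((q ≫ (F.map f').map (𝟙 _)) ≫ F.app α _)).symm
  let e' := whiskerRightIso e (F.chiApp f g z) ≪≫ F.actChiNat α (𝟙 g) (q ≫ (F.map f').map (𝟙 _)) ≪≫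
    whiskerRightIso (F.elCompIso q (𝟙 _)).symm (F.app (hcomp₂ α (𝟙 g)) z)
  have b₃ : Function.Bijective fun t => (F.elCompIso p (𝟙 ((F.map g).obj z))).hom ≫ t ≫ e'.hom :=
    (Iso.homCongr (F.elCompIso p (𝟙 ((F.map g).obj z))).symm e').bijective
  convert b₃.comp (b₂.comp b₁) using 2 with t
  rw [elHcomp_eq, elHcompAct_id_right]
  simp only [e', e, Iso.trans_hom, whiskerRightIso_hom, comp_whiskerRight,
    Category.assoc, Iso.symm_hom]
  rfl

/-- Composition with the lift `(g, 1)` is essentially surjective on fibre components: compose with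
the inverse equivalence of `χ`. -/
lemma exists_elComp_id_iso (f : a ⟶ b) (g : b ⟶ c) {x : F.obj a} {z : F.obj c}
    (r : x ⟶ (F.map (f ≫ g)).obj z) :
    ∃ p : x ⟶ (F.map f).obj ((F.map g).obj z),
      Nonempty (F.elComp p (𝟙 ((F.map g).obj z)) ≅ r) :=
  ⟨r ≫ (F.chi f g).inv.app z, ⟨F.elCompIso _ _ ≪≫
    whiskerRightIso (splitId (F.map f) _ (r ≫ (F.chi f g).inv.app z)) (F.chiApp f g z) ≪≫
    act₂₁ (isoApp (F.chi f g).counit z) r ≪≫ ρ_ r⟩⟩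

end TrihomData

/-! ### The bicategory axioms -/

namespace El

variable {B : Type u₁} [Bicategory.{w₁, v₁} B]
  {F : Trihomomorphism.{w₁, w₂, v₁, v₂, u₁, u₂} B}

open TrihomData

/-- A vertical composite, with its first component replaced by any 2-cell `γ` equal to it; this
avoids transport along equations of 2-cells of the base. -/
lemma vcomp_eq {x y : El F} {f g h : Hom x y} (σ : Hom₂ f g) (τ : Hom₂ g h)
    (γ : f.base ⟶ h.base) (e : σ.base ≫ τ.base = γ) :
    (data F).vcomp σ τ = (⟨γ, σ.fiber ≫ τ.fiber ▷ F.app σ.base y.fiber ≫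
      (F.actComp σ.base τ.base γ e h.fiber).hom⟩ : Hom₂ f h) := by
  subst e
  exact congrArg (Hom₂.mk _) (elVcomp_eq _ _)

/-- The identity 2-cell, with its first component replaced by any 2-cell `γ` equal to it. -/
lemma id₂_eq {x y : El F} (f : Hom x y) (γ : f.base ⟶ f.base) (e : γ = 𝟙 f.base) :
    (data F).id₂ f = (⟨γ, (F.actId γ e f.fiber).inv⟩ : Hom₂ f f) := by
  subst e
  exact congrArg (Hom₂.mk _) (elId₂_eq _)

lemma id_vcomp {x y : El F} {f g : Hom x y} (σ : Hom₂ f g) :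
    (data F).vcomp ((data F).id₂ f) σ = σ := by
  rw [id₂_eq f _ rfl]
  refine (vcomp_eq _ σ σ.base (Category.id_comp _)).trans ?_
  exact congrArg (Hom₂.mk _) (id_elVcomp σ.fiber (Category.id_comp _))

lemma vcomp_id {x y : El F} {f g : Hom x y} (σ : Hom₂ f g) :
    (data F).vcomp σ ((data F).id₂ g) = σ := by
  rw [id₂_eq g _ rfl]
  refine (vcomp_eq σ _ σ.base (Category.comp_id _)).trans ?_
  exact congrArg (Hom₂.mk _) (elVcomp_id σ.fiber (Category.comp_id _))

lemma vcomp_assoc {x y : El F} {f g h k : Hom x y} (σ : Hom₂ f g) (τ : Hom₂ g h) (υ : Hom₂ h k) :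
    (data F).vcomp ((data F).vcomp σ τ) υ = (data F).vcomp σ ((data F).vcomp τ υ) := by
  rw [vcomp_eq σ τ _ rfl, vcomp_eq τ υ _ rfl]
  refine (vcomp_eq _ υ _ (Category.assoc _ _ _)).trans
    (Eq.trans ?_ (vcomp_eq σ _ _ rfl).symm)
  exact congrArg (Hom₂.mk _) (elVcomp_assoc σ.fiber τ.fiber υ.fiber)

/-- A 2-cell of `el F` whose two components are invertible has a left inverse of the same kind. -/
lemma exists_left_inverse {x y : El F} {f g : Hom x y} (σ : Hom₂ f g) [IsIso σ.base]
    [IsIso σ.fiber] :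
    ∃ τ : Hom₂ g f, IsIso τ.base ∧ IsIso τ.fiber ∧ (data F).vcomp τ σ = (data F).id₂ g := by
  refine ⟨⟨inv σ.base, (F.actId (𝟙 g.base) rfl g.fiber).inv ≫
    (F.actComp (inv σ.base) σ.base (𝟙 g.base) (IsIso.inv_hom_id _) g.fiber).inv ≫
      inv σ.fiber ▷ F.app (inv σ.base) y.fiber⟩, inferInstance, inferInstance, ?_⟩
  rw [id₂_eq g _ rfl]
  refine (vcomp_eq _ σ (𝟙 g.base) (IsIso.inv_hom_id _)).trans ?_
  refine congrArg (Hom₂.mk _) ?_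
  simp only [Category.assoc]
  rw [← comp_whiskerRight_assoc, IsIso.inv_hom_id, id_whiskerRight, Category.id_comp,
    Iso.inv_hom_id, Category.comp_id]

/-- A 2-cell of `el F` with invertible components is invertible: its left inverse has a left inverse
too. -/
lemma isInvertible {x y : El F} {f g : Hom x y} (σ : Hom₂ f g) (h₁ : IsIso σ.base)
    (h₂ : IsIso σ.fiber) : (data F).IsInvertible σ := by
  obtain ⟨τ, _, _, e⟩ := exists_left_inverse σ
  obtain ⟨υ, _, _, e'⟩ := exists_left_inverse τ
  have : υ = σ := by
    rw [← vcomp_id υ, ← e, ← vcomp_assoc, e', id_vcomp]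
  exact ⟨τ, this ▸ e', e⟩

lemma isBicategory : (data F).IsBicategory where
  id_vcomp := id_vcomp
  vcomp_id := vcomp_id
  vcomp_assoc := vcomp_assoc
  hcomp_id {x y z} f g := by
    have e : hcomp₂ (𝟙 f.base) (𝟙 g.base) = 𝟙 (f.base ≫ g.base) := by simp [hcomp₂]
    refine Eq.trans ?_ (id₂_eq _ _ e).symm
    exact congrArg (Hom₂.mk _) (elHcomp_id F.isTrihom f.fiber g.fiber)
  hcomp_vcomp {x y z f f' f'' g g' g''} α α' β β' := by
    have e : hcomp₂ α.base β.base ≫ hcomp₂ α'.base β'.base =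
        hcomp₂ (α.base ≫ α'.base) (β.base ≫ β'.base) := by
      simp [hcomp₂, whisker_exchange_assoc]
    refine Eq.trans ?_ (vcomp_eq _ _ _ e).symm
    exact congrArg (Hom₂.mk _) (elHcomp_vcomp F.isTrihom α.fiber α'.fiber β.fiber β'.fiber)
  assoc_natural {x y z t f f' g g' h h'} α β γ := by
    refine (vcomp_eq _ _ _ rfl).trans (Eq.trans ?_ (vcomp_eq _ _
      (hcomp₂ (hcomp₂ α.base β.base) γ.base ≫ (α_ f'.base g'.base h'.base).hom)
      (hcomp₂_associator α.base β.base γ.base)).symm)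
    exact congrArg (Hom₂.mk _) (elAssoc_natural F.isTrihom α.fiber β.fiber γ.fiber)
  unitDom_natural {x y f f'} α := by
    have e : hcomp₂ (𝟙 (𝟙 x.base)) α.base ≫ (λ_ f'.base).hom = (λ_ f.base).hom ≫ α.base := by
      simp [hcomp₂]
    refine (vcomp_eq _ _ _ e).trans (Eq.trans ?_ (vcomp_eq _ _ _ rfl).symm)
    exact congrArg (Hom₂.mk _) (elUnitDom_natural F.isTrihom α.fiber _ e rfl)
  unitCod_natural {x y f f'} α := by
    have e : (ρ_ f.base).inv ≫ hcomp₂ α.base (𝟙 (𝟙 y.base)) = α.base ≫ (ρ_ f'.base).inv := by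
      simp [hcomp₂]
    refine (vcomp_eq _ _ _ rfl).trans (Eq.trans ?_ (vcomp_eq _ _ _ e).symm)
    exact congrArg (Hom₂.mk _) (elUnitCod_natural F.isTrihom α.fiber e)
  assoc_invertible f g h := by
    refine isInvertible _ (inferInstanceAs (IsIso (α_ f.base g.base h.base).hom)) ?_
    change IsIso (F.elAssoc f.fiber g.fiber h.fiber)
    rw [elAssoc_eq]
    infer_instance
  unitDom_invertible f := by
    refine isInvertible _ (inferInstanceAs (IsIso (λ_ f.base).hom)) ?_
    change IsIso (F.elUnitDom f.fiber)
    rw [elUnitDom_eq]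
    infer_instance
  unitCod_invertible f := by
    refine isInvertible _ (inferInstanceAs (IsIso (ρ_ f.base).inv)) ?_
    change IsIso (F.elUnitCod f.fiber)
    rw [elUnitCod_eq]
    infer_instance
  pentagon {x y z t s} f g h k := by
    have e : (hcomp₂ (α_ f.base g.base h.base).hom (𝟙 k.base) ≫
        (α_ f.base (g.base ≫ h.base) k.base).hom) ≫
          hcomp₂ (𝟙 f.base) (α_ g.base h.base k.base).hom =
        (α_ (f.base ≫ g.base) h.base k.base).hom ≫ (α_ f.base g.base (h.base ≫ k.base)).hom := by
      simp [hcomp₂]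
    refine (congrArg (fun σ => (data F).vcomp σ _) (vcomp_eq _ _ _ rfl)).trans ?_
    refine (vcomp_eq _ _ _ e).trans (Eq.trans ?_ (vcomp_eq _ _ _ rfl).symm)
    refine congrArg (Hom₂.mk _) (Eq.trans ?_
      (elPentagon F.isTrihom f.fiber g.fiber h.fiber k.fiber _ rfl e))
    exact (Category.assoc _ _ _).trans (congrArg (_ ≫ ·) (Category.assoc _ _ _))
  triangle {x y z} f g := by
    have e : hcomp₂ (ρ_ f.base).inv (𝟙 g.base) ≫ (α_ f.base (𝟙 y.base) g.base).hom ≫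
        hcomp₂ (𝟙 f.base) (λ_ g.base).hom = 𝟙 (f.base ≫ g.base) := by
      simp [hcomp₂]
    refine (vcomp_assoc _ _ _).trans
      ((congrArg (fun σ => (data F).vcomp _ σ) (vcomp_eq _ _ _ rfl)).trans ?_)
    refine (vcomp_eq _ _ _ e).trans (congrArg (Hom₂.mk _) (Eq.trans ?_
      (elTriangle F.isTrihom f.fiber g.fiber e)))
    simp only [comp_whiskerRight, Category.assoc]
    rfl

/-! ### Cartesian cells -/

lemma fiber_eq {x y : El F} {f g : Hom x y} {γ : f.base ⟶ g.base}
    {s t : f.fiber ⟶ g.fiber ≫ F.app γ y.fiber} (h : (⟨γ, s⟩ : Hom₂ f g) = ⟨γ, t⟩) : s = t := by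
  injection h

/-- A 2-cell with invertible fibre component has the universal property of a cartesian 2-cell. -/
lemma existsUnique_vcomp {x y : El F} {f g h : Hom x y} (σ : Hom₂ g h) [IsIso σ.fiber]
    (τ : Hom₂ f h) (γ : f.base ⟶ g.base) (e : γ ≫ σ.base = τ.base) :
    ∃! ρ : Hom₂ f g, ρ.base = γ ∧ (data F).vcomp ρ σ = τ := by
  refine ⟨⟨γ, τ.fiber ≫ (F.actComp γ σ.base τ.base e h.fiber).inv ≫
    inv σ.fiber ▷ F.app γ y.fiber⟩, ⟨rfl, ?_⟩, ?_⟩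
  · refine (vcomp_eq _ σ _ e).trans (congrArg (Hom₂.mk _) ?_)
    simp [← comp_whiskerRight_assoc]
  · rintro ⟨γ', t⟩ ⟨rfl, h⟩
    replace h := fiber_eq ((vcomp_eq _ σ _ e).symm.trans h)
    refine congrArg (Hom₂.mk _) ?_
    rw [← h]
    simp [← comp_whiskerRight]

/-- If a 2-cell of `el F` has the universal property of a cartesian 2-cell, then its fibre
component is invertible. -/
lemma isIso_fiber {x y : El F} {g h : Hom x y} (σ : Hom₂ g h)
    (u : ∀ {f : Hom x y} (τ : Hom₂ f h) (γ : f.base ⟶ g.base), γ ≫ σ.base = τ.base →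
      ∃! ρ : Hom₂ f g, ρ.base = γ ∧ (data F).vcomp ρ σ = τ) : IsIso σ.fiber := by
  -- Compare `σ` with the 2-cell `(σ, 1)`, which has the same first component.
  obtain ⟨⟨γ, s⟩, ⟨hγ, hs⟩, -⟩ := u (lift₂ h σ.base) (𝟙 g.base) (Category.id_comp _)
  dsimp only at hγ
  subst hγ
  let l : Hom x y := ⟨g.base, h.fiber ≫ F.app σ.base y.fiber⟩
  have v := vcomp_eq (⟨𝟙 g.base, s⟩ : Hom₂ l g) σ σ.base (Category.id_comp _)
  replace hs : _ = 𝟙 (h.fiber ≫ F.app σ.base y.fiber) := fiber_eq (v.symm.trans hs)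
  rw [actComp_id_left (𝟙 g.base) rfl, act₁₀_natural] at hs
  -- By uniqueness the comparison is also inverse to `σ` on the other side.
  have i : (⟨𝟙 g.base, σ.fiber ≫ s⟩ : Hom₂ g g) = (data F).id₂ g := by
    refine (u σ (𝟙 g.base) (Category.id_comp _)).unique ⟨rfl, ?_⟩ ⟨rfl, id_vcomp σ⟩
    refine (vcomp_eq _ σ σ.base (Category.id_comp _)).trans (congrArg (Hom₂.mk _) ?_)
    dsimp only
    rw [actComp_id_left (𝟙 g.base) rfl, act₁₀_natural, Category.assoc, hs]
    exact Category.comp_id _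
  replace i := fiber_eq (i.trans (id₂_eq g _ rfl))
  refine ⟨s ≫ (F.actId (𝟙 g.base) rfl g.fiber).hom, ?_, ?_⟩
  · rw [← Category.assoc, i, Iso.inv_hom_id]
  · rw [Category.assoc, hs]

lemma isIso_hcomp_fiber {x y z : El F} {f f' : Hom x y} {g g' : Hom y z} (σ : Hom₂ f f')
    (τ : Hom₂ g g') [IsIso σ.fiber] [IsIso τ.fiber] :
    IsIso (F.elHcomp σ.fiber τ.fiber) := by
  rw [elHcomp_eq, elHcompAct, elWhisk]
  infer_instance

/-- The bicategory `el F`. -/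
noncomputable instance : Bicategory (El F) := BicategoryData.toBicategory isBicategory

variable (F) in
/-- The projection of `el F`, as a homomorphism. -/
noncomputable abbrev projHom : El F ⥤ᵖ B := (proj F isBicategory).toPseudofunctor

open Bifib

variable (F) in
/-- The functor from a hom-category of `el F` to the corresponding hom-category of `B`. -/
noncomputable abbrev homFunctor (x y : El F) : (x ⟶ y) ⥤ (x.base ⟶ y.base) :=
  (projHom F).mapFunctor x y

lemma isHomLift_iff {x y : El F} {f g : x ⟶ y} (γ : (homFunctor F x y).obj f ⟶
    (homFunctor F x y).obj g) (σ : f ⟶ g) :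
    (homFunctor F x y).IsHomLift γ σ ↔ Hom₂.base σ = γ := by
  constructor
  · intro h
    exact (IsHomLift.eq_of_isHomLift (homFunctor F x y) γ σ).symm
  · rintro rfl
    exact inferInstanceAs ((homFunctor F x y).IsHomLift ((homFunctor F x y).map σ) σ)

lemma isCartesian₂_of_isIso {x y : El F} {f g : x ⟶ y} (σ : f ⟶ g) (h : IsIso (Hom₂.fiber σ)) :
    IsCartesian₂ (projHom F) σ :=
  { toIsHomLift := (isHomLift_iff _ σ).2 rfl
    universal_property' := by
      intro k γ τ hτ
      obtain ⟨ρ, ⟨h₁, h₂⟩, u⟩ := existsUnique_vcomp σ τ γ ((isHomLift_iff _ τ).1 hτ).symm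
      exact ⟨ρ, ⟨(isHomLift_iff γ ρ).2 h₁, h₂⟩,
        fun ρ' h' => u ρ' ⟨(isHomLift_iff γ ρ').1 h'.1, h'.2⟩⟩ }

/-- The converse of `isCartesian₂_of_isIso`. -/
lemma isIso_of_isCartesian₂ {x y : El F} {f g : x ⟶ y} (σ : f ⟶ g)
    (h : IsCartesian₂ (projHom F) σ) : IsIso (Hom₂.fiber σ) := by
  refine isIso_fiber σ fun {k} τ γ e => ?_
  change (homFunctor F x y).obj k ⟶ (homFunctor F x y).obj f at γ
  have : (homFunctor F x y).IsHomLift (γ ≫ (homFunctor F x y).map σ) τ :=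
    (isHomLift_iff _ τ).2 e.symm
  obtain ⟨ρ, ⟨h₁, h₂⟩, u⟩ := @h.universal_property' k γ τ this
  exact ⟨ρ, ⟨(isHomLift_iff γ ρ).1 h₁, h₂⟩,
    fun ρ' h' => u ρ' ⟨(isHomLift_iff γ ρ').2 h'.1, h'.2⟩⟩

lemma isCartesian₂_lift₂ {x y : El F} (g : Hom x y) {f : x.base ⟶ y.base} (α : f ⟶ g.base) :
    IsCartesian₂ (projHom F) (lift₂ g α) :=
  isCartesian₂_of_isIso _ (inferInstanceAs (IsIso (𝟙 (g.fiber ≫ F.app α y.fiber))))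

/-- The horizontal composite defined by whiskering in `el F` is the one in the data of `el F`. -/
lemma hcomp₂_eq {x y z : El F} {f f' : x ⟶ y} {g g' : y ⟶ z} (σ : f ⟶ f') (τ : g ⟶ g') :
    hcomp₂ σ τ = (data F).hcomp σ τ := by
  change (data F).vcomp ((data F).hcomp σ ((data F).id₂ g)) ((data F).hcomp ((data F).id₂ f') τ) = _
  rw [← isBicategory.hcomp_vcomp, isBicategory.vcomp_id, isBicategory.id_vcomp]

/-- A 2-cell of `el F` with invertible components, as an isomorphism. -/
noncomputable def isoMk {x y : El F} {f g : x ⟶ y} (σ : Hom₂ f g) (h₁ : IsIso σ.base)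
    (h₂ : IsIso σ.fiber) : f ≅ g :=
  BicategoryData.isoOf isBicategory σ (isInvertible σ h₁ h₂)

/-- Whiskering with `(f, 1)` is fully faithful over the whiskering with `f`. -/
lemma existsUnique_hcomp_lift₁ {b : B} (y : El F) (f : b ⟶ y.base) {z : El F}
    {p q : Hom z ⟨b, (F.map f).obj y.fiber⟩} (γ : p.base ⟶ q.base)
    (τ : (data F).Hom₂ ((data F).comp p (lift₁ y f)) ((data F).comp q (lift₁ y f)))
    (e : hcomp₂ γ (𝟙 f) = Hom₂.base τ) :
    ∃! ρ : Hom₂ p q, ρ.base = γ ∧ (data F).hcomp ρ ((data F).id₂ (lift₁ y f)) = τ := by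
  obtain ⟨θ, t⟩ := τ
  change hcomp₂ γ (𝟙 f) = θ at e
  subst e
  obtain ⟨s, hs, u⟩ := (elHcomp_id_bijective f p.fiber q.fiber γ).existsUnique t
  refine ⟨⟨γ, s⟩, ⟨rfl, congrArg (Hom₂.mk _) hs⟩, ?_⟩
  rintro ⟨γ', s'⟩ ⟨rfl, h⟩
  exact congrArg (Hom₂.mk _) (u s' (fiber_eq h))

/-- The first components in the universal property of a cartesian 1-cell: a 2-cell `k₁ ⟶ k₂` over
`δ` is compatible with the comparison cells of the lifts. The identities in the hypotheses are the
composition constraints of the strict projection. -/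
lemma base_whiskerRight_eq {a b c : B} {h₁ h₂ k₁ k₂ : a ⟶ b} {f : b ⟶ c} {g₁ g₂ : a ⟶ c}
    (β₁ : k₁ ≅ h₁) (β₂ : k₂ ≅ h₂) {α₁ : h₁ ≫ f ⟶ g₁} {α₂ : h₂ ≫ f ⟶ g₂} {α₁' : k₁ ≫ f ⟶ g₁}
    (α₂' : k₂ ≫ f ≅ g₂) {σ : g₁ ⟶ g₂} {δ : h₁ ⟶ h₂} (l₁ : β₁.hom ▷ f ≫ α₁ = 𝟙 _ ≫ α₁')
    (l₂ : β₂.hom ▷ f ≫ α₂ = 𝟙 _ ≫ α₂'.hom) (e : δ ▷ f ≫ α₂ = α₁ ≫ σ) :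
    hcomp₂ (β₁.hom ≫ δ ≫ β₂.inv) (𝟙 f) = α₁' ≫ σ ≫ α₂'.inv := by
  rw [Category.id_comp] at l₁ l₂
  rw [← Category.assoc α₁', Iso.eq_comp_inv, ← l₁, ← l₂, Category.assoc, ← e]
  simp [hcomp₂]

lemma isCartesian₁_lift₁ {b : B} (y : El F) (f : b ⟶ y.base) :
    IsCartesian₁ (projHom F) (lift₁ y f) where
  exists_lift {z} (g : Hom z y) (h : z.base ⟶ b) (α : h ≫ f ≅ g.base) := by
    obtain ⟨p, ⟨i⟩⟩ := exists_elComp_id_iso h f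
      (Hom.fiber g ≫ F.app α.hom y.fiber)
    let h' : Hom z ⟨b, (F.map f).obj y.fiber⟩ := ⟨h, p⟩
    let σ : Hom₂ (⟨h ≫ f, F.elComp p (𝟙 _)⟩ : Hom z y) g := ⟨α.hom, i.hom⟩
    refine ⟨h', isoMk σ (inferInstanceAs (IsIso α.hom)) (inferInstanceAs (IsIso i.hom)),
      Iso.refl _, ?_⟩
    change 𝟙 h ▷ f ≫ α.hom = 𝟙 (h ≫ f) ≫ α.hom
    rw [id_whiskerRight]
  existsUnique_lift {z g₁ g₂} σ {h₁ h₂} α₁ α₂ {h₁' h₂'} α₁' β₁' α₂' β₂' l₁ l₂ δ e := by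
    obtain ⟨ρ, ⟨e₁, e₂⟩, u⟩ := existsUnique_hcomp_lift₁ y f (p := h₁') (q := h₂')
      (β₁'.hom ≫ δ ≫ β₂'.inv) (α₁'.hom ≫ σ ≫ α₂'.inv)
      (base_whiskerRight_eq β₁' β₂' ((projHom F).map₂Iso α₂') l₁ l₂ e)
    have c₁ (δ' : h₁' ⟶ h₂') : δ' ▷ lift₁ y f ≫ α₂'.hom = α₁'.hom ≫ σ ↔
        (data F).hcomp δ' ((data F).id₂ (lift₁ y f)) = α₁'.hom ≫ σ ≫ α₂'.inv := by
      rw [← Category.assoc]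
      exact (Iso.eq_comp_inv α₂').symm
    have c₂ (δ' : h₁' ⟶ h₂') : β₁'.hom ≫ δ = (projHom F).map₂ δ' ≫ β₂'.hom ↔
        Hom₂.base δ' = β₁'.hom ≫ δ ≫ β₂'.inv := by
      rw [← Category.assoc]
      exact eq_comm.trans (Iso.eq_comp_inv β₂').symm
    exact ⟨ρ, ⟨(c₁ ρ).2 e₂, (c₂ ρ).2 e₁⟩, fun ρ' h' => u ρ' ⟨(c₂ ρ').1 h'.2, (c₁ ρ').1 h'.1⟩⟩

/-- Replacing a lift `k` of `h` by `h` itself yields a lift with identity comparison. -/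
lemma base_lift_eq {a b c : B} {h k : a ⟶ b} {f : b ⟶ c} {g : a ⟶ c} (β : k ≅ h)
    {α : h ≫ f ⟶ g} {α' : k ≫ f ⟶ g} (l : β.hom ▷ f ≫ α = 𝟙 _ ≫ α') :
    𝟙 h ▷ f ≫ α = 𝟙 (h ≫ f) ≫ hcomp₂ β.inv (𝟙 f) ≫ α' := by
  rw [Category.id_comp] at l
  rw [← l]
  simp [hcomp₂]

lemma hasStrictLifts : HasStrictLifts (projHom F) := by
  intro x y z f hf g h α
  obtain ⟨h', α', β', l⟩ := hf.exists_lift g h α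
  change z.base ⟶ x.base at h
  change Hom z x at h'
  change h'.base ≅ h at β'
  -- The lift is corrected by the cartesian 2-cell over the inverse of `β'`.
  let r : z ⟶ x := (⟨h, h'.fiber ≫ F.app β'.inv x.fiber⟩ : Hom z x)
  let i : r ≅ h' := isoMk (lift₂ h' β'.inv) (inferInstanceAs (IsIso β'.inv))
    (inferInstanceAs (IsIso (𝟙 (Hom.fiber h' ≫ F.app β'.inv x.fiber))))
  exact ⟨r, whiskerRightIso i f ≪≫ α', rfl, base_lift_eq β' l⟩

lemma isFibration : IsFibration (projHom F) where
  exists_cartesian {e b} f := ⟨_, lift₁ e f, isCartesian₁_lift₁ e f, rfl⟩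
  locally_fibred x y := Functor.IsFibered.of_exists_isStronglyCartesian fun g _ α =>
    ⟨_, lift₂ g α, isCartesian₂_lift₂ g α⟩
  hcomp_cartesian {x y z f f' g g'} σ τ hσ hτ := by
    have := isIso_of_isCartesian₂ σ hσ
    have := isIso_of_isCartesian₂ τ hτ
    rw [hcomp₂_eq]
    exact isCartesian₂_of_isIso _ (isIso_hcomp_fiber σ τ)

end El

theorem mainTheorem4 {B : Type u₁} [Bicategory.{w₁, v₁} B]
    (F : Trihomomorphism.{w₁, w₂, v₁, v₂, u₁, u₂} B) :
    ∃ H : (El.data F).IsBicategory,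
      letI := BicategoryData.toBicategory H
      letI P : StrictPseudofunctor (El F) B := El.proj F H
      Bifib.IsFibration P.toPseudofunctor ∧ Bifib.HasStrictLifts P.toPseudofunctor ∧
        (∀ {x : B} (y : El F) (f : x ⟶ y.base),
          Bifib.IsCartesian₁ P.toPseudofunctor (El.lift₁ y f)) ∧
        (∀ {x y : El F} (g : El.Hom x y) {f : x.base ⟶ y.base} (α : f ⟶ g.base),
          Bifib.IsCartesian₂ P.toPseudofunctor (El.lift₂ g α)) :=
  ⟨El.isBicategory, El.isFibration, El.hasStrictLifts, El.isCartesian₁_lift₁,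
    El.isCartesian₂_lift₂⟩
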